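/- Proposition 4.3. Let $\mathcal A=C^\infty(\mathbb C^n)$ be the algebra of complex-valued functions on $\mathbb C^n$ that are smooth in the real sense, and let $\sum h_{i\bar j}\,dz^i\otimes d\bar z^j$ be a Kähler metric on $\mathbb C^n$ (smooth, Hermitian, positive definite, with closed fundamental form). Put $H=(h_{i\bar j})$, and let $(h^{i\bar j})$ be the inverse metric, $\sum_j h^{i\bar j}h_{k\bar j}=\delta^i_k$. Write $\partial_i=\partial/\partial z^i$, $\bar\partial_j=\partial/\partial\bar z^j$, and let $d\mu_\hbar=\det H\prod_{i=1}^n\frac{|dz^i\wedge d\bar z^i|}{2\pi\hbar}$. For a Kähler potential $\Phi$ ($h_{i\bar j}=\partial_i\bar\partial_j\Phi$), the Calabi function $\phi(z,\bar z;v,\bar v)=\Phi(z,\bar v)+\Phi(v,\bar z)-\Phi(z,\bar z)-\Phi(v,\bar v)$ has at $v=z$ the formal expansion $$\phi=-\sum_{|I|,|J|\ge 1}\frac{1}{I!\,J!}\,\Phi_{I\bar J}(z,\bar z)\,(v-z)^I(\bar v-\bar z)^J,$$ where $\Phi_{I\bar J}=\partial^I\bar\partial^J\Phi=\partial^{I'}\bar\partial^{J'}h_{i_1\bar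 j_1}$ (with $I'=I\setminus\{i_1\}$, $J'=J\setminus\{j_1\}$) depends only on the metric. The non-normalized product $\bullet$ on $\mathcal A[[\hbar]]$ is the $\mathbb C[[\hbar]]$-bilinear product, computed $\hbar$-coefficient by $\hbar$-coefficient, given for $f_1,f_2\in\mathcal A$ by the formal integral $$(f_1\bullet f_2)(z,\bar z)=\int_{\mathbb C^n}f_1(z,\bar v)f_2(v,\bar z)\,e^{\phi(z,\bar z;v,\bar v)/\hbar}\,d\mu_\hbar(v,\bar v),$$ that is: substitute $v=z+\epsilon y$, $\hbar=\epsilon^2$, replace $f_1(z,\bar z+\epsilon\bar y)$, $f_2(z+\epsilon y,\bar z)$, $\det H(z+\epsilon y,\bar z+\epsilon\bar y)$ and $\phi(z,\bar z;z+\epsilon y,\bar z+\epsilon\bar y)/\epsilon^2$ by their formal Taylor expansions, expand everything except the factor $e^{-\sum h_{i\bar j}(z)y^i\bar y^j}$ in powers of $\epsilon$, and integrate term by term over $y\in\mathbb C^n$. Then $\bullet$ is well defined as a map $\mathcal A[[\hbar]]\times\mathcal A[[\hbar]]\to\mathcal A[[\hbar]]$. There is exactly one $e_\hbar\in\mathcal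 A[[\hbar]]$ with $e_\hbar\bullet f=f\bullet e_\hbar=f$ for all $f\in\mathcal A$, and $e_\hbar$ is invertible for the pointwise product of $\mathcal A[[\hbar]]$. The normalized product $$f_1\star f_2=e_\hbar^{-1}\big((f_1e_\hbar)\bullet(f_2e_\hbar)\big)$$ is $\mathbb C[[\hbar]]$-bilinear (in particular $\mathbb C$-bilinear) and associative on $\mathcal A[[\hbar]]$, and has the unit $1$. For all $f_1,f_2\in\mathcal A[[\hbar]]$ (with $\partial_i,\bar\partial_j$ acting coefficientwise), $$f_1\star f_2=f_1f_2+\hbar\sum_{i,j=1}^n h^{i\bar j}\,\bar\partial_jf_1\,\partial_if_2+O(\hbar^2).$$ Moreover, let $\mathcal A_c[[\hbar]]$ be the space of the $f\in\mathcal A[[\hbar]]$ all of whose coefficients have compact support. Then $$\operatorname{tr}(f)=\int_{\mathbb C^n}e_\hbar f\,d\mu_\hbar$$ is a $\mathbb C[[\hbar]]$-linear functional on $\mathcal A_c[[\hbar]]$ with values in the formal Laurent series $\mathbb C[\hbar^{-1},\hbar]]$, and for all $f_1,f_2\in\mathcal A_c[[\hbar]]$ one has $f_1\star f_2\in\mathcal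 A_c[[\hbar]]$ and $\operatorname{tr}(f_1\star f_2)=\operatorname{tr}(f_2\star f_1)$. -/

import Mathlib

open MeasureTheory
open scoped ContDiff ComplexOrder

noncomputable section

namespace FormalKahler

/-- The algebra `𝒜 = C^∞(ℂⁿ)` of complex valued functions on `ℂⁿ` that are smooth in the real sense,
with pointwise operations. -/
def smoothFunctions (n : ℕ) : Subalgebra ℂ ((Fin n → ℂ) → ℂ) where
  carrier := {f | ContDiff ℝ ∞ f}
  mul_mem' {f g} (hf : ContDiff ℝ ∞ f) (hg : ContDiff ℝ ∞ g) := hf.mul hg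
  add_mem' {f g} (hf : ContDiff ℝ ∞ f) (hg : ContDiff ℝ ∞ g) := hf.add hg
  algebraMap_mem' c := (contDiff_const : ContDiff ℝ ∞ fun _ : Fin n → ℂ => c)

/-- `𝒜 = C^∞(ℂⁿ)` as a type. -/
abbrev Smooth (n : ℕ) : Type := smoothFunctions n

/-- `𝒜[[ħ]]`; the variable `PowerSeries.X` is `ħ`. -/
abbrev FormalSmooth (n : ℕ) : Type := PowerSeries (Smooth n)

/-- The combination `(D_u f + c D_v f) / 2` of two directional derivatives of a smooth function. -/
def halfDir {n : ℕ} (u v : Fin n → ℂ) (c : ℂ) : Smooth n →ₗ[ℂ] Smooth n where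
  toFun f := ⟨fun z => (fderiv ℝ f.1 z u + c * fderiv ℝ f.1 z v) / 2, by
    have hf : ContDiff ℝ ∞ f.1 := f.2
    have h1 : ∀ w : Fin n → ℂ, ContDiff ℝ ∞ fun z => fderiv ℝ f.1 z w := fun w =>
      (hf.fderiv_right (m := ∞) (by simp)).clm_apply contDiff_const
    exact ((h1 u).add (contDiff_const.mul (h1 v))).div_const 2⟩
  map_add' f g := by
    ext z
    have hf : DifferentiableAt ℝ f.1 z := ContDiff.differentiable (n := ∞) (show ContDiff ℝ ∞ f.1 from f.2) (by simp) z
    have hg : DifferentiableAt ℝ g.1 z := ContDiff.differentiable (n := ∞) (show ContDiff ℝ ∞ g.1 from g.2) (by simp) z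
    have : fderiv ℝ (f.1 + g.1) z = fderiv ℝ f.1 z + fderiv ℝ g.1 z := fderiv_add hf hg
    simp only [Subalgebra.coe_add, Pi.add_apply, this, add_apply]
    ring
  map_smul' a f := by
    ext z
    have hf : DifferentiableAt ℝ f.1 z := ContDiff.differentiable (n := ∞) (show ContDiff ℝ ∞ f.1 from f.2) (by simp) z
    have : fderiv ℝ (a • f.1) z = a • fderiv ℝ f.1 z := fderiv_const_smul hf a
    simp only [SetLike.val_smul, Pi.smul_apply, this, smul_apply, smul_eq_mul,
      RingHom.id_apply]
    ring

/-- `∂_i = ∂/∂z^i = (∂/∂x^i - √-1 ∂/∂y^i) / 2`. -/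
def dz {n : ℕ} (i : Fin n) : Smooth n →ₗ[ℂ] Smooth n :=
  halfDir (Pi.single i 1) (Pi.single i Complex.I) (-Complex.I)

/-- `∂̄_i = ∂/∂z̄^i = (∂/∂x^i + √-1 ∂/∂y^i) / 2`. -/
def dzbar {n : ℕ} (i : Fin n) : Smooth n →ₗ[ℂ] Smooth n :=
  halfDir (Pi.single i 1) (Pi.single i Complex.I) Complex.I

/-- `∂_{i_1} ⋯ ∂_{i_p}` for a tuple of indices. -/
def dzs {n p : ℕ} (I : Fin p → Fin n) : Smooth n →ₗ[ℂ] Smooth n :=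
  (List.ofFn fun k => (dz (I k) : Module.End ℂ (Smooth n))).prod

/-- `∂̄_{j_1} ⋯ ∂̄_{j_q}` for a tuple of indices. -/
def dzbars {n q : ℕ} (J : Fin q → Fin n) : Smooth n →ₗ[ℂ] Smooth n :=
  (List.ofFn fun k => (dzbar (J k) : Module.End ℂ (Smooth n))).prod

/-- The value of a matrix of smooth functions at the point `z`. -/
def matAt {n : ℕ} (h : Matrix (Fin n) (Fin n) (Smooth n)) (z : Fin n → ℂ) :
    Matrix (Fin n) (Fin n) ℂ :=
  fun i j => (h i j).1 z

/-- A Kähler metric `∑ h_{i j̄} dz^i ⊗ dz̄^j` on `ℂⁿ`: smooth, Hermitian, positive definite, with closed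
fundamental form (the equations `∂̄_k h_{i j̄} = ∂̄_j h_{i k̄}` are the complex conjugates
of the field `closed`). -/
structure KahlerMetric (n : ℕ) where
  h : Matrix (Fin n) (Fin n) (Smooth n)
  posDef : ∀ z, (matAt h z).PosDef
  closed : ∀ i j k, dz k (h i j) = dz i (h k j)

lemma matAt_eq_map {n : ℕ} (h : Matrix (Fin n) (Fin n) (Smooth n)) (z : Fin n → ℂ) :
    matAt h z = ((Pi.evalRingHom (fun _ : Fin n → ℂ => ℂ) z).comp
      (smoothFunctions n).val.toRingHom).mapMatrix h := rfl

/-- The components `h^{i j̄}` of the inverse metric: `∑_j h^{i j̄} h_{k j̄} = δ^i_k`, so `h^{i j̄}` is the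
entry of `H⁻¹` in row `j` and column `i`. -/
def KahlerMetric.hInv {n : ℕ} (K : KahlerMetric n) (i j : Fin n) : Smooth n :=
  ⟨fun z => (matAt K.h z)⁻¹ j i, by
    have hdet : ∀ z, (matAt K.h z).det = K.h.det.1 z := fun z => by
      rw [matAt_eq_map, ← RingHom.map_det]; rfl
    have hadj : ∀ z, (matAt K.h z).adjugate j i = (K.h.adjugate j i).1 z := fun z => by
      rw [matAt_eq_map, ← RingHom.map_adjugate]; rfl
    have heq : (fun z => (matAt K.h z)⁻¹ j i)
        = fun z => (K.h.det.1 z)⁻¹ * (K.h.adjugate j i).1 z := by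
      funext z
      rw [Matrix.inv_def, Matrix.smul_apply, smul_eq_mul, Ring.inverse_eq_inv', hdet, hadj]
    have h1 : ContDiff ℝ ∞ K.h.det.1 := K.h.det.2
    have h2 : ContDiff ℝ ∞ (K.h.adjugate j i).1 := (K.h.adjugate j i).2
    change ContDiff ℝ ∞ _
    rw [heq]
    refine (h1.inv fun z => ?_).mul h2
    rw [← hdet]
    exact (K.posDef z).det_pos.ne'⟩

/-! ### Formal integrals -/

/-- Polynomials in `y^1, …, y^n` (variables `Sum.inl i`) and `ȳ^1, …, ȳ^n` (variables `Sum.inr j`). -/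
abbrev YPoly (n : ℕ) : Type := MvPolynomial (Fin n ⊕ Fin n) ℂ

/-- `y^{i_1} ⋯ y^{i_p}`. -/
def yMon {n p : ℕ} (I : Fin p → Fin n) : YPoly n := ∏ k, MvPolynomial.X (Sum.inl (I k))

/-- `ȳ^{j_1} ⋯ ȳ^{j_q}`. -/
def ybarMon {n q : ℕ} (J : Fin q → Fin n) : YPoly n := ∏ k, MvPolynomial.X (Sum.inr (J k))

/-- The Taylor expansion of `F(z, z̄ + ε ȳ)` in powers of `ε`. -/
def taylorBar {n : ℕ} (F : Smooth n) (z : Fin n → ℂ) : PowerSeries (YPoly n) :=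
  PowerSeries.mk fun q => ∑ J : Fin q → Fin n,
    MvPolynomial.C ((q.factorial : ℂ)⁻¹ * (dzbars J F).1 z) * ybarMon J

/-- The Taylor expansion of `F(z + ε y, z̄)` in powers of `ε`. -/
def taylorHol {n : ℕ} (F : Smooth n) (z : Fin n → ℂ) : PowerSeries (YPoly n) :=
  PowerSeries.mk fun p => ∑ I : Fin p → Fin n,
    MvPolynomial.C ((p.factorial : ℂ)⁻¹ * (dzs I F).1 z) * yMon I

/-- The Taylor expansion of `F(z + ε y, z̄ + ε ȳ)` in powers of `ε`. -/
def taylor {n : ℕ} (F : Smooth n) (z : Fin n → ℂ) : PowerSeries (YPoly n) :=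
  PowerSeries.mk fun m => ∑ pq ∈ Finset.HasAntidiagonal.antidiagonal m,
    ∑ I : Fin pq.1 → Fin n, ∑ J : Fin pq.2 → Fin n,
      MvPolynomial.C (((pq.1.factorial : ℂ) * (pq.2.factorial : ℂ))⁻¹ *
        (dzs I (dzbars J F)).1 z) * (yMon I * ybarMon J)

/-- The mixed derivatives `Φ_{i_0 … i_p j̄_0 … j̄_q} = ∂_{i_1} ⋯ ∂_{i_p} ∂̄_{j_1} ⋯ ∂̄_{j_q} h_{i_0 j̄_0}`
of (any) Kähler potential `Φ`, `h_{i j̄} = ∂_i ∂̄_j Φ`. At least one holomorphic and one antiholomorphic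
derivative is taken, so they depend on the metric only. -/
def KahlerMetric.potDeriv {n p q : ℕ} (K : KahlerMetric n)
    (I : Fin (p + 1) → Fin n) (J : Fin (q + 1) → Fin n) : Smooth n :=
  dzs (Fin.tail I) (dzbars (Fin.tail J) (K.h (I 0) (J 0)))

/-- The Calabi function
`φ(z, z̄; v, v̄) = Φ(z, v̄) + Φ(v, z̄) - Φ(z, z̄) - Φ(v, v̄)` has at `v = z` the formal expansion
`- ∑_{P, Q ≥ 1} (P! Q!)⁻¹ ∑ Φ_{i_1 … i_P j̄_1 … j̄_Q} (v-z)^{i_1} ⋯ (v-z)^{i_P} (v̄-z̄)^{j_1} ⋯ (v̄-z̄)^{j_Q}`.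
This is the expansion of `ε⁻² φ(z, z̄; z + ε y, z̄ + ε ȳ)` in powers of `ε`,
without its term of order `ε⁰`, which is `- ∑ h_{i j̄}(z) y^i ȳ^j`. (Here `P = p + 1`, `Q = q + 1`,
and the power of `ε` is `P + Q - 2 = p + q`.) -/
def KahlerMetric.calabiTail {n : ℕ} (K : KahlerMetric n) (z : Fin n → ℂ) :
    PowerSeries (YPoly n) :=
  PowerSeries.mk fun m => if m = 0 then 0 else
    -∑ pq ∈ Finset.HasAntidiagonal.antidiagonal m,
      ∑ I : Fin (pq.1 + 1) → Fin n, ∑ J : Fin (pq.2 + 1) → Fin n,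
        MvPolynomial.C ((((pq.1 + 1).factorial : ℂ) * ((pq.2 + 1).factorial : ℂ))⁻¹ *
          (K.potDeriv I J).1 z) * (yMon I * ybarMon J)

/-- The exponential `∑_r V^r / r!` of a formal power series `V` without constant term (for which the
terms `r > m` do not contribute to the coefficient of order `m`). -/
def formalExp {n : ℕ} (V : PowerSeries (YPoly n)) : PowerSeries (YPoly n) :=
  PowerSeries.mk fun m => ∑ r ∈ Finset.range (m + 1),
    MvPolynomial.C ((r.factorial : ℂ)⁻¹) * PowerSeries.coeff m (V ^ r)

/-- The Gaussian integral `π⁻ⁿ ∫_{ℂⁿ} P(y, ȳ) exp(-∑ H_{i j} y^i ȳ^j) ∏ |dy^i ∧ dȳ^i| / 2`; the measure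
`∏ |dy^i ∧ dȳ^i| / 2` is the Lebesgue measure of `ℂⁿ`. -/
def gaussianIntegral {n : ℕ} (H : Matrix (Fin n) (Fin n) ℂ) (P : YPoly n) : ℂ :=
  ((Real.pi : ℂ) ^ n)⁻¹ * ∫ y : Fin n → ℂ,
    MvPolynomial.eval (Sum.elim y fun j => (starRingEnd ℂ) (y j)) P *
      Complex.exp (-∑ i, ∑ j, H i j * y i * (starRingEnd ℂ) (y j))

/-- The coefficient of `ħ^k` in the formal integral
`∫ f₁(z, v̄) f₂(v, z̄) exp(φ(z, z̄; v, v̄) / ħ) dμ_ħ(v, v̄)`, where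
`dμ_ħ = det H ∏ |dv^i ∧ dv̄^i| / (2 π ħ)`: substitute `v = z + ε y`, `ε² = ħ`, expand in powers of `ε` and
integrate the coefficients, which are polynomials in `y, ȳ`, against the Gaussian. (The integrals of
the coefficients of odd powers of `ε` vanish, as these are odd polynomials.) -/
def KahlerMetric.laplaceCoeff {n : ℕ} (K : KahlerMetric n) (k : ℕ) (f₁ f₂ : Smooth n)
    (z : Fin n → ℂ) : ℂ :=
  gaussianIntegral (matAt K.h z) (PowerSeries.coeff (2 * k)
    (taylorBar f₁ z * taylorHol f₂ z * formalExp (K.calabiTail z) * taylor K.h.det z))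

/-- `B` is the non-normalized product `•` on `𝒜[[ħ]]`, that is
`(∑_a ħ^a f₁⁽ᵃ⁾) • (∑_b ħ^b f₂⁽ᵇ⁾) = ∑_{a, b} ħ^{a+b} ∫ f₁⁽ᵃ⁾(z, v̄) f₂⁽ᵇ⁾(v, z̄) e^{φ / ħ} dμ_ħ`.
There is at most one such `B`; that there is one means that the coefficients are smooth. -/
def KahlerMetric.IsBullet {n : ℕ} (K : KahlerMetric n)
    (B : FormalSmooth n → FormalSmooth n → FormalSmooth n) : Prop :=
  ∀ (f₁ f₂ : FormalSmooth n) (m : ℕ) (z : Fin n → ℂ),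
    (PowerSeries.coeff m (B f₁ f₂)).1 z =
      ∑ kc ∈ Finset.HasAntidiagonal.antidiagonal m, ∑ ab ∈ Finset.HasAntidiagonal.antidiagonal kc.2,
        K.laplaceCoeff kc.1 (PowerSeries.coeff ab.1 f₁) (PowerSeries.coeff ab.2 f₂) z

/-- `e` is a two-sided unit for the product `B`: `e • f = f • e = f` for all `f ∈ 𝒜`. -/
def IsUnitFor {n : ℕ} (B : FormalSmooth n → FormalSmooth n → FormalSmooth n)
    (e : FormalSmooth n) : Prop :=
  ∀ f : Smooth n, B e (PowerSeries.C f) = PowerSeries.C f ∧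
    B (PowerSeries.C f) e = PowerSeries.C f

/-- The normalized product `e⁻¹ ((f₁ e) • (f₂ e))`, for an invertible `e ∈ 𝒜[[ħ]]`. -/
def normalized {n : ℕ} (B : FormalSmooth n → FormalSmooth n → FormalSmooth n)
    (e f₁ f₂ : FormalSmooth n) : FormalSmooth n :=
  Ring.inverse e * B (f₁ * e) (f₂ * e)

/-- The inclusion `ℂ[[ħ]] → 𝒜[[ħ]]`. -/
def scalar (n : ℕ) : PowerSeries ℂ →+* FormalSmooth n :=
  PowerSeries.map (algebraMap ℂ (Smooth n))

/-- The extension of a linear operator on `𝒜` to `𝒜[[ħ]]`, coefficient by coefficient. -/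
def coeffwise {n : ℕ} (D : Smooth n →ₗ[ℂ] Smooth n) (f : FormalSmooth n) : FormalSmooth n :=
  PowerSeries.mk fun k => D (PowerSeries.coeff k f)

/-- `f ∈ 𝒜_c[[ħ]]`: every coefficient has compact support. -/
def CompactCoeffs {n : ℕ} (f : FormalSmooth n) : Prop :=
  ∀ k, HasCompactSupport (PowerSeries.coeff k f).1

/-- `tr(f) = ∫ e f dμ_ħ`, with `dμ_ħ = ħ⁻ⁿ π⁻ⁿ det H ∏ |dz^i ∧ dz̄^i| / 2`, a Laurent series in `ħ`. -/
def KahlerMetric.tr {n : ℕ} (K : KahlerMetric n) (e f : FormalSmooth n) : LaurentSeries ℂ :=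
  HahnSeries.single (-(n : ℤ)) 1 * HahnSeries.ofPowerSeries ℤ ℂ (PowerSeries.mk fun k =>
    ((Real.pi : ℂ) ^ n)⁻¹ * ∫ z : Fin n → ℂ, (PowerSeries.coeff k (e * f)).1 z * K.h.det.1 z)

end FormalKahler

end

open MeasureTheory
open scoped ContDiff ComplexOrder

noncomputable section

set_option linter.unusedSectionVars false

namespace FormalKahler

open PowerSeries Finset

/-! ### Operators on power series -/

section PowerSeriesOperators

variable {S T U : Type*} [CommRing S] [Algebra ℂ S] [CommRing T] [Algebra ℂ T]
  [CommRing U] [Algebra ℂ U]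

/-! The formal integral is purely algebraic. Adjoin to a ring of functions the displacements `y_i`,
`ȳ_j` as variables, let `A = ∑ y_i ∂_i`, `B = ∑ ȳ_j ∂̄_j`, `κ = ∑ h_{ij} y_i ȳ_j`, and write `X` for
`ε`. Taylor expansion is `exp(X A) exp(X B)`. With `E(x) = (e^x - 1)/x` the Calabi function divided
by `ε²` is `-E(X A) E(X B) κ`, because formally `κ = A B Φ`. The Gaussian integral is the functional
determined by integration by parts (`wick`), divided by `det H`. So everything takes place in a
`KahlerRing`, where polynomials can be adjoined freely; values in the ring itself give the
smoothness of the coefficients.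

The central fact is `derivation_gauss`: a derivation `D` of the base ring satisfies `D Γ(P) = Γ(D P
- (D κ) P)` for the Gaussian functional `Γ`, the normalization `1 / det H` being accounted for by
Jacobi's formula. Exponentiated (`transport`), it says how a formal integral changes when its base
point moves: the integrand is translated and acquires the factor `exp(κ - e^{X D} κ)`.

Associativity: by `transport` and Fubini both iterated products are Gaussian functionals in two sets
of variables. Their integrands are exchanged by a linear substitution that preserves the covariance
(`gauss2_shear`), because the exponents agree (`triple_exponent`). The latter is the additivity of
Calabi functions; without a potential it follows from the cocycle identity `ph_add`, whose
hypothesis is the closedness of the metric. The symmetry `y ↦ -y` kills odd powers of `ε`, so the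
product descends to `ħ = ε²` (`bullet`).

Unit and expansion: modulo `ħ` the product is the pointwise one, so multiplication by `1` on either
side is bijective; with associativity this yields the unit (`exists_unit`). In first order the only
term differentiating both factors is `∑ h^{ij} ∂̄_j f ∂_i g`, from the covariance of `y_i ȳ_j`; the
other terms disappear by the unit equation (`coeff_one_normalized`).

Trace: under the integral, translation by the displacement followed by its reversal exchanges the
two points of the Calabi function and hence the two factors. The translation changes nothing, since
integrals of derivatives of compactly supported functions vanish (`trace_bul`).

The analysis consists in identifying the genuine Gaussian integral with `Γ` at every point
(`gaussianIntegral_eq`) and the given Taylor series with exponentials of derivations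
(`laplaceCoeff_eq`). -/

/-- Additive maps of power series that commute with the multiplication by the variable. -/
structure IsXLinear (F : PowerSeries S → PowerSeries T) : Prop where
  add : ∀ f g, F (f + g) = F f + F g
  X_mul : ∀ f, F (X * f) = X * F f

namespace IsXLinear

lemma id : IsXLinear (fun f : PowerSeries S => f) := ⟨fun _ _ => rfl, fun _ => rfl⟩

lemma comp {F : PowerSeries T → PowerSeries U} {G : PowerSeries S → PowerSeries T}
    (hF : IsXLinear F) (hG : IsXLinear G) : IsXLinear fun f => F (G f) :=
  ⟨fun f g => by rw [hG.add, hF.add], fun f => by rw [hG.X_mul, hF.X_mul]⟩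

lemma mul_left {F : PowerSeries S → PowerSeries T} (hF : IsXLinear F) (g : PowerSeries T) :
    IsXLinear fun f => g * F f :=
  ⟨fun f g => by rw [hF.add, mul_add], fun f => by rw [hF.X_mul, mul_left_comm]⟩

lemma mul_right {F : PowerSeries S → PowerSeries T} (hF : IsXLinear F) (g : PowerSeries T) :
    IsXLinear fun f => F f * g :=
  ⟨fun f g => by rw [hF.add, add_mul], fun f => by rw [hF.X_mul, mul_assoc]⟩

lemma zero {F : PowerSeries S → PowerSeries T} (hF : IsXLinear F) : F 0 = 0 := by
  have := hF.add 0 0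
  simpa using this

/-- Two maps that are linear over the variable agree if they agree on the constants that occur. -/
theorem ext_on {F G : PowerSeries S → PowerSeries T} (hF : IsXLinear F) (hG : IsXLinear G)
    {J : Set S} (h : ∀ s ∈ J, F (C s) = G (C s)) {f : PowerSeries S} (hf : ∀ k, coeff k f ∈ J) :
    F f = G f := by
  -- Splitting off the constant term, on which the maps agree, exhibits the difference as `X` times
  -- the same difference for the shifted series; iteration makes it divisible by every power of `X`.
  have step : ∀ g : PowerSeries S, (∀ k, coeff k g ∈ J) →
      (F g - G g) = X * (F (PowerSeries.mk fun p => coeff (p + 1) g) - G (PowerSeries.mk fun p => coeff (p + 1) g)) := by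
    intro g hg
    have hg0 : g = X * (PowerSeries.mk fun p => coeff (p + 1) g) + C (constantCoeff g) :=
      sub_eq_iff_eq_add.1 (sub_const_eq_X_mul_shift g)
    conv_lhs => rw [hg0, hF.add, hG.add, hF.X_mul, hG.X_mul, h _ (by simpa using hg 0)]
    ring
  refine sub_eq_zero.1 ?_
  ext m
  induction m generalizing f with
  | zero => rw [step f hf]; simp
  | succ m ih =>
    rw [step f hf, coeff_succ_X_mul, ih (fun k => by simpa using hf (k + 1))]
    simp

theorem ext {F G : PowerSeries S → PowerSeries T} (hF : IsXLinear F) (hG : IsXLinear G)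
    (h : ∀ s, F (C s) = G (C s)) (f : PowerSeries S) : F f = G f :=
  hF.ext_on hG (J := Set.univ) (fun s _ => h s) fun _ => Set.mem_univ _

end IsXLinear

/-- A linear map applied to all coefficients. -/
def cw (L : S →ₗ[ℂ] T) : PowerSeries S →ₗ[ℂ] PowerSeries T where
  toFun f := mk fun k => L (coeff k f)
  map_add' f g := by ext; simp
  map_smul' a f := by ext; simp

@[simp] lemma coeff_cw (L : S →ₗ[ℂ] T) (f : PowerSeries S) (k : ℕ) :
    coeff k (cw L f) = L (coeff k f) := by simp [cw]

lemma coeff_csmul (c : ℂ) (f : PowerSeries S) (k : ℕ) : coeff k (c • f) = c • coeff k f := rfl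

lemma cw_isXLinear (L : S →ₗ[ℂ] T) : IsXLinear (cw L) :=
  ⟨map_add _, fun f => by ext m; cases m <;> simp [coeff_succ_X_mul]⟩

@[simp] lemma cw_C (L : S →ₗ[ℂ] T) (s : S) : cw L (C s) = C (L s) := by
  ext m; simp [coeff_C]; split_ifs <;> simp

@[simp] lemma cw_zero_map (f : PowerSeries S) : cw (0 : S →ₗ[ℂ] T) f = 0 := by ext; simp

lemma cw_derivation_mul (D : Derivation ℂ S S) (f g : PowerSeries S) :
    cw (D : S →ₗ[ℂ] S) (f * g) = cw (D : S →ₗ[ℂ] S) f * g + f * cw (D : S →ₗ[ℂ] S) g := by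
  ext m
  simp only [coeff_cw, coeff_mul, map_sum, map_add, Derivation.coeFn_coe, Derivation.leibniz,
    smul_eq_mul, ← sum_add_distrib]
  exact sum_congr rfl fun p _ => by ring

/-- An algebra homomorphism applied to all coefficients. -/
def pmap (φ : S →ₐ[ℂ] T) : PowerSeries S →+* PowerSeries T := PowerSeries.map (φ : S →+* T)

@[simp] lemma coeff_pmap (φ : S →ₐ[ℂ] T) (f : PowerSeries S) (k : ℕ) :
    coeff k (pmap φ f) = φ (coeff k f) := by simp [pmap]

@[simp] lemma pmap_C (φ : S →ₐ[ℂ] T) (s : S) : pmap φ (C s) = C (φ s) := by simp [pmap]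

lemma pmap_pmap (ψ : T →ₐ[ℂ] U) (φ : S →ₐ[ℂ] T) (f : PowerSeries S) :
    pmap ψ (pmap φ f) = pmap (ψ.comp φ) f := by ext; simp

lemma cw_map (φ : S →ₐ[ℂ] T) (f : PowerSeries S) :
    cw φ.toLinearMap f = pmap φ f := by ext; simp

lemma derivative_cw (L : S →ₗ[ℂ] T) (f : PowerSeries S) :
    derivative T (cw L f) = cw L (derivative S f) := by
  ext m
  have h1 : ∀ r : S, r * ((m : S) + 1) = ((m : ℂ) + 1) • r := fun r => by
    rw [Algebra.smul_def, mul_comm]; simp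
  have h2 : ∀ r : T, r * ((m : T) + 1) = ((m : ℂ) + 1) • r := fun r => by
    rw [Algebra.smul_def, mul_comm]; simp
  rw [coeff_derivative, coeff_cw, coeff_cw, coeff_derivative, h1, h2, map_smul]

/-! ### Linear differential equations in the variable `X`. -/

/-- A linear differential equation for a power series has at most one solution. -/
theorem ode_unique {D : Module.End ℂ S} {V Z : PowerSeries S}
    (h : derivative S Z = cw D Z + V * Z) (h0 : coeff 0 Z = 0) : Z = 0 := by
  have key : ∀ m, ∀ k ≤ m, coeff k Z = 0 := by
    intro m
    induction m with
    | zero => intro k hk; obtain rfl : k = 0 := by omega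
              exact h0
    | succ m ih =>
      intro k hk
      rcases Nat.lt_or_ge m k with hk' | hk'
      · obtain rfl : k = m + 1 := by omega
        have := congrArg (coeff m) h
        rw [coeff_derivative, map_add, coeff_cw, ih m le_rfl, map_zero, zero_add, coeff_mul,
          sum_eq_zero (fun p hp => by
            rw [ih p.2 (by have := mem_antidiagonal.1 hp; omega), mul_zero])] at this
        have hu : ((m : S) + 1) * algebraMap ℂ S (((m : ℂ) + 1)⁻¹) = 1 := by
          have : ((m : S) + 1) = algebraMap ℂ S ((m : ℂ) + 1) := by simp
          rw [this, ← map_mul, mul_inv_cancel₀ (by exact_mod_cast Nat.succ_ne_zero m), map_one]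
        calc coeff (m + 1) Z = coeff (m + 1) Z * ((m : S) + 1) * algebraMap ℂ S (((m : ℂ) + 1)⁻¹) := by
              rw [mul_assoc, hu, mul_one]
          _ = 0 := by rw [this, zero_mul]
      · exact ih k hk'
  ext m
  simpa using key m m le_rfl

/-- The tool behind most of the identities between exponentials below: both sides are seen to
satisfy one equation in `X` with the same constant term. -/
theorem ode_unique' {D : Module.End ℂ S} {V W Z Z' : PowerSeries S}
    (h : derivative S Z = cw D Z + V * Z + W) (h' : derivative S Z' = cw D Z' + V * Z' + W)
    (h0 : coeff 0 Z = coeff 0 Z') : Z = Z' := by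
  refine sub_eq_zero.1 (ode_unique (D := D) (V := V) ?_ (by simpa [sub_eq_zero] using h0))
  rw [map_sub, h, h', map_sub]
  ring

/-! ### The operators `exp(X D)` and `(exp(X D) - 1) / (X D)`. -/

/-- The operator `∑_a c_a (X D)^a` on power series. -/
def opS (c : ℕ → ℂ) (D : Module.End ℂ S) : PowerSeries S →ₗ[ℂ] PowerSeries S where
  toFun f := mk fun m => ∑ p ∈ antidiagonal m, c p.1 • (D ^ p.1) (coeff p.2 f)
  map_add' f g := by ext; simp [sum_add_distrib]
  map_smul' a f := by ext; simp [smul_sum, smul_comm a]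

lemma coeff_opS (c : ℕ → ℂ) (D : Module.End ℂ S) (f : PowerSeries S) (m : ℕ) :
    coeff m (opS c D f) = ∑ p ∈ antidiagonal m, c p.1 • (D ^ p.1) (coeff p.2 f) := by simp [opS]

lemma coeff_opS_C (c : ℕ → ℂ) (D : Module.End ℂ S) (s : S) (m : ℕ) :
    coeff m (opS c D (C s)) = c m • (D ^ m) s := by
  rw [coeff_opS, sum_eq_single (m, 0)]
  · simp
  · rintro ⟨a, b⟩ hab h
    have : b ≠ 0 := by
      rintro rfl
      simp_all
    simp [coeff_C, this]
  · simp

lemma opS_isXLinear (c : ℕ → ℂ) (D : Module.End ℂ S) : IsXLinear (opS c D) := by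
  refine ⟨map_add _, fun f => ?_⟩
  ext m
  cases m with
  | zero => simp [coeff_opS]
  | succ m =>
    rw [coeff_succ_X_mul, coeff_opS, Nat.sum_antidiagonal_succ', coeff_opS]
    simp [coeff_succ_X_mul]

lemma map_opS {c : ℕ → ℂ} {D : Module.End ℂ S} {D' : Module.End ℂ T} {L : S →ₗ[ℂ] T}
    (h : ∀ s, L (D s) = D' (L s)) (f : PowerSeries S) :
    cw L (opS c D f) = opS c D' (cw L f) := by
  have hp : ∀ a s, L ((D ^ a) s) = (D' ^ a) (L s) := by
    intro a
    induction a with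
    | zero => simp
    | succ a ih => intro s; rw [pow_succ', pow_succ', Module.End.mul_apply, h, ih]; rfl
  ext m
  simp [coeff_opS, hp]

lemma cw_opS_comm {c : ℕ → ℂ} {D D' : Module.End ℂ S} (h : Commute D' D) (f : PowerSeries S) :
    cw D' (opS c D f) = opS c D (cw D' f) :=
  map_opS (fun s => LinearMap.congr_fun h.eq s) f

lemma opS_comm (c c' : ℕ → ℂ) {D D' : Module.End ℂ S} (h : Commute D D') (f : PowerSeries S) :
    opS c D (opS c' D' f) = opS c' D' (opS c D f) := by
  refine ((opS_isXLinear c D).comp (opS_isXLinear c' D')).ext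
    ((opS_isXLinear c' D').comp (opS_isXLinear c D)) (fun s => ?_) f
  ext m
  rw [coeff_opS, coeff_opS, ← Nat.sum_antidiagonal_swap]
  refine sum_congr rfl fun p _ => ?_
  simp only [Prod.fst_swap, Prod.snd_swap, coeff_opS_C, map_smul]
  rw [smul_comm, ← Module.End.mul_apply, (h.pow_pow p.2 p.1).eq, Module.End.mul_apply]

/-- `exp(X D)` -/
abbrev ex (D : Module.End ℂ S) : PowerSeries S →ₗ[ℂ] PowerSeries S :=
  opS (fun a => ((a.factorial : ℂ))⁻¹) D

/-- `(exp(X D) - 1) / (X D)` -/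
abbrev ph (D : Module.End ℂ S) : PowerSeries S →ₗ[ℂ] PowerSeries S :=
  opS (fun a => (((a + 1).factorial : ℂ))⁻¹) D

lemma smul_mul_natCast (c : ℂ) (s : S) (m : ℕ) : c • s * ((m : S) + 1) = (c * (m + 1)) • s := by
  simp only [Algebra.smul_def, map_mul, map_add, map_natCast, map_one]
  ring

lemma derivative_ex (D : Module.End ℂ S) (f : PowerSeries S) :
    derivative S (ex D f) = cw D (ex D f) + ex D (derivative S f) := by
  ext m
  rw [coeff_derivative, map_add, coeff_cw, coeff_opS, coeff_opS, coeff_opS]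
  -- The factor `m + 1` produced by `d/dX` is `p.1 + p.2`: the first summand differentiates the
  -- exponential, the second differentiates `f`.
  have h1 : ∀ p ∈ antidiagonal (m + 1),
      ((p.1.factorial : ℂ))⁻¹ • (D ^ p.1) (coeff p.2 f) * ((m : S) + 1) =
      (((p.1.factorial : ℂ))⁻¹ * p.1) • (D ^ p.1) (coeff p.2 f) +
      (((p.1.factorial : ℂ))⁻¹ * p.2) • (D ^ p.1) (coeff p.2 f) := by
    intro p hp
    have := mem_antidiagonal.1 hp
    rw [smul_mul_natCast, ← add_smul, ← mul_add]
    have : (m : ℂ) + 1 = p.1 + p.2 := by exact_mod_cast this.symm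
    rw [this]
  rw [sum_mul, sum_congr rfl h1, sum_add_distrib]
  congr 1
  · rw [Nat.sum_antidiagonal_succ]
    simp only [Nat.cast_zero, mul_zero, zero_smul, zero_add, map_sum, map_smul]
    refine sum_congr rfl fun p _ => ?_
    rw [pow_succ', Module.End.mul_apply]
    congr 1
    rw [Nat.factorial_succ]; push_cast
    have : (p.1 : ℂ) + 1 ≠ 0 := Nat.cast_add_one_ne_zero _
    have : (p.1.factorial : ℂ) ≠ 0 := by exact_mod_cast Nat.factorial_ne_zero _
    field_simp
  · rw [Nat.sum_antidiagonal_succ']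
    simp only [Nat.cast_zero, mul_zero, zero_smul, zero_add, coeff_derivative]
    refine sum_congr rfl fun p _ => ?_
    have : coeff (p.2 + 1) f * ((p.2 : S) + 1) = ((p.2 : ℂ) + 1) • coeff (p.2 + 1) f := by
      rw [Algebra.smul_def, mul_comm]; simp
    rw [this, map_smul, smul_smul]; push_cast; rfl

lemma coeff_zero_ex (D : Module.End ℂ S) (f : PowerSeries S) :
    coeff 0 (ex D f) = coeff 0 f := by simp [coeff_opS]

lemma derivative_ex_C (D : Module.End ℂ S) (s : S) :
    derivative S (ex D (C s)) = cw D (ex D (C s)) := by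
  rw [derivative_ex, derivative_C, map_zero, add_zero]

/-- By linearity over `X` both factors may be taken constant. Then both sides solve `Z' = D Z`, the
right one by the Leibniz rule. -/
theorem ex_mul (D : Derivation ℂ S S) (f g : PowerSeries S) :
    ex (D : S →ₗ[ℂ] S) (f * g) = ex (D : S →ₗ[ℂ] S) f * ex (D : S →ₗ[ℂ] S) g := by
  refine ((opS_isXLinear _ _).comp (IsXLinear.id.mul_right g)).ext
    ((opS_isXLinear _ _).mul_right _) (fun s => ?_) f
  refine ((opS_isXLinear _ _).comp (IsXLinear.id.mul_left _)).ext
    ((opS_isXLinear _ _).mul_left _) (fun t => ?_) g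
  rw [← map_mul C]
  refine ode_unique' (D := (D : S →ₗ[ℂ] S)) (V := 0) (W := 0) ?_ ?_ ?_
  · rw [derivative_ex_C]; ring
  · rw [cw_derivation_mul, Derivation.leibniz, derivative_ex_C, derivative_ex_C]
    simp only [smul_eq_mul]; ring
  · simp [coeff_mul, coeff_opS]

lemma ex_C_one (D : Derivation ℂ S S) : ex (D : S →ₗ[ℂ] S) 1 = 1 := by
  have : ex (D : S →ₗ[ℂ] S) (C 1) = C 1 := by
    refine ode_unique' (D := (D : S →ₗ[ℂ] S)) (V := 0) (W := 0) ?_ ?_ ?_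
    · rw [derivative_ex_C]; ring
    · rw [cw_C, derivative_C]; simp
    · simp [coeff_opS]
  simpa using this

theorem ex_add {D D' : Module.End ℂ S} (h : Commute D D') (f : PowerSeries S) :
    ex (D + D') f = ex D (ex D' f) := by
  refine (opS_isXLinear _ _).ext ((opS_isXLinear _ _).comp (opS_isXLinear _ _)) (fun s => ?_) f
  refine ode_unique' (D := D + D') (V := 0) (W := 0) ?_ ?_ ?_
  · rw [derivative_ex_C]; ring
  · rw [derivative_ex, derivative_ex_C, ← cw_opS_comm h.symm]
    have : ∀ g, cw (D + D') g = cw D g + cw D' g := fun g => by ext; simp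
    rw [this]; ring
  · simp [coeff_opS]

/-- `X (exp(X D) - 1) / (X D)` applied to a constant solves an inhomogeneous equation. -/
lemma derivative_X_mul_ph_C (D : Module.End ℂ S) (s : S) :
    derivative S (X * ph D (C s)) = ex D (C s) := by
  ext m
  rw [coeff_derivative, coeff_succ_X_mul, coeff_opS_C, coeff_opS_C, smul_mul_natCast]
  congr 1
  rw [Nat.factorial_succ]; push_cast
  have : (m : ℂ) + 1 ≠ 0 := Nat.cast_add_one_ne_zero _
  have : (m.factorial : ℂ) ≠ 0 := by exact_mod_cast Nat.factorial_ne_zero _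
  field_simp

/-- Combined with `derivative_X_mul_ph_C` it says that `Z = X * ph D (C s)` solves `Z' = D Z + s`,
which brings `ph` within reach of `ode_unique'`. -/
lemma ex_C_eq (D : Module.End ℂ S) (s : S) :
    ex D (C s) = C s + cw D (X * ph D (C s)) := by
  ext m
  cases m with
  | zero => rw [coeff_zero_ex, map_add, coeff_cw, coeff_zero_X_mul, map_zero, add_zero]
  | succ m =>
    rw [coeff_opS_C, map_add, coeff_cw, coeff_succ_X_mul, coeff_opS_C, coeff_C]
    simp [pow_succ']

lemma X_mul_inj {f g : PowerSeries S} (h : X * f = X * g) : f = g := by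
  ext m
  simpa [coeff_succ_X_mul] using congrArg (coeff (m + 1)) h

/-- `e^x E(-x) = E(x)` for `E(x) = (e^x - 1) / x`. -/
theorem ex_ph_neg (D : Module.End ℂ S) (f : PowerSeries S) : ex D (ph (-D) f) = ph D f := by
  refine ((opS_isXLinear _ _).comp (opS_isXLinear _ _)).ext (opS_isXLinear _ _) (fun s => ?_) f
  -- After multiplication by `X` both sides solve `Z' = D Z + s`; on the left the term `s` arises
  -- from `e^{X D} e^{-X D} s`.
  refine X_mul_inj ?_
  rw [← (opS_isXLinear _ _).X_mul]
  refine ode_unique' (D := D) (V := 0) (W := C s) ?_ ?_ ?_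
  · rw [derivative_ex, derivative_X_mul_ph_C, ← ex_add (Commute.neg_right (Commute.refl D)), add_neg_cancel]
    have : ex (0 : Module.End ℂ S) (C s) = C s := by
      ext m; cases m <;> simp [coeff_opS_C, coeff_C]
    rw [this]; ring
  · rw [derivative_X_mul_ph_C, ex_C_eq]; ring
  · simp [coeff_opS]

/-- The cocycle identity `E(a + b)(s + t) = E(a) s + e^a E(b) t` if `a t = b s`. -/
theorem ph_add {a b : Module.End ℂ S} (h : Commute a b) {s t : S} (hst : a t = b s) :
    ph (a + b) (C (s + t)) = ph a (C s) + ex a (ph b (C t)) := by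
  have hadd : ∀ g, cw (a + b) g = cw a g + cw b g := fun g => by ext; simp
  refine X_mul_inj ?_
  refine ode_unique' (D := a + b) (V := 0) (W := C (s + t)) ?_ ?_ ?_
  · rw [derivative_X_mul_ph_C, ex_C_eq]; ring
  · have e1 : cw b (X * ph a (C s)) = cw a (X * ph a (C t)) := by
      rw [(cw_isXLinear b).X_mul, (cw_isXLinear a).X_mul, cw_opS_comm h.symm,
        cw_opS_comm (Commute.refl a), cw_C, cw_C, hst]
    rw [mul_add, ← (opS_isXLinear _ a).X_mul (ph b (C t)), map_add, derivative_X_mul_ph_C,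
      derivative_ex, derivative_X_mul_ph_C, hadd, map_add, map_add, e1, cw_opS_comm h.symm,
      ex_C_eq b, map_add (ex a), ex_C_eq a t, ex_C_eq a s, map_add]
    ring
  · simp

/-! ### The exponential of a power series without constant term -/

/-- The exponential of a power series without constant term. -/
def pexp (V : PowerSeries S) : PowerSeries S :=
  mk fun m => ∑ r ∈ range (m + 1), ((r.factorial : ℂ))⁻¹ • coeff m (V ^ r)

lemma coeff_pow_eq_zero {V : PowerSeries S} (hV : coeff 0 V = 0) {m r : ℕ} (h : m < r) :
    coeff m (V ^ r) = 0 :=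
  coeff_of_lt_order m (lt_of_lt_of_le (by exact_mod_cast h)
    (le_order_pow_of_constantCoeff_eq_zero r (by simpa using hV)))

/-- The cutoff in `pexp` varies with the coefficient. Any larger one gives the same value, so a
single cutoff serves all coefficients that enter an identity. -/
lemma coeff_pexp {V : PowerSeries S} (hV : coeff 0 V = 0) {m N : ℕ} (h : m < N) :
    coeff m (pexp V) = ∑ r ∈ range N, ((r.factorial : ℂ))⁻¹ • coeff m (V ^ r) := by
  rw [pexp, coeff_mk]
  refine sum_subset (fun r hr => by simp at *; omega) fun r _ hr => ?_
  rw [coeff_pow_eq_zero hV (by simp at hr; omega), smul_zero]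

lemma coeff_zero_pexp (V : PowerSeries S) : coeff 0 (pexp V) = 1 := by
  simp [pexp]

lemma derivative_pexp {V : PowerSeries S} (hV : coeff 0 V = 0) :
    derivative S (pexp V) = derivative S V * pexp V := by
  have hd : ∀ r : ℕ, (((r + 1).factorial : ℂ))⁻¹ • derivative S (V ^ (r + 1)) =
      ((r.factorial : ℂ))⁻¹ • (derivative S V * V ^ r) := by
    intro r
    rw [derivative_pow, Nat.add_sub_cancel, Nat.factorial_succ, mul_assoc, ← nsmul_eq_mul,
      ← Nat.cast_smul_eq_nsmul ℂ, smul_smul, mul_comm (V ^ r)]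
    congr 1
    push_cast
    have : (r : ℂ) + 1 ≠ 0 := Nat.cast_add_one_ne_zero _
    have : (r.factorial : ℂ) ≠ 0 := by exact_mod_cast Nat.factorial_ne_zero _
    field_simp
  ext m
  have h1 : coeff m (derivative S (pexp V)) =
      coeff m (∑ r ∈ range (m + 2), ((r.factorial : ℂ))⁻¹ • derivative S (V ^ r)) := by
    rw [coeff_derivative, coeff_pexp hV (Nat.lt_succ_self _), map_sum, sum_mul]
    refine sum_congr rfl fun r _ => ?_
    rw [coeff_csmul, coeff_derivative, smul_mul_assoc]
  rw [h1, sum_range_succ', pow_zero, derivative_one, smul_zero, add_zero, sum_congr rfl fun r _ => hd r,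
    map_sum, coeff_mul]
  simp only [coeff_csmul, coeff_mul, smul_sum]
  rw [sum_comm]
  refine sum_congr rfl fun p hp => ?_
  rw [coeff_pexp hV (N := m + 1) (by have := mem_antidiagonal.1 hp; omega), mul_sum]
  exact sum_congr rfl fun r _ => by rw [mul_smul_comm]

/-- Replaces all computations with the exponential series: its behaviour under sums and flows is
read off from `Z' = V' Z`. -/
theorem pexp_unique {V Z : PowerSeries S} (hV : coeff 0 V = 0) (h : derivative S Z = derivative S V * Z)
    (h0 : coeff 0 Z = 1) : Z = pexp V :=
  ode_unique' (D := 0) (V := derivative S V) (W := 0) (by rw [h]; simp)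
    (by rw [derivative_pexp hV]; simp) (by rw [h0, coeff_zero_pexp])

theorem pexp_add {V W : PowerSeries S} (hV : coeff 0 V = 0) (hW : coeff 0 W = 0) :
    pexp (V + W) = pexp V * pexp W := by
  refine (pexp_unique (by rw [map_add, hV, hW, add_zero]) ?_ ?_).symm
  · rw [Derivation.leibniz, derivative_pexp hV, derivative_pexp hW, map_add]
    simp only [smul_eq_mul]; ring
  · simp [coeff_mul, coeff_zero_pexp]

/-- `D` acts on coefficients and so commutes with `d/dX`. Both sides therefore solve the equation
obtained by applying `D` to `Z' = V' Z`. -/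
theorem cw_pexp (D : Derivation ℂ S S) {V : PowerSeries S} (hV : coeff 0 V = 0) :
    cw (D : S →ₗ[ℂ] S) (pexp V) = cw (D : S →ₗ[ℂ] S) V * pexp V := by
  refine ode_unique' (D := 0) (V := derivative S V)
    (W := derivative S (cw (D : S →ₗ[ℂ] S) V) * pexp V) ?_ ?_ ?_
  · rw [derivative_cw, derivative_pexp hV, cw_derivation_mul, derivative_cw]; simp; ring
  · rw [Derivation.leibniz, derivative_pexp hV]
    simp only [smul_eq_mul, cw_zero_map]; ring
  · rw [coeff_cw, coeff_zero_pexp, coeff_mul]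
    simp at hV
    simp [coeff_zero_pexp, hV]

lemma pmap_pexp (φ : S →ₐ[ℂ] T) (V : PowerSeries S) :
    pmap φ (pexp V) = pexp (pmap φ V) := by
  ext m
  simp only [coeff_pmap, pexp, coeff_mk, map_sum, ← map_pow]
  exact sum_congr rfl fun r _ => by rw [map_smul]

theorem ex_pexp (D : Derivation ℂ S S) {V : PowerSeries S} (hV : coeff 0 V = 0) :
    ex (D : S →ₗ[ℂ] S) (pexp V) = pexp (ex (D : S →ₗ[ℂ] S) V) := by
  have hV' : coeff 0 (ex (D : S →ₗ[ℂ] S) V) = 0 := by rw [coeff_zero_ex, hV]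
  refine pexp_unique hV' ?_ (by rw [coeff_zero_ex, coeff_zero_pexp])
  rw [derivative_ex, derivative_ex, derivative_pexp hV, ex_mul, cw_opS_comm (Commute.refl _),
    cw_pexp D hV, ex_mul, ← cw_opS_comm (Commute.refl _)]
  ring

lemma rescale_pexp (a : ℂ) (V : PowerSeries S) :
    rescale (algebraMap ℂ S a) (pexp V) = pexp (rescale (algebraMap ℂ S a) V) := by
  ext m
  simp only [coeff_rescale, pexp, coeff_mk, ← map_pow, mul_sum]
  exact sum_congr rfl fun r _ => by rw [mul_smul_comm]

/-- Linear maps intertwining `D - D k` and `D'` intertwine the translations they generate, up to the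
cocycle `exp(k - e^{X D} k)`. -/
theorem transport {D : Derivation ℂ S S} {D' : Module.End ℂ T} {L : S →ₗ[ℂ] T} {k : S} {J : Ideal S}
    (hJ : ∀ s ∈ J, D s ∈ J) (hL : ∀ s ∈ J, L (D s - D k * s) = D' (L s)) {f : PowerSeries S}
    (hf : ∀ m, coeff m f ∈ J) :
    ex D' (cw L f) =
      cw L (pexp (C k - ex (D : S →ₗ[ℂ] S) (C k)) * ex (D : S →ₗ[ℂ] S) f) := by
  set Q := pexp (C k - ex (D : S →ₗ[ℂ] S) (C k)) with hQ
  have h0 : coeff 0 (C k - ex (D : S →ₗ[ℂ] S) (C k)) = 0 := by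
    rw [map_sub, coeff_zero_ex, sub_self]
  refine ((opS_isXLinear _ _).comp (cw_isXLinear _)).ext_on
    ((cw_isXLinear _).comp ((opS_isXLinear _ _).mul_left Q)) (J := J) (fun s hs => ?_) hf
  -- `hL` is available only on `J`, so the series to which it is applied must have coefficients
  -- there. This is the reason for asking that `J` be an ideal stable under `D`.
  have hmem : ∀ m, coeff m (Q * ex (D : S →ₗ[ℂ] S) (C s)) ∈ J := by
    intro m
    rw [coeff_mul]
    refine J.sum_mem fun p _ => J.mul_mem_left _ ?_
    rw [coeff_opS_C]
    have : ∀ a, ((D : S →ₗ[ℂ] S) ^ a) s ∈ J := by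
      intro a
      induction a with
      | zero => simpa using hs
      | succ a ih => rw [pow_succ', Module.End.mul_apply]; exact hJ _ ih
    rw [Algebra.smul_def]
    exact J.mul_mem_left _ (this _)
  -- Both sides solve `Z' = D' Z`. On the right, the term `-D (e^{X D} k)` of the logarithmic
  -- derivative of `Q` turns the derivative of the product into `D - D k` applied to it, which `hL`
  -- carries to `D'`.
  refine ode_unique' (D := D') (V := 0) (W := 0) ?_ ?_ ?_
  · rw [cw_C, derivative_ex_C]; ring
  · have h1 : cw D' (cw L (Q * ex (D : S →ₗ[ℂ] S) (C s))) =
        cw L (cw (D : S →ₗ[ℂ] S) (Q * ex (D : S →ₗ[ℂ] S) (C s)) -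
          C (D k) * (Q * ex (D : S →ₗ[ℂ] S) (C s))) := by
      ext m
      have : coeff m (C (D k) * (Q * ex (D : S →ₗ[ℂ] S) (C s))) =
        D k * coeff m (Q * ex (D : S →ₗ[ℂ] S) (C s)) := coeff_C_mul _ _ _
      rw [coeff_cw, coeff_cw, coeff_cw, map_sub, coeff_cw, this, ← hL _ (hmem m)]
      rfl
    rw [derivative_cw, h1, zero_mul, add_zero, add_zero]
    congr 1
    rw [Derivation.leibniz, hQ, derivative_pexp h0, cw_derivation_mul, cw_pexp D h0, derivative_ex_C,
      map_sub, map_sub, derivative_C, derivative_ex_C, cw_C]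
    simp only [smul_eq_mul, Derivation.coeFn_coe]
    ring
  · rw [coeff_zero_ex, coeff_cw, coeff_cw, coeff_mul]
    simp [hQ, coeff_zero_pexp, coeff_opS]

end PowerSeriesOperators

end FormalKahler

namespace FormalKahler

open Finset

/-! ### Coefficientwise derivations of polynomials -/

section CoeffDerivation

variable {V T : Type*} [CommRing T] [Algebra ℂ T]

/-- A derivation applied to the coefficients of polynomials. -/
def coeffDer (V : Type*) (D : Derivation ℂ T T) :
    Derivation ℂ (MvPolynomial V T) (MvPolynomial V T) :=
  have hc : ∀ (P : MvPolynomial V T) m, MvPolynomial.coeff m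
      (∑ s ∈ P.support, MvPolynomial.monomial s (D (P.coeff s))) = D (P.coeff m) := fun P m => by
    classical
    simp only [MvPolynomial.coeff_sum, MvPolynomial.coeff_monomial, sum_ite_eq',
      MvPolynomial.mem_support_iff]
    split_ifs with h
    · rfl
    · simp [not_not.1 h]
  Derivation.mk'
    { toFun := fun P => ∑ s ∈ P.support, MvPolynomial.monomial s (D (P.coeff s))
      map_add' := fun P Q => by
        ext m
        rw [hc, MvPolynomial.coeff_add, MvPolynomial.coeff_add, hc, hc, map_add]
      map_smul' := fun a P => by
        ext m
        rw [hc, MvPolynomial.coeff_smul, RingHom.id_apply, MvPolynomial.coeff_smul, hc, D.map_smul] }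
    fun P Q => by
      classical
      ext m
      simp only [LinearMap.coe_mk, AddHom.coe_mk]
      rw [hc]
      simp only [smul_eq_mul, MvPolynomial.coeff_add, MvPolynomial.coeff_mul, hc, map_sum,
        Derivation.leibniz]
      rw [sum_add_distrib]
      congr 1
      conv_rhs => rw [← Finset.HasAntidiagonal.map_swap_antidiagonal, sum_map]
      rfl

@[simp] lemma coeff_coeffDer (D : Derivation ℂ T T) (P : MvPolynomial V T) (m : V →₀ ℕ) :
    MvPolynomial.coeff m (coeffDer V D P) = D (P.coeff m) := by
  classical
  change MvPolynomial.coeff m (∑ s ∈ P.support, MvPolynomial.monomial s (D (P.coeff s))) = _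
  simp only [MvPolynomial.coeff_sum, MvPolynomial.coeff_monomial, sum_ite_eq',
    MvPolynomial.mem_support_iff]
  split_ifs with h
  · rfl
  · simp [not_not.1 h]

@[simp] lemma coeffDer_C (D : Derivation ℂ T T) (t : T) :
    coeffDer V D (MvPolynomial.C t) = MvPolynomial.C (D t) := by
  classical
  ext m
  rw [coeff_coeffDer, MvPolynomial.coeff_C, MvPolynomial.coeff_C]
  split_ifs <;> simp

@[simp] lemma coeffDer_X (D : Derivation ℂ T T) (v : V) :
    coeffDer V D (MvPolynomial.X v) = 0 := by
  classical
  ext m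
  rw [coeff_coeffDer, MvPolynomial.coeff_X]
  split_ifs <;> simp

lemma coeffDer_pderiv (D : Derivation ℂ T T) (v : V) (P : MvPolynomial V T) :
    coeffDer V D (MvPolynomial.pderiv v P) = MvPolynomial.pderiv v (coeffDer V D P) := by
  ext m
  rw [coeff_coeffDer, MvPolynomial.coeff_pderiv, MvPolynomial.coeff_pderiv, coeff_coeffDer,
    Derivation.leibniz]
  simp [mul_comm]

end CoeffDerivation

/-! ### The Wick functional -/

section Wick

variable {V T : Type*} [Fintype V] [CommRing T] [Algebra ℂ T]

/-- The derivation `∑_w c_{v w} ∂_w`. -/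
def contr (c : V → V → T) (v : V) : Derivation T (MvPolynomial V T) (MvPolynomial V T) :=
  ∑ w, c v w • MvPolynomial.pderiv w

lemma contr_apply (c : V → V → T) (v : V) (P : MvPolynomial V T) :
    contr c v P = ∑ w, MvPolynomial.C (c v w) * MvPolynomial.pderiv w P := by
  rw [contr, ← Derivation.coeFnAddMonoidHom_apply, map_sum, Finset.sum_apply]
  simp only [Derivation.coeFnAddMonoidHom_apply]
  exact sum_congr rfl fun w _ => by rw [Derivation.smul_apply, MvPolynomial.smul_eq_C_mul]

lemma contr_X (c : V → V → T) (v w : V) :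
    contr c v (MvPolynomial.X w) = MvPolynomial.C (c v w) := by
  classical
  rw [contr_apply, sum_eq_single w]
  · simp
  · intro u _ hu
    rw [MvPolynomial.pderiv_X_of_ne hu.symm, mul_zero]
  · simp

/-- The Laplacian `(1/2) ∑ c_{v w} ∂_v ∂_w`. -/
def lap (c : V → V → T) : Module.End T (MvPolynomial V T) :=
  algebraMap ℂ T 2⁻¹ • ∑ v, (MvPolynomial.pderiv (R := T) v).toLinearMap ∘ₗ (contr c v).toLinearMap

lemma lap_apply (c : V → V → T) (P : MvPolynomial V T) :
    lap c P = algebraMap ℂ T 2⁻¹ • ∑ v, MvPolynomial.pderiv v (contr c v P) := by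
  simp [lap]

lemma lap_C (c : V → V → T) (t : T) : lap c (MvPolynomial.C t) = 0 := by
  simp [lap_apply]

lemma pderiv_comm (v w : V) (P : MvPolynomial V T) :
    MvPolynomial.pderiv v (MvPolynomial.pderiv w P) =
      MvPolynomial.pderiv w (MvPolynomial.pderiv v P) := by
  classical
  ext m
  simp only [MvPolynomial.coeff_pderiv, add_right_comm m (Finsupp.single v 1)]
  simp only [Finsupp.add_apply, Finsupp.single_apply]
  by_cases h : v = w
  · simp [h]
  · simp [h, Ne.symm h]; ring

lemma contr_pderiv (c : V → V → T) (v w : V) (P : MvPolynomial V T) :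
    contr c v (MvPolynomial.pderiv w P) = MvPolynomial.pderiv w (contr c v P) := by
  rw [contr_apply, contr_apply, map_sum]
  exact sum_congr rfl fun u _ => by rw [MvPolynomial.pderiv_C_mul, pderiv_comm]

lemma contr_comm (c : V → V → T) (v w : V) (P : MvPolynomial V T) :
    contr c v (contr c w P) = contr c w (contr c v P) := by
  rw [contr_apply c v P, map_sum, contr_apply]
  refine sum_congr rfl fun u _ => ?_
  rw [Derivation.leibniz, MvPolynomial.derivation_C, smul_zero, add_zero, contr_pderiv, smul_eq_mul]

lemma contr_lap (c : V → V → T) (v : V) (P : MvPolynomial V T) :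
    contr c v (lap c P) = lap c (contr c v P) := by
  rw [lap_apply, lap_apply, Derivation.map_smul, map_sum]
  congr 1
  exact sum_congr rfl fun u _ => by rw [contr_pderiv, contr_comm]

/-- The commutator of the Laplacian with multiplication by `X_u`. By symmetry of `c` the
second-order operator yields `contr c u` twice, which the factor `1/2` in `lap` compensates. -/
lemma lap_X_mul {c : V → V → T} (hc : ∀ v w, c v w = c w v) (u : V) (P : MvPolynomial V T) :
    lap c (MvPolynomial.X u * P) = MvPolynomial.X u * lap c P + contr c u P := by
  classical
  have h1 : ∀ v, MvPolynomial.pderiv v (contr c v (MvPolynomial.X u * P)) =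
      MvPolynomial.X u * MvPolynomial.pderiv v (contr c v P) + 
        ((if v = u then contr c u P else 0) + MvPolynomial.C (c u v) * MvPolynomial.pderiv v P) := by
    intro v
    rw [Derivation.leibniz, contr_X, smul_eq_mul, smul_eq_mul, map_add, MvPolynomial.pderiv_mul,
      MvPolynomial.pderiv_mul, MvPolynomial.pderiv_C, MvPolynomial.pderiv_X, hc u v]
    by_cases h : v = u
    · subst h; simp; ring
    · simp [h, Ne.symm h]; ring
  rw [lap_apply, lap_apply, sum_congr rfl fun v _ => h1 v, sum_add_distrib, sum_add_distrib,
    sum_ite_eq' univ u, ← mul_sum, ← contr_apply]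
  simp only [mem_univ, if_true, smul_add, ← mul_smul_comm]
  rw [← add_smul, ← map_add]
  norm_num

/-- `contr` commutes with the Laplacian, so the commutators with the `k + 1` factors are all equal
and add up. -/
lemma lap_pow_X_mul {c : V → V → T} (hc : ∀ v w, c v w = c w v) (u : V) (k : ℕ)
    (P : MvPolynomial V T) :
    (lap c ^ (k + 1)) (MvPolynomial.X u * P) =
      MvPolynomial.X u * (lap c ^ (k + 1)) P + ((k : ℂ) + 1) • (lap c ^ k) (contr c u P) := by
  have hcomm : ∀ k Q, (lap c ^ k) (contr c u Q) = contr c u ((lap c ^ k) Q) := by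
    intro k
    induction k with
    | zero => simp
    | succ k ih => intro Q; rw [pow_succ', Module.End.mul_apply, ih, ← contr_lap]; rfl
  induction k with
  | zero => simp [lap_X_mul hc]
  | succ k ih =>
    rw [pow_succ' (lap c) (k + 1), Module.End.mul_apply, Module.End.mul_apply, ih, map_add,
      lap_X_mul hc, ← hcomm, ← algebraMap_smul T ((k : ℂ) + 1), map_smul, algebraMap_smul,
      ← Module.End.mul_apply (lap c) (lap c ^ k), ← pow_succ', add_assoc]
    congr 1
    push_cast
    rw [add_smul ((k : ℂ) + 1), one_smul, add_comm]

/-- Makes `exp(lap c)` a finite sum on each polynomial, as the definition of `wick` requires. -/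
lemma lap_nilpotent {c : V → V → T} (hc : ∀ v w, c v w = c w v) (P : MvPolynomial V T) :
    ∃ N, ∀ k ≥ N, (lap c ^ k) P = 0 := by
  induction P using MvPolynomial.induction_on with
  | C t =>
    refine ⟨1, fun k hk => ?_⟩
    obtain ⟨k, rfl⟩ := Nat.exists_eq_add_of_le' hk
    rw [pow_succ, Module.End.mul_apply, lap_C, map_zero]
  | add P Q hP hQ =>
    obtain ⟨N, hN⟩ := hP
    obtain ⟨M, hM⟩ := hQ
    exact ⟨max N M, fun k hk => by
      rw [map_add, hN k (le_trans (le_max_left _ _) hk), hM k (le_trans (le_max_right _ _) hk),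
        add_zero]⟩
  | mul_X P u hP =>
    obtain ⟨N, hN⟩ := hP
    refine ⟨N + 1, fun k hk => ?_⟩
    obtain ⟨k, rfl⟩ : ∃ j, k = j + 1 := ⟨k - 1, by omega⟩
    have hcomm : ∀ k Q, (lap c ^ k) (contr c u Q) = contr c u ((lap c ^ k) Q) := by
      intro k
      induction k with
      | zero => simp
      | succ k ih => intro Q; rw [pow_succ', Module.End.mul_apply, ih, ← contr_lap]; rfl
    rw [mul_comm, lap_pow_X_mul hc, hN _ (by omega), hcomm, hN _ (by omega)]
    simp

/-- The functional with `Γ(X_v P) = ∑_w c_{v w} Γ(∂_w P)` and `Γ(1) = 1`, for a symmetric matrix `c`. -/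
def wick (c : V → V → T) (hc : ∀ v w, c v w = c w v) : MvPolynomial V T →ₗ[T] T :=
  have hfin : ∀ P, (Function.support fun k : ℕ => ((k.factorial : ℂ))⁻¹ •
      MvPolynomial.constantCoeff ((lap c ^ k) P)).Finite := fun P => by
    obtain ⟨N, hN⟩ := lap_nilpotent hc P
    refine (Set.finite_lt_nat N).subset fun k hk => ?_
    by_contra h
    exact hk (by simp [hN k (not_lt.1 h)])
  -- The constant term of `exp(lap c) P`: Wick's theorem taken as the definition.
  { toFun := fun P => ∑ᶠ k : ℕ, ((k.factorial : ℂ))⁻¹ •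
      MvPolynomial.constantCoeff ((lap c ^ k) P)
    map_add' := fun P Q => by
      rw [← finsum_add_distrib (hfin P) (hfin Q)]
      simp
    map_smul' := fun t P => by
      rw [RingHom.id_apply, smul_finsum' t (hfin P)]
      exact finsum_congr fun k => by
        rw [map_smul, MvPolynomial.constantCoeff_smul, smul_comm] }

lemma wick_eq_sum {c : V → V → T} (hc : ∀ v w, c v w = c w v) {P : MvPolynomial V T} {N : ℕ}
    (hN : ∀ k ≥ N, (lap c ^ k) P = 0) :
    wick c hc P = ∑ k ∈ range N, ((k.factorial : ℂ))⁻¹ •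
      MvPolynomial.constantCoeff ((lap c ^ k) P) := by
  refine finsum_eq_sum_of_support_subset _ fun k hk => ?_
  by_contra h
  exact hk (by simp [hN k (by simpa using h)])

lemma wick_one (c : V → V → T) (hc : ∀ v w, c v w = c w v) : wick c hc 1 = 1 := by
  rw [wick_eq_sum hc (N := 1)]
  · simp
  · intro k hk
    obtain ⟨k, rfl⟩ := Nat.exists_eq_add_of_le' hk
    rw [pow_succ, Module.End.mul_apply, ← MvPolynomial.C_1, lap_C, map_zero]

/-- In the constant term of `exp(lap c) (X_v P)` only the commutator terms survive, and `(k + 1) /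
(k + 1)! = 1 / k!` reassembles them into the exponential applied to `contr c v P`. -/
lemma wick_X_mul (c : V → V → T) (hc : ∀ v w, c v w = c w v) (v : V) (P : MvPolynomial V T) :
    wick c hc (MvPolynomial.X v * P) = ∑ w, c v w * wick c hc (MvPolynomial.pderiv w P) := by
  obtain ⟨N, hN⟩ := lap_nilpotent hc P
  obtain ⟨M, hM⟩ := lap_nilpotent hc (MvPolynomial.X v * P)
  obtain ⟨M', hM'⟩ := lap_nilpotent hc (contr c v P)
  have h : wick c hc (MvPolynomial.X v * P) = wick c hc (contr c v P) := by
    rw [wick_eq_sum hc (N := max M M' + 1) (fun k hk => hM k (by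
        have := le_max_left M M'; omega)),
      wick_eq_sum hc (N := max M M') (fun k hk => hM' k (le_trans (le_max_right _ _) hk)),
      sum_range_succ']
    simp only [pow_zero, Module.End.one_apply, map_mul, MvPolynomial.constantCoeff_X, zero_mul,
      smul_zero, add_zero]
    refine sum_congr rfl fun k _ => ?_
    rw [lap_pow_X_mul hc, map_add, map_mul, MvPolynomial.constantCoeff_X, zero_mul, zero_add,
      MvPolynomial.constantCoeff_smul, smul_smul, Nat.factorial_succ]
    congr 1
    have : (k : ℂ) + 1 ≠ 0 := Nat.cast_add_one_ne_zero _
    have : (k.factorial : ℂ) ≠ 0 := by exact_mod_cast Nat.factorial_ne_zero _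
    push_cast
    field_simp
  rw [h, contr_apply, map_sum]
  exact sum_congr rfl fun w _ => by
    rw [← MvPolynomial.smul_eq_C_mul, map_smul, smul_eq_mul]

lemma wick_C_mul (c : V → V → T) (hc : ∀ v w, c v w = c w v) (t : T) (P : MvPolynomial V T) :
    wick c hc (MvPolynomial.C t * P) = t * wick c hc P := by
  rw [← MvPolynomial.smul_eq_C_mul, map_smul, smul_eq_mul]

lemma wick_C (c : V → V → T) (hc : ∀ v w, c v w = c w v) (t : T) :
    wick c hc (MvPolynomial.C t) = t := by
  rw [← mul_one (MvPolynomial.C t), ← MvPolynomial.smul_eq_C_mul, map_smul, wick_one, smul_eq_mul,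
    mul_one]

/-- A functional with the recursion of the Wick functional is determined by its value at the
constants. -/
theorem wick_unique {M : Type*} [AddCommGroup M] [Module T M] {c : V → V → T}
    {Λ Λ' : MvPolynomial V T →+ M}
    (h : ∀ v P, Λ (MvPolynomial.X v * P) = ∑ w, c v w • Λ (MvPolynomial.pderiv w P))
    (h' : ∀ v P, Λ' (MvPolynomial.X v * P) = ∑ w, c v w • Λ' (MvPolynomial.pderiv w P))
    (h0 : ∀ t, Λ (MvPolynomial.C t) = Λ' (MvPolynomial.C t)) (P : MvPolynomial V T) : Λ P = Λ' P := by
  classical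
  -- Induction on the degree: the recursion trades a variable for a derivative of smaller degree.
  -- Only additivity enters, so functionals that are semilinear along a change of rings are covered.
  suffices H : ∀ (d : ℕ) (s : V →₀ ℕ) (a : T), s.degree ≤ d →
      Λ (MvPolynomial.monomial s a) = Λ' (MvPolynomial.monomial s a) by
    induction P using MvPolynomial.induction_on' with
    | monomial s a => exact H _ s a le_rfl
    | add P Q hP hQ => rw [map_add, map_add, hP, hQ]
  intro d
  induction d with
  | zero =>
    intro s a hs
    obtain rfl : s = 0 := (Finsupp.degree_eq_zero_iff s).1 (by omega)
    exact h0 a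
  | succ d ih =>
    intro s a hs
    by_cases hs0 : s = 0
    · subst hs0; exact h0 a
    obtain ⟨v, hv⟩ : ∃ v, s v ≠ 0 := by
      by_contra hcon
      push Not at hcon
      exact hs0 (Finsupp.ext hcon)
    have hsplit : s = Finsupp.single v 1 + (s - Finsupp.single v 1) := by
      rw [add_tsub_cancel_of_le]
      rw [Finsupp.single_le_iff]; omega
    have hdeg : (s - Finsupp.single v 1).degree ≤ d := by
      have := congrArg Finsupp.degree hsplit
      rw [map_add, Finsupp.degree_single] at this
      omega
    have hm : MvPolynomial.monomial s a =
        MvPolynomial.X v * MvPolynomial.monomial (s - Finsupp.single v 1) a := by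
      rw [MvPolynomial.X, MvPolynomial.monomial_mul, ← hsplit, one_mul]
    rw [hm, h, h']
    refine sum_congr rfl fun w _ => ?_
    rw [MvPolynomial.pderiv_monomial, ih]
    refine le_trans ?_ hdeg
    exact Finsupp.degree_mono tsub_le_self

lemma pderiv_wick_subst {V' T' : Type*} [Fintype V'] [CommRing T'] [Algebra ℂ T']
    {φ : T →+* T'} {s : MvPolynomial V T →+* MvPolynomial V' T'} {l : V → V' → T'}
    (hC : ∀ t, s (MvPolynomial.C t) = MvPolynomial.C (φ t))
    (hX : ∀ v, s (MvPolynomial.X v) = ∑ v', MvPolynomial.C (l v v') * MvPolynomial.X v')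
    (v' : V') (P : MvPolynomial V T) :
    MvPolynomial.pderiv v' (s P) =
      ∑ v, MvPolynomial.C (l v v') * s (MvPolynomial.pderiv v P) := by
  classical
  induction P using MvPolynomial.induction_on with
  | C t => simp [hC]
  | add P Q hP hQ => simp only [map_add, hP, hQ, mul_add, sum_add_distrib]
  | mul_X P u hP =>
    have h1 : MvPolynomial.pderiv v' (s (MvPolynomial.X u)) = MvPolynomial.C (l u v') := by
      rw [hX, map_sum, sum_eq_single v']
      · simp
      · intro b _ hb
        rw [MvPolynomial.pderiv_C_mul, MvPolynomial.pderiv_X_of_ne hb, mul_zero]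
      · simp
    rw [map_mul, MvPolynomial.pderiv_mul, hP, h1]
    have h2 : ∀ v, MvPolynomial.C (l v v') * s (MvPolynomial.pderiv v (P * MvPolynomial.X u)) =
        MvPolynomial.C (l v v') * s (MvPolynomial.pderiv v P) * s (MvPolynomial.X u) +
          if v = u then s P * MvPolynomial.C (l u v') else 0 := by
      intro v
      rw [MvPolynomial.pderiv_mul, map_add, map_mul, map_mul]
      by_cases h : v = u
      · subst h; simp; ring
      · rw [MvPolynomial.pderiv_X_of_ne (Ne.symm h)]; simp [h]; ring
    rw [sum_congr rfl fun v _ => h2 v, sum_add_distrib, sum_ite_eq' univ u, if_pos (mem_univ _),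
      sum_mul]

/-- The behaviour of the Wick functional under changes of the ring and linear substitutions. -/
theorem wick_subst {V' T' : Type*} [Fintype V'] [CommRing T'] [Algebra ℂ T']
    {φ : T →+* T'} {s : MvPolynomial V T →+* MvPolynomial V' T'} {l : V → V' → T'}
    (hC : ∀ t, s (MvPolynomial.C t) = MvPolynomial.C (φ t))
    (hX : ∀ v, s (MvPolynomial.X v) = ∑ v', MvPolynomial.C (l v v') * MvPolynomial.X v')
    {c : V → V → T} (hc : ∀ v w, c v w = c w v) {c' : V' → V' → T'} (hc' : ∀ v w, c' v w = c' w v)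
    (hcc : ∀ v w, φ (c v w) = ∑ a, ∑ b, l v a * l w b * c' a b) (P : MvPolynomial V T) :
    wick c' hc' (s P) = φ (wick c hc P) := by
  -- `T'` becomes a `T`-module through `φ`; both composites then satisfy the same recursion with
  -- covariance `c`.
  let _ : Module T T' := Module.compHom T' φ
  have hsm : ∀ (t : T) (t' : T'), t • t' = φ t * t' := fun _ _ => rfl
  refine wick_unique (c := c) (Λ := (wick c' hc').toAddMonoidHom.comp s.toAddMonoidHom)
    (Λ' := φ.toAddMonoidHom.comp (wick c hc).toAddMonoidHom) ?_ ?_ ?_ P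
  · intro v P
    have hCm : ∀ (t : T') (Q : MvPolynomial V' T'),
        wick c' hc' (MvPolynomial.C t * Q) = t * wick c' hc' Q := fun t Q => by
      rw [← MvPolynomial.smul_eq_C_mul, map_smul, smul_eq_mul]
    simp only [AddMonoidHom.coe_comp, Function.comp_apply, RingHom.toAddMonoidHom_eq_coe,
      AddMonoidHom.coe_coe, LinearMap.toAddMonoidHom_coe, map_mul, hX, hsm]
    simp only [sum_mul, map_sum, mul_assoc, hCm, wick_X_mul, pderiv_wick_subst hC hX, hcc, mul_sum]
    rw [sum_congr rfl fun a _ => sum_comm, sum_comm]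
    refine sum_congr rfl fun w _ => sum_congr rfl fun a _ => sum_congr rfl fun b _ => by ring
  · intro v P
    simp [wick_X_mul, hsm]
  · intro t
    simp [hC, wick_C]

/-- Integration by parts for the Wick functional, if `m` is inverse to `c`. -/
lemma wick_pderiv [DecidableEq V] {c m : V → V → T} (hc : ∀ v w, c v w = c w v)
    (hm : ∀ v w, ∑ u, m v u * c u w = if v = w then 1 else 0) (v : V) (P : MvPolynomial V T) :
    wick c hc (MvPolynomial.pderiv v P) =
      wick c hc ((∑ u, MvPolynomial.C (m v u) * MvPolynomial.X u) * P) := by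
  simp only [sum_mul, map_sum, mul_assoc, wick_C_mul, wick_X_mul, mul_sum]
  rw [sum_comm]
  simp only [← mul_assoc, ← sum_mul, hm, ite_mul, one_mul, zero_mul, sum_ite_eq, mem_univ, if_true]

/-- A linear functional satisfying the integration by parts is a multiple of the Wick functional. -/
theorem eq_wick_of_pderiv [DecidableEq V] {c m : V → V → T} (hc : ∀ v w, c v w = c w v)
    (hm : ∀ v w, ∑ u, c v u * m u w = if v = w then 1 else 0) {Λ : MvPolynomial V T →ₗ[T] T}
    (h : ∀ v P, Λ (MvPolynomial.pderiv v P) =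
      Λ ((∑ u, MvPolynomial.C (m v u) * MvPolynomial.X u) * P)) (P : MvPolynomial V T) :
    Λ P = Λ 1 * wick c hc P := by
  have hlin : ∀ t Q, Λ (MvPolynomial.C t * Q) = t * Λ Q := fun t Q => by
    rw [← MvPolynomial.smul_eq_C_mul, map_smul, smul_eq_mul]
  refine wick_unique (c := c) (Λ := Λ.toAddMonoidHom) (Λ' := (Λ 1 • wick c hc).toAddMonoidHom)
    ?_ ?_ ?_ P
  · intro v P
    simp only [LinearMap.toAddMonoidHom_coe, h, smul_eq_mul]
    simp only [sum_mul, map_sum, mul_assoc, hlin, mul_sum]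
    rw [sum_comm]
    simp only [← mul_assoc, ← sum_mul, hm, ite_mul, one_mul, zero_mul, sum_ite_eq, mem_univ, if_true]
  · intro v P
    simp only [LinearMap.toAddMonoidHom_coe, LinearMap.smul_apply, wick_X_mul, smul_eq_mul, mul_sum]
    exact sum_congr rfl fun w _ => by ring
  · intro t
    simp only [LinearMap.toAddMonoidHom_coe, LinearMap.smul_apply, wick_C, smul_eq_mul]
    rw [← mul_one (MvPolynomial.C t), ← MvPolynomial.smul_eq_C_mul, map_smul, smul_eq_mul, mul_comm]

/-- The derivative of the Wick functional in the direction of a derivation of the base ring; `q` is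
the derivative of the quadratic form. -/
theorem derivation_wick [DecidableEq V] {c m : V → V → T} (hc : ∀ v w, c v w = c w v)
    (hm : ∀ v w, ∑ u, c v u * m u w = if v = w then 1 else 0)
    (hm' : ∀ v w, ∑ u, m v u * c u w = if v = w then 1 else 0)
    (D : Derivation ℂ T T) {k : MvPolynomial V T}
    (hk : ∀ v, MvPolynomial.pderiv v k = ∑ u, MvPolynomial.C (m v u) * MvPolynomial.X u)
    (P : MvPolynomial V T) :
    D (wick c hc P) = wick c hc (coeffDer V D P - coeffDer V D k * P) +
      wick c hc (coeffDer V D k) * wick c hc P := by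
  set Γ := wick c hc
  set q := coeffDer V D k
  have hlin : ∀ t Q, Γ (MvPolynomial.C t * Q) = t * Γ Q := fun t Q => by
    rw [← MvPolynomial.smul_eq_C_mul, map_smul, smul_eq_mul]
  -- The defect `D Γ(P) - Γ(D P - q P)` is linear over `T`, as its Leibniz terms cancel, and
  -- inherits the integration by parts. Hence it is `Λ(1) Γ(P)`, and `Λ(1) = Γ(q)`.
  let Λ : MvPolynomial V T →ₗ[T] T :=
    { toFun := fun P => D (Γ P) - Γ (coeffDer V D P - q * P)
      map_add' := fun P Q => by simp only [map_add, map_sub, mul_add]; ring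
      map_smul' := fun t P => by
        rw [RingHom.id_apply, MvPolynomial.smul_eq_C_mul, Derivation.leibniz, hlin, coeffDer_C,
          Derivation.leibniz]
        simp only [smul_eq_mul, map_sub, map_add, mul_left_comm q]
        rw [hlin, mul_comm P, hlin, hlin]
        ring }
  have hΛ : ∀ P, Λ P = D (Γ P) - Γ (coeffDer V D P - q * P) := fun _ => rfl
  have h := eq_wick_of_pderiv hc hm (Λ := Λ) (fun v P => by
    have ibp := fun Q => wick_pderiv hc hm' v Q
    simp only [← hk] at ibp ⊢
    have e1 : Γ (MvPolynomial.pderiv v P) = Γ (MvPolynomial.pderiv v k * P) := ibp P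
    have e2 := ibp (coeffDer V D P)
    have e3 := ibp (q * P)
    rw [hΛ, hΛ, e1, coeffDer_pderiv, Derivation.leibniz, coeffDer_pderiv]
    rw [MvPolynomial.pderiv_mul] at e3
    simp only [smul_eq_mul, map_sub, map_add] at e2 e3 ⊢
    change Γ _ = Γ _ at e2
    change Γ _ + Γ _ = Γ _ at e3
    rw [e2, mul_comm P, mul_left_comm q, ← e3]
    ring) P
  have h1 : Λ 1 = Γ q := by
    rw [hΛ]
    have : Γ 1 = 1 := wick_one c hc
    simp [this]
  rw [hΛ, h1] at h
  linear_combination h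

/-- A covariance killed by `D` leaves no correction term. For `wick_fubini`, `D` is the derivative
in an outer variable. -/
lemma derivation_wick_of_const {c : V → V → T} (hc : ∀ v w, c v w = c w v) (D : Derivation ℂ T T)
    (hD : ∀ v w, D (c v w) = 0) (P : MvPolynomial V T) :
    D (wick c hc P) = wick c hc (coeffDer V D P) := by
  let Λ : MvPolynomial V T →+ T := ⟨⟨fun P => D (wick c hc P), by simp⟩, by simp⟩
  let Λ' : MvPolynomial V T →+ T := ⟨⟨fun P => wick c hc (coeffDer V D P), by simp⟩, by simp⟩
  refine wick_unique (c := c) (Λ := Λ) (Λ' := Λ') ?_ ?_ ?_ P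
  · intro v Q
    change D (wick c hc _) = ∑ w, c v w • D (wick c hc _)
    rw [wick_X_mul, map_sum]
    exact sum_congr rfl fun u _ => by rw [Derivation.leibniz, hD, smul_zero, add_zero]
  · intro v Q
    change wick c hc (coeffDer V _ _) = ∑ w', c v w' • wick c hc (coeffDer V _ _)
    rw [Derivation.leibniz, coeffDer_X, smul_zero, add_zero, smul_eq_mul, wick_X_mul]
    exact sum_congr rfl fun u _ => by rw [coeffDer_pderiv, smul_eq_mul]
  · intro t
    change D (wick c hc _) = wick c hc (coeffDer V _ _)
    rw [coeffDer_C, wick_C, wick_C]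

/-- Fubini: the Wick functional of a sum of two quadratic forms in separate variables. -/
theorem wick_fubini {W : Type*} [Fintype W] {c : V → V → T}
    {c' : W → W → T} (hc' : ∀ v w, c' v w = c' w v)
    {b : V ⊕ W → V ⊕ W → T} (hb : ∀ v w, b v w = b w v)
    (hll : ∀ v w, b (.inl v) (.inl w) = c v w) (hrr : ∀ v w, b (.inr v) (.inr w) = c' v w)
    (hlr : ∀ v w, b (.inl v) (.inr w) = 0)
    {cW : V → V → MvPolynomial W T} (hcW : ∀ v w, cW v w = cW w v)
    (hcW' : ∀ v w, cW v w = MvPolynomial.C (c v w))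
    {θ : MvPolynomial (V ⊕ W) T →+* MvPolynomial V (MvPolynomial W T)}
    (hC : ∀ t, θ (MvPolynomial.C t) = MvPolynomial.C (MvPolynomial.C t))
    (hl : ∀ v, θ (MvPolynomial.X (.inl v)) = MvPolynomial.X v)
    (hr : ∀ w, θ (MvPolynomial.X (.inr w)) = MvPolynomial.C (MvPolynomial.X w))
    (P : MvPolynomial (V ⊕ W) T) :
    wick b hb P = wick c' hc' (wick cW hcW (θ P)) := by
  classical
  -- The inner covariance does not depend on the outer variables, so outer derivatives pass through
  -- the inner functional and the iterated functional obeys the recursion for `b`.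
  have hD : ∀ (w : W) (Q : MvPolynomial V (MvPolynomial W T)),
      MvPolynomial.pderiv w (wick cW hcW Q) = wick cW hcW (coeffDer V
        ((MvPolynomial.pderiv w).restrictScalars ℂ) Q) := fun w Q =>
    derivation_wick_of_const hcW ((MvPolynomial.pderiv w).restrictScalars ℂ)
      (fun v v' => by rw [hcW']; exact MvPolynomial.pderiv_C) Q
  have hl' : ∀ (v : V) (P : MvPolynomial (V ⊕ W) T),
      MvPolynomial.pderiv v (θ P) = θ (MvPolynomial.pderiv (Sum.inl v) P) := by
    intro v P
    induction P using MvPolynomial.induction_on with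
    | C t => rw [hC, MvPolynomial.pderiv_C, MvPolynomial.pderiv_C, map_zero]
    | add P Q hP hQ => simp only [map_add, hP, hQ]
    | mul_X P u hP =>
      rw [map_mul, MvPolynomial.pderiv_mul, MvPolynomial.pderiv_mul, map_add, map_mul, map_mul, hP]
      congr 2
      cases u with
      | inl u =>
        rw [hl, MvPolynomial.pderiv_X, MvPolynomial.pderiv_X]
        by_cases h : u = v <;> simp [h]
      | inr u => rw [hr, MvPolynomial.pderiv_C, MvPolynomial.pderiv_X_of_ne (by simp), map_zero]
  have hr' : ∀ (w : W) (P : MvPolynomial (V ⊕ W) T),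
      coeffDer V ((MvPolynomial.pderiv w).restrictScalars ℂ) (θ P) =
        θ (MvPolynomial.pderiv (Sum.inr w) P) := by
    intro w P
    induction P using MvPolynomial.induction_on with
    | C t =>
      rw [hC, coeffDer_C, MvPolynomial.pderiv_C, map_zero]
      change MvPolynomial.C (MvPolynomial.pderiv w (MvPolynomial.C t)) = 0
      rw [MvPolynomial.pderiv_C, map_zero]
    | add P Q hP hQ => simp only [map_add, hP, hQ]
    | mul_X P u hP =>
      rw [map_mul, Derivation.leibniz, MvPolynomial.pderiv_mul, map_add, map_mul, map_mul, hP,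
        smul_eq_mul, smul_eq_mul, add_comm, mul_comm (θ (MvPolynomial.X u))]
      congr 2
      cases u with
      | inl u => rw [hl, coeffDer_X, MvPolynomial.pderiv_X_of_ne (by simp), map_zero]
      | inr u =>
        rw [hr, coeffDer_C]
        change MvPolynomial.C (MvPolynomial.pderiv w (MvPolynomial.X u)) = _
        rw [MvPolynomial.pderiv_X, MvPolynomial.pderiv_X]
        by_cases h : u = w <;> simp [h]
  refine wick_unique (c := b) (Λ := (wick b hb).toAddMonoidHom)
    (Λ' := ((wick c' hc').toAddMonoidHom.comp (wick cW hcW).toAddMonoidHom).comp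
      θ.toAddMonoidHom) ?_ ?_ ?_ P
  · intro v P
    exact wick_X_mul b hb v P
  · intro v P
    change wick c' hc' (wick cW hcW (θ _)) = ∑ w, b v w • wick c' hc' (wick cW hcW (θ _))
    rw [Fintype.sum_sum_type, map_mul]
    cases v with
    | inl v =>
      rw [hl, wick_X_mul, map_sum]
      simp only [hlr, zero_smul, sum_const_zero, add_zero, hll]
      exact sum_congr rfl fun u _ => by rw [hcW', wick_C_mul, hl', smul_eq_mul]
    | inr w =>
      rw [hr, wick_C_mul, wick_X_mul]
      simp only [hb (.inr w) (.inl _), hlr, zero_smul, sum_const_zero, zero_add, hrr]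
      exact sum_congr rfl fun u _ => by rw [hD, hr', smul_eq_mul]
  · intro t
    change wick b hb _ = wick c' hc' (wick cW hcW (θ _))
    rw [hC, wick_C, wick_C, wick_C]

end Wick

end FormalKahler

namespace FormalKahler

open Finset

/-! ### Jacobi's formula -/

lemma derivation_prod {S ι : Type*} [CommRing S] [Algebra ℂ S] [DecidableEq ι] (D : Derivation ℂ S S)
    (s : Finset ι) (f : ι → S) : D (∏ i ∈ s, f i) = ∑ i ∈ s, (∏ j ∈ s.erase i, f j) * D (f i) := by
  induction s using Finset.induction_on with
  | empty => simp
  | insert a s ha ih =>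
    rw [prod_insert ha, Derivation.leibniz, ih, sum_insert ha, erase_insert ha, smul_eq_mul,
      smul_eq_mul, mul_sum, add_comm]
    congr 1
    refine sum_congr rfl fun i hi => ?_
    have : a ≠ i := fun h => ha (h ▸ hi)
    rw [erase_insert_of_ne this, prod_insert (by simp [ha]), mul_assoc]

/-- Jacobi's formula for the derivative of a determinant. -/
theorem derivation_det {S : Type*} [CommRing S] [Algebra ℂ S] {n : ℕ} (D : Derivation ℂ S S)
    (M : Matrix (Fin n) (Fin n) S) :
    D M.det = ∑ i, ∑ j, M.adjugate j i * D (M i j) := by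
  -- By Cramer's rule the sum over one column is the determinant with that column differentiated;
  -- the Leibniz rule in the permutation expansion produces the sum of these.
  have h1 : ∀ j, ∑ i, M.adjugate j i * D (M i j) = (M.updateCol j fun i => D (M i j)).det := fun j => by
    rw [← Matrix.cramer_apply, Matrix.cramer_eq_adjugate_mulVec]
    rfl
  rw [sum_comm, sum_congr rfl fun j _ => h1 j, Matrix.det_apply, map_sum]
  simp only [Matrix.det_apply]
  rw [sum_comm]
  refine sum_congr rfl fun σ _ => ?_
  rw [← smul_sum]
  have : ∀ (u : ℤˣ) (x : S), D (u • x) = u • D x := fun u x => by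
    rcases Int.units_eq_one_or u with rfl | rfl <;> simp
  rw [this, derivation_prod]
  congr 1
  refine sum_congr rfl fun j _ => ?_
  rw [← prod_erase_mul univ _ (mem_univ j), Matrix.updateCol_self]
  congr 1
  refine prod_congr rfl fun i hi => ?_
  rw [Matrix.updateCol_ne (ne_of_mem_erase hi)]

/-! ### Flows of derivations -/

section Flow

variable {S T : Type*} [CommRing S] [Algebra ℂ S] [CommRing T] [Algebra ℂ T]

/-- The automorphism `exp(X D)` of the ring of power series. -/
def flow (D : Derivation ℂ S S) : PowerSeries S →+* PowerSeries S where
  toFun := ex (D : S →ₗ[ℂ] S)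
  map_one' := ex_C_one D
  map_mul' := ex_mul D
  map_zero' := map_zero _
  map_add' := map_add _

lemma flow_apply (D : Derivation ℂ S S) (f : PowerSeries S) : flow D f = ex (D : S →ₗ[ℂ] S) f := rfl

/-- `(exp(X D) - 1) / (X D)` -/
def flowInt (D : Derivation ℂ S S) : PowerSeries S →ₗ[ℂ] PowerSeries S := ph (D : S →ₗ[ℂ] S)

lemma flow_add {D D' : Derivation ℂ S S} (h : ∀ s, D (D' s) = D' (D s)) (f : PowerSeries S) :
    flow (D + D') f = flow D (flow D' f) := by
  rw [flow_apply, flow_apply, flow_apply, ← ex_add (LinearMap.ext h), Derivation.coe_add_linearMap]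

lemma flow_comm {D D' : Derivation ℂ S S} (h : ∀ s, D (D' s) = D' (D s)) (f : PowerSeries S) :
    flow D (flow D' f) = flow D' (flow D f) := by
  simp only [flow_apply]
  exact opS_comm _ _ (LinearMap.ext h) f

lemma flow_flowInt_comm {D D' : Derivation ℂ S S} (h : ∀ s, D (D' s) = D' (D s)) (f : PowerSeries S) :
    flow D (flowInt D' f) = flowInt D' (flow D f) := by
  simp only [flow_apply, flowInt]
  exact opS_comm _ _ (LinearMap.ext h) f

lemma flowInt_comm {D D' : Derivation ℂ S S} (h : ∀ s, D (D' s) = D' (D s)) (f : PowerSeries S) :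
    flowInt D (flowInt D' f) = flowInt D' (flowInt D f) := by
  simp only [flowInt]
  exact opS_comm _ _ (LinearMap.ext h) f

lemma flow_flowInt_neg (D : Derivation ℂ S S) (f : PowerSeries S) :
    flow D (flowInt (-D) f) = flowInt D f := by
  rw [flow_apply, flowInt, Derivation.coe_neg_linearMap, ex_ph_neg]; rfl

lemma flow_neg (D : Derivation ℂ S S) (f : PowerSeries S) : flow D (flow (-D) f) = f := by
  rw [← flow_add (by simp), add_neg_cancel]
  ext m
  rw [flow_apply, coeff_opS, sum_eq_single (0, m)]
  · simp
  · rintro ⟨a, b⟩ hab hne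
    have : a ≠ 0 := by rintro rfl; simp_all
    simp [this]
  · simp

lemma flowInt_add {D D' : Derivation ℂ S S} (h : ∀ s, D (D' s) = D' (D s)) {s t : S}
    (hst : D t = D' s) :
    flowInt (D + D') (PowerSeries.C (s + t)) =
      flowInt D (PowerSeries.C s) + flow D (flowInt D' (PowerSeries.C t)) := by
  rw [flowInt, Derivation.coe_add_linearMap, ph_add (LinearMap.ext h) hst]; rfl

lemma coeff_zero_flow (D : Derivation ℂ S S) (f : PowerSeries S) :
    PowerSeries.coeff 0 (flow D f) = PowerSeries.coeff 0 f := coeff_zero_ex _ f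

lemma coeff_zero_flowInt (D : Derivation ℂ S S) (f : PowerSeries S) :
    PowerSeries.coeff 0 (flowInt D f) = PowerSeries.coeff 0 f := by simp [flowInt, coeff_opS]

lemma flow_pexp (D : Derivation ℂ S S) {V : PowerSeries S} (hV : PowerSeries.coeff 0 V = 0) :
    flow D (pexp V) = pexp (flow D V) := ex_pexp D hV

lemma pmap_flow {φ : S →ₐ[ℂ] T} {D : Derivation ℂ S S} {D' : Derivation ℂ T T}
    (h : ∀ s, φ (D s) = D' (φ s)) (f : PowerSeries S) :
    pmap φ (flow D f) = flow D' (pmap φ f) := by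
  rw [← cw_map, ← cw_map, flow_apply, map_opS (D' := (D' : T →ₗ[ℂ] T)) h]; rfl

lemma pmap_flowInt {φ : S →ₐ[ℂ] T} {D : Derivation ℂ S S} {D' : Derivation ℂ T T}
    (h : ∀ s, φ (D s) = D' (φ s)) (f : PowerSeries S) :
    pmap φ (flowInt D f) = flowInt D' (pmap φ f) := by
  rw [← cw_map, ← cw_map, flowInt, map_opS (D' := (D' : T →ₗ[ℂ] T)) h]; rfl

end Flow

/-! ### Rings with Kähler metrics -/

/-- A commutative algebra with commuting derivations `∂_i`, `∂̄_j` and an invertible matrix `h` that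
satisfies the Kähler condition. -/
structure KahlerRing (n : ℕ) (S : Type*) [CommRing S] [Algebra ℂ S] where
  a : Fin n → Derivation ℂ S S
  b : Fin n → Derivation ℂ S S
  aa : ∀ i j s, a i (a j s) = a j (a i s)
  ab : ∀ i j s, a i (b j s) = b j (a i s)
  bb : ∀ i j s, b i (b j s) = b j (b i s)
  h : Matrix (Fin n) (Fin n) S
  closed_a : ∀ i j k, a k (h i j) = a i (h k j)
  closed_b : ∀ i j k, b k (h i j) = b j (h i k)
  hi : Fin n → Fin n → S
  hi_mul : ∀ i k, ∑ j, hi i j * h k j = if i = k then 1 else 0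
  mul_hi : ∀ j l, ∑ i, hi i j * h i l = if j = l then 1 else 0
  d : S
  d_mul : d * h.det = 1

namespace KahlerRing

variable {n : ℕ} {R S T : Type*} [CommRing R] [Algebra ℂ R] [CommRing S] [Algebra ℂ S]
  [CommRing T] [Algebra ℂ T]

/-- The element is killed by all derivations. -/
def IsConst (K : KahlerRing n S) (s : S) : Prop := (∀ i, K.a i s = 0) ∧ ∀ i, K.b i s = 0

lemma IsConst.add {K : KahlerRing n S} {s t : S} (hs : K.IsConst s) (ht : K.IsConst t) :
    K.IsConst (s + t) :=
  ⟨fun i => by rw [map_add, hs.1, ht.1, add_zero], fun i => by rw [map_add, hs.2, ht.2, add_zero]⟩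

lemma IsConst.neg {K : KahlerRing n S} {s : S} (hs : K.IsConst s) : K.IsConst (-s) :=
  ⟨fun i => by rw [map_neg, hs.1, neg_zero], fun i => by rw [map_neg, hs.2, neg_zero]⟩

/-- `∑ ξ_i ∂_i` -/
def A (K : KahlerRing n S) (ξ : Fin n → S) : Derivation ℂ S S := ∑ i, ξ i • K.a i

/-- `∑ η_j ∂̄_j` -/
def B (K : KahlerRing n S) (η : Fin n → S) : Derivation ℂ S S := ∑ j, η j • K.b j

/-- `∑ h_{i j} ξ_i η_j` -/
def κ (K : KahlerRing n S) (ξ η : Fin n → S) : S := ∑ i, ∑ j, K.h i j * ξ i * η j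

lemma derivation_sum_smul_apply {ι : Type*} (s : Finset ι) (ξ : ι → S) (D : ι → Derivation ℂ S S)
    (x : S) : (∑ i ∈ s, ξ i • D i) x = ∑ i ∈ s, ξ i * D i x := by
  rw [← Derivation.coeFnAddMonoidHom_apply, map_sum, Finset.sum_apply]
  rfl

lemma A_apply (K : KahlerRing n S) (ξ : Fin n → S) (x : S) : K.A ξ x = ∑ i, ξ i * K.a i x :=
  derivation_sum_smul_apply _ _ _ _

lemma B_apply (K : KahlerRing n S) (ξ : Fin n → S) (x : S) : K.B ξ x = ∑ i, ξ i * K.b i x :=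
  derivation_sum_smul_apply _ _ _ _

lemma A_add (K : KahlerRing n S) (ξ η : Fin n → S) : K.A (ξ + η) = K.A ξ + K.A η := by
  ext x; simp [A_apply, add_mul, sum_add_distrib]

lemma B_add (K : KahlerRing n S) (ξ η : Fin n → S) : K.B (ξ + η) = K.B ξ + K.B η := by
  ext x; simp [B_apply, add_mul, sum_add_distrib]

lemma A_neg (K : KahlerRing n S) (ξ : Fin n → S) : K.A (-ξ) = -K.A ξ := by
  ext x; simp [A_apply]

lemma B_neg (K : KahlerRing n S) (ξ : Fin n → S) : K.B (-ξ) = -K.B ξ := by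
  ext x; simp [B_apply]

lemma κ_add_left (K : KahlerRing n S) (ξ ξ' η : Fin n → S) :
    K.κ (ξ + ξ') η = K.κ ξ η + K.κ ξ' η := by
  simp [κ, mul_add, add_mul, sum_add_distrib]

lemma κ_add_right (K : KahlerRing n S) (ξ η η' : Fin n → S) :
    K.κ ξ (η + η') = K.κ ξ η + K.κ ξ η' := by
  simp [κ, mul_add, sum_add_distrib]

lemma κ_neg_neg (K : KahlerRing n S) (ξ η : Fin n → S) : K.κ (-ξ) (-η) = K.κ ξ η := by
  simp [κ]

lemma comm_of_const {ι : Type*} [Fintype ι] {ξ η : ι → S} {D E : ι → Derivation ℂ S S}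
    (hDE : ∀ i j s, D i (E j s) = E j (D i s)) (hξ : ∀ i j, E j (ξ i) = 0)
    (hη : ∀ i j, D i (η j) = 0) (x : S) :
    ∑ i, ξ i * D i (∑ j, η j * E j x) = ∑ j, η j * E j (∑ i, ξ i * D i x) := by
  simp only [map_sum, Derivation.leibniz, hξ, hη, smul_eq_mul, mul_zero, add_zero, hDE, mul_sum]
  rw [sum_comm]
  exact sum_congr rfl fun _ _ => sum_congr rfl fun _ _ => by ring

lemma A_A_comm (K : KahlerRing n S) {ξ η : Fin n → S} (hξ : ∀ i, K.IsConst (ξ i))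
    (hη : ∀ i, K.IsConst (η i)) (x : S) : K.A ξ (K.A η x) = K.A η (K.A ξ x) := by
  simp only [A_apply]
  exact comm_of_const K.aa (fun i j => (hξ i).1 j) (fun i j => (hη j).1 i) x

lemma A_B_comm (K : KahlerRing n S) {ξ η : Fin n → S} (hξ : ∀ i, K.IsConst (ξ i))
    (hη : ∀ i, K.IsConst (η i)) (x : S) : K.A ξ (K.B η x) = K.B η (K.A ξ x) := by
  simp only [A_apply, B_apply]
  exact comm_of_const K.ab (fun i j => (hξ i).2 j) (fun i j => (hη j).1 i) x

lemma B_B_comm (K : KahlerRing n S) {ξ η : Fin n → S} (hξ : ∀ i, K.IsConst (ξ i))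
    (hη : ∀ i, K.IsConst (η i)) (x : S) : K.B ξ (K.B η x) = K.B η (K.B ξ x) := by
  simp only [B_apply]
  exact comm_of_const K.bb (fun i j => (hξ i).2 j) (fun i j => (hη j).2 i) x

lemma a_κ (K : KahlerRing n S) {ξ η : Fin n → S} (hξ : ∀ i, K.IsConst (ξ i))
    (hη : ∀ i, K.IsConst (η i)) (k : Fin n) :
    K.a k (K.κ ξ η) = ∑ i, ∑ j, K.a k (K.h i j) * ξ i * η j := by
  simp only [κ, map_sum, Derivation.leibniz, (hξ _).1, (hη _).1, smul_eq_mul, mul_zero, zero_add]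
  exact sum_congr rfl fun i _ => sum_congr rfl fun j _ => by ring

lemma b_κ (K : KahlerRing n S) {ξ η : Fin n → S} (hξ : ∀ i, K.IsConst (ξ i))
    (hη : ∀ i, K.IsConst (η i)) (k : Fin n) :
    K.b k (K.κ ξ η) = ∑ i, ∑ j, K.b k (K.h i j) * ξ i * η j := by
  simp only [κ, map_sum, Derivation.leibniz, (hξ _).2, (hη _).2, smul_eq_mul, mul_zero, zero_add]
  exact sum_congr rfl fun i _ => sum_congr rfl fun j _ => by ring

/-- Symmetry in `ξ, ξ'`: with a potential both sides would be `A_ξ A_ξ' B_η Φ`. It is closedness in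
the form that `ph_add` asks for. -/
lemma A_κ (K : KahlerRing n S) {ξ ξ' η : Fin n → S} (hξ : ∀ i, K.IsConst (ξ i))
    (hξ' : ∀ i, K.IsConst (ξ' i)) (hη : ∀ i, K.IsConst (η i)) :
    K.A ξ (K.κ ξ' η) = K.A ξ' (K.κ ξ η) := by
  simp only [A_apply, K.a_κ hξ hη, K.a_κ hξ' hη, mul_sum]
  rw [sum_comm]
  refine sum_congr rfl fun i _ => sum_congr rfl fun k _ => sum_congr rfl fun j _ => ?_
  rw [K.closed_a i j k]; ring

lemma B_κ (K : KahlerRing n S) {ξ η η' : Fin n → S} (hξ : ∀ i, K.IsConst (ξ i))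
    (hη : ∀ i, K.IsConst (η i)) (hη' : ∀ i, K.IsConst (η' i)) :
    K.B η (K.κ ξ η') = K.B η' (K.κ ξ η) := by
  simp only [B_apply, K.b_κ hξ hη, K.b_κ hξ hη', mul_sum]
  have e : ∀ F : Fin n → Fin n → Fin n → S,
      ∑ k, ∑ i, ∑ j, F k i j = ∑ j, ∑ i, ∑ k, F k i j := fun F => by
    rw [sum_comm, sum_congr rfl fun i _ => sum_comm (f := fun k j => F k i j), sum_comm]
  rw [e]
  refine sum_congr rfl fun k _ => sum_congr rfl fun i _ => sum_congr rfl fun j _ => ?_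
  rw [K.closed_b i k j]; ring

/-- Homomorphisms of rings with Kähler metrics. -/
structure IsHom (K : KahlerRing n S) (K' : KahlerRing n T) (φ : S →ₐ[ℂ] T) : Prop where
  a : ∀ i s, φ (K.a i s) = K'.a i (φ s)
  b : ∀ i s, φ (K.b i s) = K'.b i (φ s)
  h : ∀ i j, φ (K.h i j) = K'.h i j
  hi : ∀ i j, φ (K.hi i j) = K'.hi i j
  d : φ K.d = K'.d

namespace IsHom

variable {K : KahlerRing n S} {K' : KahlerRing n T} {φ : S →ₐ[ℂ] T}

lemma A (hφ : IsHom K K' φ) (ξ : Fin n → S) (s : S) : φ (K.A ξ s) = K'.A (φ ∘ ξ) (φ s) := by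
  simp [A_apply, hφ.a]

lemma B (hφ : IsHom K K' φ) (ξ : Fin n → S) (s : S) : φ (K.B ξ s) = K'.B (φ ∘ ξ) (φ s) := by
  simp [B_apply, hφ.b]

lemma κ (hφ : IsHom K K' φ) (ξ η : Fin n → S) : φ (K.κ ξ η) = K'.κ (φ ∘ ξ) (φ ∘ η) := by
  simp [KahlerRing.κ, hφ.h]

lemma det (hφ : IsHom K K' φ) : φ K.h.det = K'.h.det := by
  rw [AlgHom.map_det]
  congr 1
  ext i j
  exact hφ.h i j

lemma const (hφ : IsHom K K' φ) {s : S} (hs : K.IsConst s) : K'.IsConst (φ s) :=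
  ⟨fun i => by rw [← hφ.a, hs.1, map_zero], fun i => by rw [← hφ.b, hs.2, map_zero]⟩

end IsHom

/-- The expansion of the Calabi function without the leading term. -/
def tail (K : KahlerRing n S) (ξ η : Fin n → S) : PowerSeries S :=
  -- If `κ = A B Φ`, then `-X² E(X A) E(X B) κ = -(e^{X A} - 1)(e^{X B} - 1) Φ`, which is the Calabi
  -- function at displacement `X (ξ, η)`. After division by `X²`, the leading term `-κ` is left to
  -- the Gaussian weight.
  PowerSeries.C (K.κ ξ η) - flowInt (K.A ξ) (flowInt (K.B η) (PowerSeries.C (K.κ ξ η)))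

lemma coeff_zero_tail (K : KahlerRing n S) (ξ η : Fin n → S) :
    PowerSeries.coeff 0 (K.tail ξ η) = 0 := by
  rw [tail, map_sub, coeff_zero_flowInt, coeff_zero_flowInt, sub_self]

/-- The integrand of the formal integral, without the Gaussian factor. -/
def integrand (K : KahlerRing n S) (ξ η : Fin n → S) (f g : PowerSeries S) : PowerSeries S :=
  flow (K.B η) f * flow (K.A ξ) g * pexp (K.tail ξ η) *
    flow (K.A ξ) (flow (K.B η) (PowerSeries.C K.h.det))

lemma IsHom.tail {K : KahlerRing n S} {K' : KahlerRing n T} {φ : S →ₐ[ℂ] T} (hφ : IsHom K K' φ)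
    (ξ η : Fin n → S) :
    pmap φ (K.tail ξ η) = K'.tail (φ ∘ ξ) (φ ∘ η) := by
  rw [KahlerRing.tail, map_sub, pmap_flowInt (hφ.A ξ), pmap_flowInt (hφ.B η), pmap_C, hφ.κ]
  rfl

lemma IsHom.integrand {K : KahlerRing n S} {K' : KahlerRing n T} {φ : S →ₐ[ℂ] T} (hφ : IsHom K K' φ)
    (ξ η : Fin n → S) (f g : PowerSeries S) :
    pmap φ (K.integrand ξ η f g) =
      K'.integrand (φ ∘ ξ) (φ ∘ η) (pmap φ f)
        (pmap φ g) := by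
  rw [KahlerRing.integrand, map_mul, map_mul, map_mul, pmap_flow (hφ.B η), pmap_flow (hφ.A ξ),
    pmap_flow (hφ.A ξ), pmap_flow (hφ.B η), pmap_pexp, hφ.tail, pmap_C,
    hφ.det]
  rfl

/-- The Kähler ring of polynomials over a Kähler ring; the variables are constants. -/
def poly (K : KahlerRing n S) (V : Type*) : KahlerRing n (MvPolynomial V S) where
  a i := coeffDer V (K.a i)
  b i := coeffDer V (K.b i)
  aa i j P := by ext m; simp only [coeff_coeffDer, K.aa i j]
  ab i j P := by ext m; simp only [coeff_coeffDer, K.ab i j]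
  bb i j P := by ext m; simp only [coeff_coeffDer, K.bb i j]
  h := K.h.map MvPolynomial.C
  closed_a i j k := by simp [K.closed_a i j k]
  closed_b i j k := by simp [K.closed_b i j k]
  hi i j := MvPolynomial.C (K.hi i j)
  hi_mul i k := by
    simp only [Matrix.map_apply, ← map_mul, ← map_sum, K.hi_mul]
    split_ifs <;> simp
  mul_hi i k := by
    simp only [Matrix.map_apply, ← map_mul, ← map_sum, K.mul_hi]
    split_ifs <;> simp
  d := MvPolynomial.C K.d
  d_mul := by
    rw [← RingHom.mapMatrix_apply, ← RingHom.map_det, ← map_mul, K.d_mul, map_one]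

lemma poly_const_X (K : KahlerRing n S) {V : Type*} (v : V) :
    (K.poly V).IsConst (MvPolynomial.X v) :=
  ⟨fun _ => coeffDer_X _ _, fun _ => coeffDer_X _ _⟩

/-- The inclusion of the constant polynomials. -/
def cHom (V S : Type*) [CommRing S] [Algebra ℂ S] : S →ₐ[ℂ] MvPolynomial V S :=
  (Algebra.ofId S (MvPolynomial V S)).restrictScalars ℂ

lemma cHom_apply {V : Type*} (s : S) : cHom V S s = MvPolynomial.C s := rfl

lemma cHom_isHom (K : KahlerRing n S) (V : Type*) : IsHom K (K.poly V) (cHom V S) where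
  a _ _ := (coeffDer_C _ _).symm
  b _ _ := (coeffDer_C _ _).symm
  h _ _ := rfl
  hi _ _ := rfl
  d := rfl

/-- A homomorphism out of a polynomial ring that is a homomorphism on the coefficients and sends
the variables to constants is a homomorphism of Kähler rings. -/
lemma isHom_of_poly {K : KahlerRing n S} {K' : KahlerRing n T} {V : Type*}
    {φ : MvPolynomial V S →ₐ[ℂ] T} (hC : IsHom K K' (φ.comp (cHom V S)))
    (hX : ∀ v, K'.IsConst (φ (MvPolynomial.X v))) : IsHom (K.poly V) K' φ where
  a i P := by
    change φ (coeffDer V _ P) = _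
    induction P using MvPolynomial.induction_on with
    | C t => rw [coeffDer_C]; exact hC.a i t
    | add P Q hP hQ => simp only [map_add, hP, hQ]
    | mul_X P u hP =>
      rw [Derivation.leibniz, coeffDer_X, smul_zero, zero_add, smul_eq_mul, map_mul, hP, map_mul,
        Derivation.leibniz, (hX u).1, smul_zero, zero_add, smul_eq_mul]
  b i P := by
    change φ (coeffDer V _ P) = _
    induction P using MvPolynomial.induction_on with
    | C t => rw [coeffDer_C]; exact hC.b i t
    | add P Q hP hQ => simp only [map_add, hP, hQ]
    | mul_X P u hP =>
      rw [Derivation.leibniz, coeffDer_X, smul_zero, zero_add, smul_eq_mul, map_mul, hP, map_mul,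
        Derivation.leibniz, (hX u).2, smul_zero, zero_add, smul_eq_mul]
  h i j := hC.h i j
  hi i j := hC.hi i j
  d := hC.d

/-! ### The Gaussian functional -/

/-- The covariance of `y_i` (`Sum.inl i`) and `ȳ_j` (`Sum.inr j`). -/
def cov (K : KahlerRing n S) : Fin n ⊕ Fin n → Fin n ⊕ Fin n → S
  | .inl i, .inr j => K.hi i j
  | .inr j, .inl i => K.hi i j
  | .inl _, .inl _ => 0
  | .inr _, .inr _ => 0

/-- The matrix of the second derivatives of `∑ h_{i j} y_i ȳ_j`. -/
def hess (K : KahlerRing n S) : Fin n ⊕ Fin n → Fin n ⊕ Fin n → S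
  | .inl i, .inr j => K.h i j
  | .inr j, .inl i => K.h i j
  | .inl _, .inl _ => 0
  | .inr _, .inr _ => 0

lemma cov_symm (K : KahlerRing n S) (v w : Fin n ⊕ Fin n) : K.cov v w = K.cov w v := by
  cases v <;> cases w <;> rfl

lemma cov_hess (K : KahlerRing n S) (v w : Fin n ⊕ Fin n) :
    ∑ u, K.cov v u * K.hess u w = if v = w then 1 else 0 := by
  rw [Fintype.sum_sum_type]
  cases v <;> cases w <;> simp [cov, hess, K.hi_mul, K.mul_hi]

lemma hess_cov (K : KahlerRing n S) (v w : Fin n ⊕ Fin n) :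
    ∑ u, K.hess v u * K.cov u w = if v = w then 1 else 0 := by
  rw [Fintype.sum_sum_type]
  cases v <;> cases w <;> simp [cov, hess, mul_comm (K.h _ _), K.hi_mul, K.mul_hi, eq_comm]

/-- The coordinates `y_i`. -/
def yv (n : ℕ) (S : Type*) [CommRing S] (i : Fin n) : MvPolynomial (Fin n ⊕ Fin n) S :=
  MvPolynomial.X (.inl i)

/-- The coordinates `ȳ_j`. -/
def ybv (n : ℕ) (S : Type*) [CommRing S] (i : Fin n) : MvPolynomial (Fin n ⊕ Fin n) S :=
  MvPolynomial.X (.inr i)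

/-- The Gaussian functional `P ↦ ∫ P(y, ȳ) exp(-∑ h_{i j} y_i ȳ_j)`. -/
def gauss (K : KahlerRing n S) : MvPolynomial (Fin n ⊕ Fin n) S →ₗ[S] S :=
  K.d • wick K.cov K.cov_symm

lemma gauss_apply (K : KahlerRing n S) (P : MvPolynomial (Fin n ⊕ Fin n) S) :
    K.gauss P = K.d * wick K.cov K.cov_symm P := rfl

/-- Supplies the hypothesis `hk` of `derivation_wick`: `κ` is the quadratic form whose Hessian is
inverse to the covariance. -/
lemma pderiv_κ (K : KahlerRing n S) (v : Fin n ⊕ Fin n) :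
    MvPolynomial.pderiv v ((K.poly _).κ (yv n S) (ybv n S)) =
      ∑ u, MvPolynomial.C (K.hess v u) * MvPolynomial.X u := by
  classical
  rw [Fintype.sum_sum_type, κ]
  simp only [map_sum, poly, Matrix.map_apply, mul_assoc, MvPolynomial.pderiv_mul,
    MvPolynomial.pderiv_C, zero_mul, zero_add, yv, ybv]
  cases v with
  | inl i =>
    simp only [hess, map_zero, zero_mul, sum_const_zero, zero_add]
    rw [sum_eq_single i]
    · refine sum_congr rfl fun j _ => ?_
      rw [MvPolynomial.pderiv_X_self, MvPolynomial.pderiv_X_of_ne (by simp)]; ring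
    · intro k _ hk
      refine sum_eq_zero fun j _ => ?_
      rw [MvPolynomial.pderiv_X_of_ne (by simpa using hk), MvPolynomial.pderiv_X_of_ne (by simp)]
      ring
    · simp
  | inr j =>
    simp only [hess, map_zero, zero_mul, sum_const_zero, add_zero]
    refine sum_congr rfl fun i _ => ?_
    rw [sum_eq_single j]
    · rw [MvPolynomial.pderiv_X_self, MvPolynomial.pderiv_X_of_ne (by simp)]; ring
    · intro k _ hk
      rw [MvPolynomial.pderiv_X_of_ne (by simp), MvPolynomial.pderiv_X_of_ne (by simpa using hk)]
      ring
    · simp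

lemma hi_eq_adjugate (K : KahlerRing n S) (i j : Fin n) : K.hi i j = K.d * K.h.adjugate j i := by
  have h1 : (Matrix.of fun j i => K.hi i j) * K.h = 1 := by
    ext j l
    rw [Matrix.mul_apply, Matrix.one_apply, ← K.mul_hi]
    rfl
  have h2 : K.h * (K.d • K.h.adjugate) = 1 := by
    rw [Matrix.mul_smul, Matrix.mul_adjugate, smul_smul, K.d_mul, one_smul]
  have := left_inv_eq_right_inv h1 h2
  exact congrFun (congrFun this j) i

lemma wick_yv_ybv (K : KahlerRing n S) (i j : Fin n) :
    wick K.cov K.cov_symm (yv n S i * ybv n S j) = K.hi i j := by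
  rw [yv, wick_X_mul, Fintype.sum_sum_type, ybv]
  simp only [cov, zero_mul, sum_const_zero, zero_add]
  rw [sum_eq_single j]
  · rw [MvPolynomial.pderiv_X_self, wick_one, mul_one]
  · intro k _ hk
    rw [MvPolynomial.pderiv_X_of_ne (by simpa using hk.symm), map_zero, mul_zero]
  · simp

/-- Derivatives of Gaussian integrals. -/
theorem derivation_gauss (K : KahlerRing n S) (D : Derivation ℂ S S)
    (P : MvPolynomial (Fin n ⊕ Fin n) S) :
    K.gauss (coeffDer _ D P - coeffDer _ D ((K.poly _).κ (yv n S) (ybv n S)) * P) =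
      D (K.gauss P) := by
  have h1 := derivation_wick K.cov_symm K.cov_hess K.hess_cov D K.pderiv_κ P
  set Γ := wick K.cov K.cov_symm
  -- `Γ(D κ) = ∑ h^{ij} D h_{ij}` is the logarithmic derivative of `det H`. The extra term in
  -- `derivation_wick` therefore cancels against the derivative of the normalization `K.d`.
  have h2 : K.h.det * Γ (coeffDer _ D ((K.poly _).κ (yv n S) (ybv n S))) = D K.h.det := by
    rw [derivation_det]
    simp only [κ, map_sum, mul_sum]
    refine sum_congr rfl fun i _ => sum_congr rfl fun j _ => ?_
    rw [mul_assoc, Derivation.leibniz, Derivation.leibniz]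
    have e : K.h.det * K.hi i j = K.h.adjugate j i := by
      rw [hi_eq_adjugate, ← mul_assoc, mul_comm _ K.d, K.d_mul, one_mul]
    simp only [poly, Matrix.map_apply, coeffDer_C, yv, ybv, coeffDer_X, smul_eq_mul,
      mul_zero, add_zero, zero_add]
    rw [mul_comm _ (MvPolynomial.C _), wick_C_mul]
    have := K.wick_yv_ybv i j
    rw [yv, ybv] at this
    rw [this, ← e]; ring
  have h3 : D K.d = -(K.d * K.d * D K.h.det) := by
    have := congrArg D K.d_mul
    rw [Derivation.leibniz, Derivation.map_one_eq_zero, smul_eq_mul, smul_eq_mul] at this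
    linear_combination K.d * this - D K.d * K.d_mul
  rw [gauss_apply, gauss_apply, Derivation.leibniz, smul_eq_mul, smul_eq_mul, h3, ← h2, h1]
  linear_combination (K.d * Γ P * Γ (coeffDer _ D ((K.poly _).κ (yv n S) (ybv n S)))) * K.d_mul

/-- Only the inverse metric and the inverse determinant need to be respected. Evaluation at a point
does that without commuting with the derivations, so it falls under this lemma and not under
`IsHom`. -/
lemma gauss_map {K : KahlerRing n S} {K' : KahlerRing n T} {φ : S →+* T}
    (hhi : ∀ i j, φ (K.hi i j) = K'.hi i j) (hd : φ K.d = K'.d)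
    (P : MvPolynomial (Fin n ⊕ Fin n) S) :
    K'.gauss (MvPolynomial.map φ P) = φ (K.gauss P) := by
  classical
  rw [gauss_apply, gauss_apply, map_mul, hd]
  congr 1
  refine wick_subst (φ := φ) (s := MvPolynomial.map φ)
    (l := fun v w => if v = w then 1 else 0) (by simp) (by simp) _ _ (fun v w => ?_) P
  simp only [ite_mul, one_mul, zero_mul, mul_ite, mul_zero, sum_ite_eq, mem_univ, if_true]
  cases v <;> cases w <;> simp [cov, hhi]

/-- The Gaussian functional commutes with homomorphisms of Kähler rings. -/
lemma IsHom.gauss {K : KahlerRing n S} {K' : KahlerRing n T} {φ : S →ₐ[ℂ] T} (hφ : IsHom K K' φ)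
    (P : MvPolynomial (Fin n ⊕ Fin n) S) :
    K'.gauss (MvPolynomial.map (φ : S →+* T) P) = φ (K.gauss P) :=
  gauss_map hφ.hi hφ.d P

end KahlerRing

end FormalKahler

namespace FormalKahler

open Finset

namespace KahlerRing

variable {n : ℕ} {R S T : Type*} [CommRing R] [Algebra ℂ R] [CommRing S] [Algebra ℂ S]
  [CommRing T] [Algebra ℂ T]

/-! ### The product and its associativity -/

/-- The Gaussian functional, as a `ℂ`-linear map. -/
def gaussL (K : KahlerRing n S) : MvPolynomial (Fin n ⊕ Fin n) S →ₗ[ℂ] S :=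
  K.gauss.restrictScalars ℂ

lemma gaussL_apply (K : KahlerRing n S) (P : MvPolynomial (Fin n ⊕ Fin n) S) :
    K.gaussL P = K.gauss P := rfl

/-- The formal integral `∫ f(z, v̄) g(v, z̄) exp(φ / ε²) dμ`, as a power series in `ε`. -/
def bul (K : KahlerRing n S) (f g : PowerSeries S) : PowerSeries S :=
  cw K.gaussL ((K.poly _).integrand (yv n S) (ybv n S)
    (pmap (cHom _ S) f) (pmap (cHom _ S) g))

lemma cw_gaussL_mul (K : KahlerRing n S) (F : PowerSeries (MvPolynomial (Fin n ⊕ Fin n) S))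
    (g : PowerSeries S) :
    cw K.gaussL F * g = cw K.gaussL (F * pmap (cHom _ S) g) := by
  ext m
  simp only [PowerSeries.coeff_mul, coeff_cw, map_sum, coeff_pmap]
  refine sum_congr rfl fun p _ => ?_
  rw [gaussL_apply, gaussL_apply, gauss_apply, gauss_apply, cHom_apply,
    mul_comm _ (MvPolynomial.C _), wick_C_mul]
  ring

/-- Moving the base point of a formal integral. The Gaussian weight depends on the base point too,
and its change is the exponential factor. -/
lemma flow_cw_gaussL (K : KahlerRing n S) (D : Derivation ℂ S S)
    (F : PowerSeries (MvPolynomial (Fin n ⊕ Fin n) S)) :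
    flow D (cw K.gaussL F) = cw K.gaussL
      (pexp (PowerSeries.C ((K.poly _).κ (yv n S) (ybv n S)) -
        flow (coeffDer _ D) (PowerSeries.C ((K.poly _).κ (yv n S) (ybv n S)))) *
        flow (coeffDer _ D) F) :=
  transport (J := ⊤) (fun _ _ => Submodule.mem_top) (fun P _ => K.derivation_gauss D P)
    fun _ => Submodule.mem_top

lemma coeffDer_A (K : KahlerRing n S) {V : Type*} (ξ : Fin n → S) :
    coeffDer V (K.A ξ) = (K.poly V).A (cHom V S ∘ ξ) := by
  ext P m
  simp [A_apply, poly, cHom_apply, MvPolynomial.coeff_sum, MvPolynomial.coeff_C_mul]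

lemma coeffDer_B (K : KahlerRing n S) {V : Type*} (ξ : Fin n → S) :
    coeffDer V (K.B ξ) = (K.poly V).B (cHom V S ∘ ξ) := by
  ext P m
  simp [B_apply, poly, cHom_apply, MvPolynomial.coeff_sum, MvPolynomial.coeff_C_mul]

lemma IsHom.comp {K : KahlerRing n R} {K' : KahlerRing n S} {K'' : KahlerRing n T} {φ : R →ₐ[ℂ] S}
    {ψ : S →ₐ[ℂ] T} (hψ : IsHom K' K'' ψ) (hφ : IsHom K K' φ) : IsHom K K'' (ψ.comp φ) where
  a i s := by simp [hφ.a, hψ.a]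
  b i s := by simp [hφ.b, hψ.b]
  h i j := by simp [hφ.h, hψ.h]
  hi i j := by simp [hφ.hi, hψ.hi]
  d := by simp [hφ.d, hψ.d]

/-- The homomorphism of polynomial rings given by a homomorphism of the coefficients. -/
def mapHom (V : Type*) (φ : S →ₐ[ℂ] T) : MvPolynomial V S →ₐ[ℂ] MvPolynomial V T where
  toRingHom := MvPolynomial.map (φ : S →+* T)
  commutes' c := by
    change MvPolynomial.map (φ : S →+* T) (MvPolynomial.C (algebraMap ℂ S c)) =
      MvPolynomial.C (algebraMap ℂ T c)
    simp

lemma mapHom_apply {V : Type*} (φ : S →ₐ[ℂ] T) (P : MvPolynomial V S) :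
    mapHom V φ P = MvPolynomial.map (φ : S →+* T) P := rfl

lemma IsHom.mapHom {K : KahlerRing n S} {K' : KahlerRing n T} {φ : S →ₐ[ℂ] T} (hφ : IsHom K K' φ)
    (V : Type*) : IsHom (K.poly V) (K'.poly V) (mapHom V φ) :=
  have e : (KahlerRing.mapHom V φ).comp (cHom V S) = (cHom V T).comp φ := by
    ext s : 1
    simp [mapHom_apply, cHom_apply]
  isHom_of_poly (by rw [e]; exact (cHom_isHom K' V).comp hφ) fun v => by
    rw [mapHom_apply, MvPolynomial.map_X]; exact poly_const_X _ _

lemma map_cw_gaussL {K : KahlerRing n S} {K' : KahlerRing n T} {φ : S →ₐ[ℂ] T} (hφ : IsHom K K' φ)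
    (F : PowerSeries (MvPolynomial (Fin n ⊕ Fin n) S)) :
    pmap φ (cw K.gaussL F) =
      cw K'.gaussL (pmap (mapHom _ φ) F) := by
  ext m
  simp only [coeff_pmap, coeff_cw, gaussL_apply]
  exact (hφ.gauss _).symm

/-- The integrand of `(f • g) • h`. -/
def tripleL (K : KahlerRing n S) (x xb y yb : Fin n → S) (f g h : PowerSeries S) : PowerSeries S :=
  pexp (PowerSeries.C (K.κ x xb) - flow (K.B yb) (PowerSeries.C (K.κ x xb))) *
    flow (K.B yb) (K.integrand x xb f g) *
    (flow (K.A y) h * pexp (K.tail y yb) * flow (K.A y) (flow (K.B yb) (PowerSeries.C K.h.det)))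

/-- The integrand of `f • (g • h)`. -/
def tripleR (K : KahlerRing n S) (x xb y yb : Fin n → S) (f g h : PowerSeries S) : PowerSeries S :=
  pexp (PowerSeries.C (K.κ y yb) - flow (K.A x) (PowerSeries.C (K.κ y yb))) *
    flow (K.A x) (K.integrand y yb g h) *
    (flow (K.B xb) f * pexp (K.tail x xb) * flow (K.A x) (flow (K.B xb) (PowerSeries.C K.h.det)))

lemma IsHom.tripleL {K : KahlerRing n S} {K' : KahlerRing n T} {φ : S →ₐ[ℂ] T} (hφ : IsHom K K' φ)
    (x xb y yb : Fin n → S) (f g h : PowerSeries S) :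
    pmap φ (K.tripleL x xb y yb f g h) =
      K'.tripleL (φ ∘ x) (φ ∘ xb) (φ ∘ y) (φ ∘ yb) (pmap φ f)
        (pmap φ g) (pmap φ h) := by
  simp only [KahlerRing.tripleL, map_mul, pmap_pexp, map_sub, pmap_flow (hφ.B _), pmap_flow (hφ.A _),
    hφ.tail, hφ.integrand, pmap_C, hφ.det, hφ.κ]

lemma IsHom.tripleR {K : KahlerRing n S} {K' : KahlerRing n T} {φ : S →ₐ[ℂ] T} (hφ : IsHom K K' φ)
    (x xb y yb : Fin n → S) (f g h : PowerSeries S) :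
    pmap φ (K.tripleR x xb y yb f g h) =
      K'.tripleR (φ ∘ x) (φ ∘ xb) (φ ∘ y) (φ ∘ yb) (pmap φ f)
        (pmap φ g) (pmap φ h) := by
  simp only [KahlerRing.tripleR, map_mul, pmap_pexp, map_sub, pmap_flow (hφ.B _), pmap_flow (hφ.A _),
    hφ.tail, hφ.integrand, pmap_C, hφ.det, hφ.κ]

/-- The two ways of composing the Calabi functions of three points agree. -/
lemma triple_exponent (K : KahlerRing n S) {x xb y yb : Fin n → S} (hx : ∀ i, K.IsConst (x i))
    (hxb : ∀ i, K.IsConst (xb i)) (hy : ∀ i, K.IsConst (y i)) (hyb : ∀ i, K.IsConst (yb i)) :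
    PowerSeries.C (K.κ x xb) - flow (K.B yb) (PowerSeries.C (K.κ x xb)) + 
        flow (K.B yb) (K.tail x xb) + K.tail (x + y) yb =
      PowerSeries.C (K.κ y yb) - flow (K.A x) (PowerSeries.C (K.κ y yb)) + 
        flow (K.A x) (K.tail y yb) + K.tail x (yb + xb) := by
  -- Closedness enters here, through `A_κ` and `B_κ`: it allows `flowInt` along a sum of two
  -- displacements to be split.
  have h1 := flowInt_add (K.A_A_comm hx hy) (K.A_κ hx hy hyb)
  have h2 := flowInt_add (K.B_B_comm hyb hxb) (K.B_κ hx hyb hxb)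
  have e1 : flowInt (K.A (x + y)) (flowInt (K.B yb) (PowerSeries.C (K.κ (x + y) yb))) =
      flowInt (K.B yb) (flowInt (K.A x) (PowerSeries.C (K.κ x yb))) +
      flowInt (K.B yb) (flow (K.A x) (flowInt (K.A y) (PowerSeries.C (K.κ y yb)))) := by
    rw [flowInt_comm (K.A_B_comm (ξ := x + y) (fun i => (hx i).add (hy i)) hyb), A_add, κ_add_left, h1, map_add]
  have e2 : flowInt (K.A x) (flowInt (K.B (yb + xb)) (PowerSeries.C (K.κ x (yb + xb)))) =
      flowInt (K.A x) (flowInt (K.B yb) (PowerSeries.C (K.κ x yb))) +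
      flowInt (K.A x) (flow (K.B yb) (flowInt (K.B xb) (PowerSeries.C (K.κ x xb)))) := by
    rw [B_add, κ_add_right, h2, map_add]
  have e3 : flow (K.B yb) (flowInt (K.A x) (flowInt (K.B xb) (PowerSeries.C (K.κ x xb)))) =
      flowInt (K.A x) (flow (K.B yb) (flowInt (K.B xb) (PowerSeries.C (K.κ x xb)))) :=
    flow_flowInt_comm (fun s => (K.A_B_comm hx hyb s).symm) _
  have e4 : flow (K.A x) (flowInt (K.A y) (flowInt (K.B yb) (PowerSeries.C (K.κ y yb)))) =
      flowInt (K.B yb) (flow (K.A x) (flowInt (K.A y) (PowerSeries.C (K.κ y yb)))) := by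
    rw [flowInt_comm (K.A_B_comm hy hyb), flow_flowInt_comm (K.A_B_comm hx hyb)]
  have e5 := flowInt_comm (K.A_B_comm hx hyb) (PowerSeries.C (K.κ x yb))
  rw [tail, tail, tail, tail, map_sub, map_sub, e1, e2, e3, e4, κ_add_left, κ_add_right, map_add,
    map_add, e5]
  ring

theorem tripleL_eq_tripleR (K : KahlerRing n S) {x xb y yb : Fin n → S} (hx : ∀ i, K.IsConst (x i))
    (hxb : ∀ i, K.IsConst (xb i)) (hy : ∀ i, K.IsConst (y i)) (hyb : ∀ i, K.IsConst (yb i))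
    (f g h : PowerSeries S) :
    K.tripleL x xb (x + y) yb f g h = K.tripleR x (yb + xb) y yb f g h := by
  have hc0 : ∀ (D : Derivation ℂ S S) (s : S),
      PowerSeries.coeff 0 (PowerSeries.C s - flow D (PowerSeries.C s)) = 0 := fun D s => by
    rw [map_sub, coeff_zero_flow, sub_self]
  have ht := fun ξ η => K.coeff_zero_tail ξ η
  have hft : ∀ D ξ η, PowerSeries.coeff 0 (flow D (K.tail ξ η)) = 0 := fun D ξ η => by
    rw [coeff_zero_flow, ht]
  have h0 : ∀ {U V : PowerSeries S}, PowerSeries.coeff 0 U = 0 → PowerSeries.coeff 0 V = 0 →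
      PowerSeries.coeff 0 (U + V) = 0 := fun hU hV => by rw [map_add, hU, hV, add_zero]
  have hexp := congrArg pexp (K.triple_exponent hx hxb hy hyb)
  rw [pexp_add (h0 (hc0 _ _) (hft _ _ _)) (ht _ _), pexp_add (hc0 _ _) (hft _ _ _),
    pexp_add (h0 (hc0 _ _) (hft _ _ _)) (ht _ _), pexp_add (hc0 _ _) (hft _ _ _)] at hexp
  rw [tripleL, tripleR, integrand, integrand]
  simp only [map_mul, flow_pexp _ (ht _ _)]
  have cAB := K.A_B_comm hx hyb
  have cAB' := K.A_B_comm hx hxb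
  have cAA := K.A_A_comm hx hy
  have cBB := K.B_B_comm hyb hxb
  have a1 : ∀ u, flow (K.A (x + y)) u = flow (K.A x) (flow (K.A y) u) := fun u => by
    rw [A_add, flow_add cAA]
  have a2 : ∀ u, flow (K.B (yb + xb)) u = flow (K.B yb) (flow (K.B xb) u) := fun u => by
    rw [B_add, flow_add cBB]
  have a3 := fun u => flow_comm (fun s => (cAB s).symm) u
  rw [a1, a1, a2, a2, a3 g, a3]
  linear_combination (flow (K.B yb) (flow (K.B xb) f) * flow (K.A x) (flow (K.B yb) g) *
    flow (K.A x) (flow (K.A y) h) *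
    flow (K.A x) (flow (K.A y) (flow (K.B yb) (PowerSeries.C K.h.det))) *
    flow (K.A x) (flow (K.B yb) (flow (K.B xb) (PowerSeries.C K.h.det)))) * hexp

/-! ### Iterated Gaussian functionals and the change of variables between them. -/

/-- The covariance of two independent copies of the variables. -/
def cov2 (K : KahlerRing n S) :
    (Fin n ⊕ Fin n) ⊕ (Fin n ⊕ Fin n) → (Fin n ⊕ Fin n) ⊕ (Fin n ⊕ Fin n) → S
  | .inl v, .inl w => K.cov v w
  | .inr v, .inr w => K.cov v w
  | .inl _, .inr _ => 0
  | .inr _, .inl _ => 0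

lemma cov2_symm (K : KahlerRing n S) (v w : (Fin n ⊕ Fin n) ⊕ (Fin n ⊕ Fin n)) :
    K.cov2 v w = K.cov2 w v := by
  cases v <;> cases w <;> first | rfl | exact K.cov_symm _ _

/-- Polynomials in two sets of variables as iterated polynomials. -/
def iter (n : ℕ) (S : Type*) [CommRing S] [Algebra ℂ S] :
    MvPolynomial ((Fin n ⊕ Fin n) ⊕ (Fin n ⊕ Fin n)) S →ₐ[ℂ]
      MvPolynomial (Fin n ⊕ Fin n) (MvPolynomial (Fin n ⊕ Fin n) S) :=
  (MvPolynomial.aeval (R := S) (Sum.elim MvPolynomial.X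
    fun w => MvPolynomial.C (MvPolynomial.X w))).restrictScalars ℂ

lemma iter_C (s : S) : iter n S (MvPolynomial.C s) = MvPolynomial.C (MvPolynomial.C s) := by
  simp [iter, MvPolynomial.algebraMap_apply]

lemma iter_inl (v : Fin n ⊕ Fin n) : iter n S (MvPolynomial.X (.inl v)) = MvPolynomial.X v := by
  simp [iter]

lemma iter_inr (v : Fin n ⊕ Fin n) :
    iter n S (MvPolynomial.X (.inr v)) = MvPolynomial.C (MvPolynomial.X v) := by
  simp [iter]

lemma iter_comp_cHom :
    (iter n S).comp (cHom _ S) = (cHom (Fin n ⊕ Fin n) _).comp (cHom (Fin n ⊕ Fin n) S) := by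
  ext s : 1
  simp [cHom_apply, iter_C]

lemma iter_isHom (K : KahlerRing n S) :
    IsHom (K.poly _) ((K.poly (Fin n ⊕ Fin n)).poly (Fin n ⊕ Fin n)) (iter n S) :=
  isHom_of_poly (by rw [iter_comp_cHom]; exact (cHom_isHom _ _).comp (cHom_isHom _ _))
    fun v => by
      cases v with
      | inl v => rw [iter_inl]; exact poly_const_X _ _
      | inr v => rw [iter_inr]; exact (cHom_isHom _ _).const (poly_const_X _ _)

/-- The Gaussian functional in two sets of variables. -/
def gauss2 (K : KahlerRing n S) :
    MvPolynomial ((Fin n ⊕ Fin n) ⊕ (Fin n ⊕ Fin n)) S →ₗ[ℂ] S :=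
  ((K.d * K.d) • wick K.cov2 K.cov2_symm).restrictScalars ℂ

lemma gauss_gauss_iter (K : KahlerRing n S)
    (P : MvPolynomial ((Fin n ⊕ Fin n) ⊕ (Fin n ⊕ Fin n)) S) :
    K.gaussL ((K.poly (Fin n ⊕ Fin n)).gaussL (iter n S P)) = K.gauss2 P := by
  have h := wick_fubini (c := K.cov) (c' := K.cov) K.cov_symm (b := K.cov2) K.cov2_symm
    (fun _ _ => rfl) (fun _ _ => rfl) (fun _ _ => rfl) (cW := (K.poly (Fin n ⊕ Fin n)).cov)
    (K.poly _).cov_symm (fun v w => by cases v <;> cases w <;> simp [cov, poly])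
    (θ := (iter n S : _ →+* _)) iter_C iter_inl iter_inr P
  have e : K.gauss2 P = K.d * K.d * wick K.cov2 K.cov2_symm P := rfl
  rw [e, h, gaussL_apply, gaussL_apply, gauss_apply, gauss_apply]
  change K.d * wick K.cov _ (MvPolynomial.C K.d * _) = _
  rw [wick_C_mul, mul_assoc]
  rfl

lemma cw_gauss_gauss_iter (K : KahlerRing n S)
    (F : PowerSeries (MvPolynomial ((Fin n ⊕ Fin n) ⊕ (Fin n ⊕ Fin n)) S)) :
    cw K.gaussL (cw (K.poly (Fin n ⊕ Fin n)).gaussL (pmap (iter n S) F)) =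
      cw K.gauss2 F := by
  ext m
  simp only [coeff_cw, coeff_pmap]
  exact K.gauss_gauss_iter _

/-- The linear substitution that relates the two iterated integrals of a triple product. -/
def shearCoeff (n : ℕ) :
    (Fin n ⊕ Fin n) ⊕ (Fin n ⊕ Fin n) → (Fin n ⊕ Fin n) ⊕ (Fin n ⊕ Fin n) → ℤ
  -- Inner displacements are `inl`, outer ones `inr`. In `(f • g) • h`, with inner `(x, x̄)` and
  -- outer `(y, ȳ)`, the arguments are `(z, z̄ + ȳ + x̄)`, `(z + x, z̄ + ȳ)` and `(z + y, z̄)`. In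
  -- `f • (g • h)` the same arguments occur for outer displacement `(x, ȳ + x̄)` and inner
  -- displacement `(y - x, ȳ)`. The substitution treats `y` and `ȳ` as independent.
  | .inl (.inl i), .inr (.inl j) => if i = j then 1 else 0
  | .inl (.inl i), .inl (.inl j) => if i = j then -1 else 0
  | .inl (.inr i), .inr (.inr j) => if i = j then 1 else 0
  | .inr (.inl i), .inl (.inl j) => if i = j then 1 else 0
  | .inr (.inr i), .inr (.inr j) => if i = j then 1 else 0
  | .inr (.inr i), .inl (.inr j) => if i = j then 1 else 0
  | _, _ => 0

/-- The substitution with coefficients `shearCoeff`. -/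
def shear (n : ℕ) (S : Type*) [CommRing S] [Algebra ℂ S] :
    MvPolynomial ((Fin n ⊕ Fin n) ⊕ (Fin n ⊕ Fin n)) S →ₐ[ℂ]
      MvPolynomial ((Fin n ⊕ Fin n) ⊕ (Fin n ⊕ Fin n)) S :=
  (MvPolynomial.aeval (R := S) fun v =>
    ∑ w, MvPolynomial.C ((shearCoeff n v w : ℤ) : S) * MvPolynomial.X w).restrictScalars ℂ

lemma shear_C (s : S) : shear n S (MvPolynomial.C s) = MvPolynomial.C s := by
  simp [shear]

lemma shear_X (v : (Fin n ⊕ Fin n) ⊕ (Fin n ⊕ Fin n)) :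
    shear n S (MvPolynomial.X v) =
      ∑ w, MvPolynomial.C ((shearCoeff n v w : ℤ) : S) * MvPolynomial.X w := by
  simp [shear]

lemma shear_isHom (K : KahlerRing n S) : IsHom (K.poly _) (K.poly _) (shear n S) := by
  refine isHom_of_poly ?_ fun v => ?_
  · have : (shear n S).comp (cHom _ S) = cHom _ S := by
      ext s : 1
      simp [cHom_apply, shear_C]
    rw [this]
    exact cHom_isHom _ _
  · rw [shear_X]
    constructor <;> intro i <;> rw [map_sum] <;> refine sum_eq_zero fun w _ => ?_
    · rw [Derivation.leibniz, (K.poly_const_X w).1, map_intCast, Derivation.map_intCast]; simp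
    · rw [Derivation.leibniz, (K.poly_const_X w).2, map_intCast, Derivation.map_intCast]; simp

/-- `y - x` is paired with `ȳ`, and `x` with `ȳ + x̄`, with the old covariance; `y - x` against `ȳ +
x̄` gives `h^{ij} - h^{ij} = 0`. So the covariance is preserved, although the substitution is not
real. -/
lemma gauss2_shear (K : KahlerRing n S)
    (P : MvPolynomial ((Fin n ⊕ Fin n) ⊕ (Fin n ⊕ Fin n)) S) :
    K.gauss2 (shear n S P) = K.gauss2 P := by
  have h := wick_subst (φ := RingHom.id S) (s := (shear n S : _ →+* _)) (l := fun v w => ((shearCoeff n v w : ℤ) : S))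
    shear_C shear_X K.cov2_symm K.cov2_symm (fun v w => by
      simp only [Fintype.sum_sum_type, RingHom.id_apply]
      rcases v with (v | v) | (v | v) <;> rcases w with (w | w) | (w | w) <;>
        simp [shearCoeff, cov2, cov]) P
  exact congrArg (fun s => K.d * K.d * s) h

lemma cw_gauss2_shear (K : KahlerRing n S)
    (F : PowerSeries (MvPolynomial ((Fin n ⊕ Fin n) ⊕ (Fin n ⊕ Fin n)) S)) :
    cw K.gauss2 (pmap (shear n S) F) = cw K.gauss2 F := by
  ext m
  simp only [coeff_cw, coeff_pmap]
  exact K.gauss2_shear _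

lemma mapHom_comp_cHom {V : Type*} :
    (mapHom V (cHom V S)).comp (cHom V S) = (cHom V (MvPolynomial V S)).comp (cHom V S) := by
  ext s : 1
  simp [mapHom_apply, cHom_apply]

/-! The variables of the iterated polynomial ring. -/

lemma iter_comp_inl_y : iter n S ∘ (fun i => MvPolynomial.X (.inl (.inl i))) =
    yv n (MvPolynomial (Fin n ⊕ Fin n) S) := funext fun _ => iter_inl _

lemma iter_comp_inl_yb : iter n S ∘ (fun i => MvPolynomial.X (.inl (.inr i))) =
    ybv n (MvPolynomial (Fin n ⊕ Fin n) S) := funext fun _ => iter_inl _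

lemma iter_comp_inr_y : iter n S ∘ (fun i => MvPolynomial.X (.inr (.inl i))) =
    cHom (Fin n ⊕ Fin n) (MvPolynomial (Fin n ⊕ Fin n) S) ∘ yv n S := funext fun _ => iter_inr _

lemma iter_comp_inr_yb : iter n S ∘ (fun i => MvPolynomial.X (.inr (.inr i))) =
    cHom (Fin n ⊕ Fin n) (MvPolynomial (Fin n ⊕ Fin n) S) ∘ ybv n S := funext fun _ => iter_inr _

lemma mapHom_comp_yv : mapHom (Fin n ⊕ Fin n) (cHom (Fin n ⊕ Fin n) S) ∘ yv n S =
    yv n (MvPolynomial (Fin n ⊕ Fin n) S) := by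
  funext i; simp [mapHom_apply, yv]

lemma mapHom_comp_ybv : mapHom (Fin n ⊕ Fin n) (cHom (Fin n ⊕ Fin n) S) ∘ ybv n S =
    ybv n (MvPolynomial (Fin n ⊕ Fin n) S) := by
  funext i; simp [mapHom_apply, ybv]

/-- `flow_cw_gaussL` moves the antiholomorphic translation under the inner functional,
`cw_gaussL_mul` pulls in the remaining outer factors, and Fubini joins the two functionals. -/
lemma bul_bul_left (K : KahlerRing n S) (f g h : PowerSeries S) :
    K.bul (K.bul f g) h = cw K.gauss2 ((K.poly _).tripleL
      (fun i => MvPolynomial.X (.inl (.inl i))) (fun i => MvPolynomial.X (.inl (.inr i)))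
      (fun i => MvPolynomial.X (.inr (.inl i))) (fun i => MvPolynomial.X (.inr (.inr i)))
      (pmap (cHom _ S) f) (pmap (cHom _ S) g)
      (pmap (cHom _ S) h)) := by
  rw [← cw_gauss_gauss_iter, (K.iter_isHom).tripleL, bul, bul, integrand,
    map_cw_gaussL (K.cHom_isHom _), flow_cw_gaussL, mul_assoc, mul_assoc, cw_gaussL_mul,
    ((K.cHom_isHom _).mapHom _).integrand, coeffDer_B]
  simp only [pmap_pmap, mapHom_comp_cHom, iter_comp_cHom, map_mul, pmap_pexp,
    ((K.poly _).cHom_isHom _).tail, pmap_flow (((K.poly _).cHom_isHom _).A _),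
    pmap_flow (((K.poly _).cHom_isHom _).B _), pmap_C, ((K.poly _).cHom_isHom _).det]
  simp only [tripleL, iter_comp_inl_y, iter_comp_inl_yb, iter_comp_inr_y, iter_comp_inr_yb,
    mapHom_comp_yv, mapHom_comp_ybv, mul_assoc]

lemma bul_bul_right (K : KahlerRing n S) (f g h : PowerSeries S) :
    K.bul f (K.bul g h) = cw K.gauss2 ((K.poly _).tripleR
      (fun i => MvPolynomial.X (.inr (.inl i))) (fun i => MvPolynomial.X (.inr (.inr i)))
      (fun i => MvPolynomial.X (.inl (.inl i))) (fun i => MvPolynomial.X (.inl (.inr i)))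
      (pmap (cHom _ S) f) (pmap (cHom _ S) g)
      (pmap (cHom _ S) h)) := by
  rw [← cw_gauss_gauss_iter, (K.iter_isHom).tripleR, bul, bul, integrand,
    map_cw_gaussL (K.cHom_isHom _), flow_cw_gaussL,
    mul_comm (flow _ _) (cw _ _), mul_assoc, mul_assoc, cw_gaussL_mul,
    ((K.cHom_isHom _).mapHom _).integrand, coeffDer_A]
  simp only [pmap_pmap, mapHom_comp_cHom, iter_comp_cHom, map_mul, pmap_pexp,
    ((K.poly _).cHom_isHom _).tail, pmap_flow (((K.poly _).cHom_isHom _).A _),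
    pmap_flow (((K.poly _).cHom_isHom _).B _), pmap_C, ((K.poly _).cHom_isHom _).det]
  simp only [tripleR, iter_comp_inl_y, iter_comp_inl_yb, iter_comp_inr_y, iter_comp_inr_yb,
    mapHom_comp_yv, mapHom_comp_ybv, mul_assoc]

lemma shear_comp_cHom : (shear n S).comp (cHom _ S) = cHom _ S := by
  ext s : 1
  simp [cHom_apply, shear_C]

lemma shear_comp_inr_y : shear n S ∘ (fun i => MvPolynomial.X (.inr (.inl i))) =
    fun i => MvPolynomial.X (.inl (.inl i)) := by
  funext i
  simp [shear_X, shearCoeff, Fintype.sum_sum_type]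

lemma shear_comp_inr_yb : shear n S ∘ (fun i => MvPolynomial.X (.inr (.inr i))) =
    (fun i => MvPolynomial.X (.inr (.inr i))) + fun i => MvPolynomial.X (.inl (.inr i)) := by
  funext i
  simp [shear_X, shearCoeff, Fintype.sum_sum_type, add_comm]

lemma shear_comp_inl_y : shear n S ∘ (fun i => MvPolynomial.X (.inl (.inl i))) =
    fun i => MvPolynomial.X (.inr (.inl i)) + -MvPolynomial.X (.inl (.inl i)) := by
  funext i
  simp [shear_X, shearCoeff, Fintype.sum_sum_type, add_comm]

lemma shear_comp_inl_yb : shear n S ∘ (fun i => MvPolynomial.X (.inl (.inr i))) =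
    fun i => MvPolynomial.X (.inr (.inr i)) := by
  funext i
  simp [shear_X, shearCoeff, Fintype.sum_sum_type]

theorem bul_assoc (K : KahlerRing n S) (f g h : PowerSeries S) :
    K.bul (K.bul f g) h = K.bul f (K.bul g h) := by
  have hX : ∀ v, (K.poly ((Fin n ⊕ Fin n) ⊕ (Fin n ⊕ Fin n))).IsConst (MvPolynomial.X v) :=
    fun v => K.poly_const_X v
  have h1 := tripleL_eq_tripleR (K.poly ((Fin n ⊕ Fin n) ⊕ (Fin n ⊕ Fin n)))
    (x := fun i => MvPolynomial.X (.inl (.inl i))) (xb := fun i => MvPolynomial.X (.inl (.inr i)))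
    (y := fun i => MvPolynomial.X (.inr (.inl i)) + -MvPolynomial.X (.inl (.inl i)))
    (yb := fun i => MvPolynomial.X (.inr (.inr i))) (fun i => hX _) (fun i => hX _)
      (fun i => (hX _).add (hX _).neg) (fun i => hX _)
      (pmap (cHom _ S) f) (pmap (cHom _ S) g) (pmap (cHom _ S) h)
  have h2 : ((fun i => MvPolynomial.X (.inl (.inl i))) +
      (fun i => MvPolynomial.X (.inr (.inl i)) + -MvPolynomial.X (.inl (.inl i))) :
        Fin n → MvPolynomial ((Fin n ⊕ Fin n) ⊕ (Fin n ⊕ Fin n)) S) =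
      fun i => MvPolynomial.X (.inr (.inl i)) := by
    funext i
    exact add_add_neg_cancel'_right _ _
  rw [h2] at h1
  have h3 := K.shear_isHom.tripleR (fun i => MvPolynomial.X (.inr (.inl i)))
    (fun i => MvPolynomial.X (.inr (.inr i)))
      (fun i => MvPolynomial.X (.inl (.inl i))) (fun i => MvPolynomial.X (.inl (.inr i)))
      (pmap (cHom _ S) f) (pmap (cHom _ S) g) (pmap (cHom _ S) h)
  rw [shear_comp_inr_y, shear_comp_inr_yb, shear_comp_inl_y, shear_comp_inl_yb, pmap_pmap,
    pmap_pmap, pmap_pmap, shear_comp_cHom] at h3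
  rw [bul_bul_left, bul_bul_right, h1, ← h3, cw_gauss2_shear]

end KahlerRing

end FormalKahler

namespace FormalKahler

open Finset

/-! ### Deformed products on power series -/

section Deformation

variable {S T : Type*} [CommRing S] [Algebra ℂ S] [CommRing T] [Algebra ℂ T]

lemma IsXLinear.coeff_eq {F : PowerSeries S → PowerSeries T} (hF : IsXLinear F) (f : PowerSeries S)
    (m : ℕ) : PowerSeries.coeff m (F f) = ∑ p ∈ antidiagonal m,
      PowerSeries.coeff p.1 (F (PowerSeries.C (PowerSeries.coeff p.2 f))) := by
  let G : PowerSeries S → PowerSeries T := fun f => PowerSeries.mk fun m =>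
    ∑ p ∈ antidiagonal m, PowerSeries.coeff p.1 (F (PowerSeries.C (PowerSeries.coeff p.2 f)))
  have hG : IsXLinear G := by
    constructor
    · intro f g
      ext m
      simp [G, hF.add, sum_add_distrib]
    · intro f
      ext m
      cases m with
      | zero => simp [G, hF.zero]
      | succ m =>
        simp [G, PowerSeries.coeff_succ_X_mul, Nat.antidiagonal_succ', hF.zero]
  have h := hF.ext hG (fun s => ?_) f
  · rw [h]; simp [G]
  · ext m
    simp only [G, PowerSeries.coeff_mk]
    rw [sum_eq_single (m, 0)]
    · simp
    · rintro ⟨a, b⟩ hab hne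
      have : b ≠ 0 := by rintro rfl; simp_all
      simp [PowerSeries.coeff_C, this, hF.zero]
    · simp

/-- The solution of `∑_{a + b = m} T_a c_b = g_m` for `T_0 = 1`. -/
def triangularSolution (T : ℕ → S → S) (g : ℕ → S) : ℕ → S
  | m => g m - ∑ b : Fin m, T (m - b) (triangularSolution T g b)

lemma IsXLinear.bijective {F : PowerSeries S → PowerSeries S} (hF : IsXLinear F)
    (h0 : ∀ f, PowerSeries.coeff 0 (F f) = PowerSeries.coeff 0 f) : Function.Bijective F := by
  -- `F` is the identity plus a strictly lower triangular part in the coefficients, so it can be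
  -- inverted degree by degree.
  have hc : ∀ f m, PowerSeries.coeff m (F f) = PowerSeries.coeff m f + ∑ b : Fin m,
      PowerSeries.coeff (m - b) (F (PowerSeries.C (PowerSeries.coeff b f))) := fun f m => by
    rw [hF.coeff_eq, ← Nat.sum_antidiagonal_swap, Nat.sum_antidiagonal_eq_sum_range_succ_mk,
      sum_range_succ, add_comm]
    simp only [Prod.swap, Nat.sub_self]
    rw [h0, PowerSeries.coeff_C, if_pos rfl, ← Fin.sum_univ_eq_sum_range
        (fun b => PowerSeries.coeff (m - b) (F (PowerSeries.C (PowerSeries.coeff b f))))]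
  constructor
  · intro f g hfg
    ext m
    induction m using Nat.strong_induction_on with
    | _ m ih =>
      have h1 := hc f m
      have h2 := hc g m
      rw [hfg, h2] at h1
      have : ∀ b : Fin m, PowerSeries.coeff (b : ℕ) f = PowerSeries.coeff (b : ℕ) g := fun b => ih b b.2
      simp only [this] at h1
      exact (add_right_cancel h1).symm
  · intro g
    refine ⟨PowerSeries.mk (triangularSolution
      (fun a s => PowerSeries.coeff a (F (PowerSeries.C s))) fun m => PowerSeries.coeff m g), ?_⟩
    ext m
    rw [hc]
    simp only [PowerSeries.coeff_mk]
    rw [triangularSolution]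
    simp

/-- An associative product on power series that is linear over the variable and deforms the given
product. -/
structure IsDeformation (B : PowerSeries S → PowerSeries S → PowerSeries S) : Prop where
  left : ∀ g, IsXLinear fun f => B f g
  right : ∀ f, IsXLinear (B f)
  assoc : ∀ f g h, B (B f g) h = B f (B g h)
  coeff_zero : ∀ f g, PowerSeries.coeff 0 (B f g) = PowerSeries.coeff 0 f * PowerSeries.coeff 0 g

namespace IsDeformation

variable {B : PowerSeries S → PowerSeries S → PowerSeries S}

lemma bijective_left (hB : IsDeformation B) : Function.Bijective (B 1) :=
  (hB.right 1).bijective fun f => by rw [hB.coeff_zero]; simp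

lemma bijective_right (hB : IsDeformation B) : Function.Bijective fun f => B f 1 :=
  (hB.left 1).bijective fun f => by rw [hB.coeff_zero]; simp

/-- If `e • 1 = 1`, then `e • (1 • g) = 1 • g`, and every element has the form `1 • g`; hence `e` is
a left unit. A right unit arises in the same way, and the two coincide. -/
theorem exists_unit (hB : IsDeformation B) : ∃ e, ∀ f, B e f = f ∧ B f e = f := by
  obtain ⟨e, he⟩ := hB.bijective_right.2 1
  obtain ⟨e', he'⟩ := hB.bijective_left.2 1
  have h1 : ∀ f, B e f = f := fun f => by
    obtain ⟨g, rfl⟩ := hB.bijective_left.2 f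
    rw [← hB.assoc]
    exact congrArg (fun x => B x g) he
  have h2 : ∀ f, B f e' = f := fun f => by
    obtain ⟨g, rfl⟩ := hB.bijective_right.2 f
    change B (B g 1) e' = _
    rw [hB.assoc, he']
  have : e' = e := by rw [← h1 e', h2 e]
  exact ⟨e, fun f => ⟨h1 f, this ▸ h2 f⟩⟩

lemma coeff_zero_unit (hB : IsDeformation B) {e : PowerSeries S} (he : ∀ f, B e f = f) :
    PowerSeries.coeff 0 e = 1 := by
  have := congrArg (PowerSeries.coeff 0) (he 1)
  rw [hB.coeff_zero] at this
  simpa using this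

lemma coeff_eq (hB : IsDeformation B) (f g : PowerSeries S) (m : ℕ) :
    PowerSeries.coeff m (B f g) = ∑ kc ∈ antidiagonal m, ∑ ab ∈ antidiagonal kc.2,
      PowerSeries.coeff kc.1 (B (PowerSeries.C (PowerSeries.coeff ab.1 f))
        (PowerSeries.C (PowerSeries.coeff ab.2 g))) := by
  rw [(hB.left g).coeff_eq]
  simp only [(hB.right _).coeff_eq g]
  rw [sum_sigma', sum_sigma']
  refine sum_nbij' (fun x => ⟨(x.2.1, x.1.2 + x.2.2), (x.1.2, x.2.2)⟩)
    (fun x => ⟨(x.1.1 + x.2.2, x.2.1), (x.1.1, x.2.2)⟩) ?_ ?_ ?_ ?_ ?_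
  · rintro ⟨⟨a, b⟩, c, d⟩ h
    simp at h ⊢; omega
  · rintro ⟨⟨a, b⟩, c, d⟩ h
    simp at h ⊢; omega
  · rintro ⟨⟨a, b⟩, c, d⟩ h
    simp at h ⊢; omega
  · rintro ⟨⟨a, b⟩, c, d⟩ h
    simp at h ⊢; omega
  · rintro ⟨⟨a, b⟩, c, d⟩ h
    rfl

lemma coeff_one (hB : IsDeformation B) (f g : PowerSeries S) :
    PowerSeries.coeff 1 (B f g) =
      PowerSeries.coeff 0 f * PowerSeries.coeff 1 g + PowerSeries.coeff 1 f * PowerSeries.coeff 0 g +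
        PowerSeries.coeff 1 (B (PowerSeries.C (PowerSeries.coeff 0 f))
          (PowerSeries.C (PowerSeries.coeff 0 g))) := by
  rw [hB.coeff_eq]
  simp only [Nat.antidiagonal_succ, Nat.antidiagonal_zero, map_singleton, sum_cons, sum_singleton,
    hB.coeff_zero, Function.Embedding.prodMap, Function.Embedding.coeFn_mk, Prod.map,
    Function.Embedding.refl_apply, PowerSeries.coeff_C, if_true]

/-- If the first order term of a deformation is a bidifferential operator that differs from
`M` by terms in which only one of the arguments is differentiated, then the first order term of the
normalized product is `M`. -/
theorem coeff_one_normalized (hB : IsDeformation B) {e : PowerSeries S}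
    (he : ∀ f, B e f = f ∧ B f e = f) {w : S} {a b : S → S} {M : S → S → S} (ha : a 1 = 0)
    (hb : b 1 = 0) (hM : ∀ f, M 1 f = 0) (hM' : ∀ f, M f 1 = 0)
    (h : ∀ f g, PowerSeries.coeff 1 (B (PowerSeries.C f) (PowerSeries.C g)) =
      w * f * g + g * a f + f * b g + M f g) {f g s : PowerSeries S}
    (hs : e * s = B (f * e) (g * e)) :
    PowerSeries.coeff 0 s = PowerSeries.coeff 0 f * PowerSeries.coeff 0 g ∧
    PowerSeries.coeff 1 s = PowerSeries.coeff 0 f * PowerSeries.coeff 1 g +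
      PowerSeries.coeff 1 f * PowerSeries.coeff 0 g +
      M (PowerSeries.coeff 0 f) (PowerSeries.coeff 0 g) := by
  have e0 := hB.coeff_zero_unit fun f => (he f).1
  have hmul : ∀ u v : PowerSeries S, PowerSeries.coeff 1 (u * v) =
      PowerSeries.coeff 0 u * PowerSeries.coeff 1 v + PowerSeries.coeff 1 u * PowerSeries.coeff 0 v :=
    fun u v => by simp [PowerSeries.coeff_mul, Nat.antidiagonal_succ]
  have hmul0 : ∀ u v : PowerSeries S, PowerSeries.coeff 0 (u * v) =
      PowerSeries.coeff 0 u * PowerSeries.coeff 0 v := fun u v => by simp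
  have h1 : ∀ t, PowerSeries.coeff 1 e * t + w * t + b t = 0 := fun t => by
    have := congrArg (PowerSeries.coeff 1) (he (PowerSeries.C t)).1
    rw [hB.coeff_one, e0, h, ha, hM] at this
    simp [PowerSeries.coeff_C] at this
    linear_combination this
  have h2 : ∀ t, t * PowerSeries.coeff 1 e + w * t + a t = 0 := fun t => by
    have := congrArg (PowerSeries.coeff 1) (he (PowerSeries.C t)).2
    rw [hB.coeff_one, e0, h, hb, hM'] at this
    simp [PowerSeries.coeff_C] at this
    linear_combination this
  -- Evaluating the unit equation at `t = 1` determines the first coefficient of `e` as `-w`; with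
  -- `h1` and `h2` this forces the one-sided terms `a` and `b` to vanish.
  have hw : PowerSeries.coeff 1 e + w = 0 := by
    have := h1 1
    rw [hb] at this
    linear_combination this
  have s0 : PowerSeries.coeff 0 s = PowerSeries.coeff 0 f * PowerSeries.coeff 0 g := by
    have := congrArg (PowerSeries.coeff 0) hs
    rw [hB.coeff_zero, hmul0, hmul0, hmul0, e0] at this
    linear_combination this
  refine ⟨s0, ?_⟩
  have := congrArg (PowerSeries.coeff 1) hs
  rw [hB.coeff_one, hmul, hmul, hmul, hmul0, hmul0, e0, h, s0] at this
  simp only [mul_one] at this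
  linear_combination this + PowerSeries.coeff 0 f * h1 (PowerSeries.coeff 0 g) +
    PowerSeries.coeff 0 g * h2 (PowerSeries.coeff 0 f) -
    PowerSeries.coeff 0 f * PowerSeries.coeff 0 g * hw

end IsDeformation

lemma pmap_isXLinear (φ : S →ₐ[ℂ] T) : IsXLinear (pmap φ) :=
  ⟨map_add _, fun f => by rw [map_mul]; congr 1; simp [pmap]⟩

/-- `ℂ[[X]]`-linearity follows from linearity over `X` and homogeneity over `ℂ`, by the principle
`IsXLinear.ext` applied to the scalar. -/
lemma IsXLinear.pmap_ofId_mul {F : PowerSeries S → PowerSeries T} (hF : IsXLinear F)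
    (h : ∀ (c : ℂ) s, F (c • s) = c • F s) (c : PowerSeries ℂ) (f : PowerSeries S) :
    F (pmap (Algebra.ofId ℂ S) c * f) = pmap (Algebra.ofId ℂ T) c * F f := by
  refine (hF.comp ((pmap_isXLinear _).mul_right f)).ext ((pmap_isXLinear _).mul_right (F f))
    (fun a => ?_) c
  have e1 : pmap (Algebra.ofId ℂ S) (PowerSeries.C a) * f = a • f := by
    ext m; rw [coeff_csmul]; simp [Algebra.ofId_apply, Algebra.smul_def]
  have e2 : pmap (Algebra.ofId ℂ T) (PowerSeries.C a) * F f = a • F f := by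
    ext m; rw [coeff_csmul]; simp [Algebra.ofId_apply, Algebra.smul_def]
  rw [e1, e2, h]

end Deformation


/-! ### Even power series -/

section Even

variable {S T : Type*} [CommRing S] [Algebra ℂ S] [CommRing T] [Algebra ℂ T]

/-- The substitution of `X ^ 2` for `X`. -/
def doubleExp (f : PowerSeries S) : PowerSeries S :=
  PowerSeries.mk fun m => if Even m then PowerSeries.coeff (m / 2) f else 0

/-- The power series of the coefficients with even index. -/
def halfExp (f : PowerSeries S) : PowerSeries S := PowerSeries.mk fun m => PowerSeries.coeff (2 * m) f

/-- The substitution of `-X` for `X`. -/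
def alt : PowerSeries S →+* PowerSeries S := PowerSeries.rescale (algebraMap ℂ S (-1))

lemma coeff_alt (f : PowerSeries S) (m : ℕ) :
    PowerSeries.coeff m (alt f) = (-1 : ℂ) ^ m • PowerSeries.coeff m f := by
  rw [alt, PowerSeries.coeff_rescale, ← map_pow, Algebra.smul_def]

lemma doubleExp_add (f g : PowerSeries S) : doubleExp (f + g) = doubleExp f + doubleExp g := by
  ext m
  simp only [doubleExp, PowerSeries.coeff_mk, map_add]
  split_ifs <;> simp

lemma doubleExp_X_mul (f : PowerSeries S) :
    doubleExp (PowerSeries.X * f) = PowerSeries.X * (PowerSeries.X * doubleExp f) := by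
  ext m
  match m with
  | 0 => simp [doubleExp]
  | 1 => simp [doubleExp, PowerSeries.coeff_succ_X_mul]
  | m + 2 =>
    have h : (m + 2) / 2 = m / 2 + 1 := by omega
    rw [PowerSeries.coeff_succ_X_mul, PowerSeries.coeff_succ_X_mul]
    simp only [doubleExp, PowerSeries.coeff_mk, h, PowerSeries.coeff_succ_X_mul, Nat.even_add_one,
      not_not]

lemma doubleExp_C (s : S) : doubleExp (PowerSeries.C s) = PowerSeries.C s := by
  ext m
  simp only [doubleExp, PowerSeries.coeff_mk, PowerSeries.coeff_C]
  rcases eq_or_ne m 0 with rfl | hm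
  · simp
  · rw [if_neg hm]
    split_ifs with h1 h2
    · obtain ⟨k, rfl⟩ := h1
      omega
    · rfl
    · rfl

lemma alt_doubleExp (f : PowerSeries S) : alt (doubleExp f) = doubleExp f := by
  ext m
  rw [coeff_alt]
  simp only [doubleExp, PowerSeries.coeff_mk]
  split_ifs with h
  · rw [h.neg_one_pow, one_smul]
  · rw [smul_zero]

lemma doubleExp_halfExp {f : PowerSeries S} (hf : alt f = f) : doubleExp (halfExp f) = f := by
  ext m
  simp only [doubleExp, halfExp, PowerSeries.coeff_mk]
  split_ifs with h
  · rw [Nat.mul_div_cancel' h.two_dvd]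
  · have h1 := congrArg (PowerSeries.coeff m) hf
    rw [coeff_alt, (Nat.not_even_iff_odd.1 h).neg_one_pow, neg_one_smul] at h1
    have h2 : (2 : ℂ) • PowerSeries.coeff m f = 0 := by
      rw [two_smul]; nth_rewrite 1 [← h1]; simp
    have h3 := congrArg (fun s => (2⁻¹ : ℂ) • s) h2
    simpa [smul_smul] using h3.symm

lemma alt_opS (c : ℕ → ℂ) (D : Module.End ℂ S) (f : PowerSeries S) :
    alt (opS c D f) = opS c (-D) (alt f) := by
  ext m
  rw [coeff_alt, coeff_opS, coeff_opS, smul_sum]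
  refine sum_congr rfl fun p hp => ?_
  rw [coeff_alt, ← mem_antidiagonal.1 hp, map_smul, neg_pow D, smul_smul, smul_smul, pow_add]
  rcases Nat.even_or_odd p.1 with h | h <;> simp [h.neg_one_pow, mul_comm]

lemma alt_flow (D : Derivation ℂ S S) (f : PowerSeries S) : alt (flow D f) = flow (-D) (alt f) := by
  rw [flow_apply, flow_apply, alt_opS, Derivation.coe_neg_linearMap]

lemma alt_flowInt (D : Derivation ℂ S S) (f : PowerSeries S) :
    alt (flowInt D f) = flowInt (-D) (alt f) := by
  rw [flowInt, flowInt, alt_opS, Derivation.coe_neg_linearMap]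

lemma alt_C (s : S) : alt (PowerSeries.C s) = PowerSeries.C s := by
  ext m
  rw [coeff_alt, PowerSeries.coeff_C]
  split_ifs with h <;> simp [h]

lemma alt_cw (L : S →ₗ[ℂ] T) (f : PowerSeries S) : alt (cw L f) = cw L (alt f) := by
  ext m
  simp [coeff_alt]

lemma alt_pmap (φ : S →ₐ[ℂ] T) (f : PowerSeries S) : alt (pmap φ f) = pmap φ (alt f) := by
  rw [← cw_map, ← cw_map, alt_cw]

end Even

/-! ### Parity in `ε`, the product in `ħ`, and its first-order term. -/

namespace KahlerRing

variable {n : ℕ} {S : Type*} [CommRing S] [Algebra ℂ S]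

/-- Displacements occur only multiplied by `ε`, apart from `κ`, which is even in them; so changing
the sign of `ε` amounts to reversing both displacements. -/
lemma alt_integrand (K : KahlerRing n S) (ξ η : Fin n → S) (f g : PowerSeries S) :
    alt (K.integrand ξ η f g) = K.integrand (-ξ) (-η) (alt f) (alt g) := by
  have h : ∀ V : PowerSeries S, alt (pexp V) = pexp (alt V) := fun V => rescale_pexp _ _
  simp only [integrand, map_mul, alt_flow, h, tail, map_sub, alt_C, alt_flowInt, A_neg, B_neg,
    κ_neg_neg]

/-- The substitution `y ↦ -y`, `ȳ ↦ -ȳ`. -/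
def neg (V S : Type*) [CommRing S] [Algebra ℂ S] : MvPolynomial V S →ₐ[ℂ] MvPolynomial V S :=
  (MvPolynomial.aeval (R := S) fun v => -MvPolynomial.X v).restrictScalars ℂ

lemma neg_C {V : Type*} (s : S) : neg V S (MvPolynomial.C s) = MvPolynomial.C s := by
  simp [neg]

lemma neg_X {V : Type*} (v : V) : neg V S (MvPolynomial.X v) = -MvPolynomial.X v := by
  simp [neg]

lemma neg_comp_cHom {V : Type*} : (neg V S).comp (cHom V S) = cHom V S := by
  ext s : 1
  simp [cHom_apply, neg_C]

lemma neg_isHom (K : KahlerRing n S) (V : Type*) : IsHom (K.poly V) (K.poly V) (neg V S) :=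
  isHom_of_poly (by rw [neg_comp_cHom]; exact cHom_isHom _ _) fun v => by
    rw [neg_X]; exact (K.poly_const_X v).neg

lemma gaussL_neg (K : KahlerRing n S) (P : MvPolynomial (Fin n ⊕ Fin n) S) :
    K.gaussL (neg _ S P) = K.gaussL P := by
  classical
  have h := wick_subst (φ := RingHom.id S) (s := (neg (Fin n ⊕ Fin n) S : _ →+* _))
    (l := fun v w => if v = w then -1 else 0) neg_C (fun v => by
      simp only [apply_ite MvPolynomial.C, map_neg, map_one, map_zero, ite_mul, zero_mul, sum_ite_eq,
        mem_univ, if_true, neg_one_mul]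
      exact neg_X v) K.cov_symm K.cov_symm
    (fun v w => by simp) P
  exact congrArg (fun s => K.d * s) h

/-- The Gaussian functional is invariant under `y ↦ -y`, `ȳ ↦ -ȳ`. This serves the parity argument
and, in the trace, the exchange of the two points. -/
lemma bul_eq_neg (K : KahlerRing n S) (f g : PowerSeries S) :
    K.bul f g = cw K.gaussL ((K.poly _).integrand (-yv n S) (-ybv n S)
      (pmap (cHom _ S) f) (pmap (cHom _ S) g)) := by
  have h := (K.neg_isHom (Fin n ⊕ Fin n)).integrand (yv n S) (ybv n S)
    (pmap (cHom _ S) f) (pmap (cHom _ S) g)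
  have e1 : neg _ S ∘ yv n S = -yv n S := funext fun i => neg_X _
  have e2 : neg _ S ∘ ybv n S = -ybv n S := funext fun i => neg_X _
  rw [pmap_pmap, pmap_pmap, neg_comp_cHom, e1, e2] at h
  rw [← h, bul]
  ext m
  rw [coeff_cw, coeff_cw, coeff_pmap, gaussL_neg]

lemma alt_bul (K : KahlerRing n S) (f g : PowerSeries S) :
    alt (K.bul f g) = K.bul (alt f) (alt g) := by
  rw [K.bul_eq_neg (alt f), bul, alt_cw, alt_integrand, alt_pmap, alt_pmap]

lemma flow_isXLinear (D : Derivation ℂ S S) : IsXLinear (flow D) :=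
  let h := opS_isXLinear (fun m => ((m.factorial : ℂ))⁻¹) (D : S →ₗ[ℂ] S)
  ⟨h.add, h.X_mul⟩

lemma bul_left (K : KahlerRing n S) (g : PowerSeries S) : IsXLinear fun f => K.bul f g :=
  (cw_isXLinear _).comp (((((flow_isXLinear _).comp (pmap_isXLinear _)).mul_right _).mul_right
    _).mul_right _)

lemma bul_right (K : KahlerRing n S) (f : PowerSeries S) : IsXLinear (K.bul f) :=
  (cw_isXLinear _).comp (((((flow_isXLinear _).comp (pmap_isXLinear _)).mul_left _).mul_right
    _).mul_right _)

/-- The non-normalized product, as a power series in `ħ = ε²`. -/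
def bullet (K : KahlerRing n S) (f g : PowerSeries S) : PowerSeries S :=
  halfExp (K.bul (doubleExp f) (doubleExp g))

/-- Products of even series are even, so passing to even coefficients loses nothing and
associativity descends from `bul`. -/
lemma doubleExp_bullet (K : KahlerRing n S) (f g : PowerSeries S) :
    doubleExp (K.bullet f g) = K.bul (doubleExp f) (doubleExp g) :=
  doubleExp_halfExp (by rw [alt_bul, alt_doubleExp, alt_doubleExp])

lemma gaussL_C_mul (K : KahlerRing n S) (s : S) (P : MvPolynomial (Fin n ⊕ Fin n) S) :
    K.gaussL (MvPolynomial.C s * P) = s * K.gaussL P := by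
  rw [gaussL_apply, gaussL_apply, ← MvPolynomial.smul_eq_C_mul, map_smul, smul_eq_mul]

lemma gaussL_C_det_mul (K : KahlerRing n S) (P : MvPolynomial (Fin n ⊕ Fin n) S) :
    K.gaussL (MvPolynomial.C K.h.det * P) = wick K.cov K.cov_symm P := by
  rw [gaussL_C_mul, gaussL_apply, gauss_apply, ← mul_assoc, mul_comm K.h.det, K.d_mul, one_mul]

lemma poly_det (K : KahlerRing n S) (V : Type*) :
    (K.poly V).h.det = MvPolynomial.C K.h.det := (K.cHom_isHom V).det.symm

lemma coeff_zero_mul' (f g : PowerSeries S) : PowerSeries.coeff 0 (f * g) =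
    PowerSeries.coeff 0 f * PowerSeries.coeff 0 g := by simp

lemma coeff_zero_bul (K : KahlerRing n S) (f g : PowerSeries S) :
    PowerSeries.coeff 0 (K.bul f g) = PowerSeries.coeff 0 f * PowerSeries.coeff 0 g := by
  rw [bul, coeff_cw, integrand, coeff_zero_mul', coeff_zero_mul', coeff_zero_mul', coeff_zero_flow,
    coeff_zero_flow, coeff_zero_flow, coeff_zero_flow, coeff_zero_pexp, coeff_pmap, coeff_pmap,
    PowerSeries.coeff_C, if_pos rfl, poly_det, mul_comm, gaussL_C_det_mul, mul_one, ← map_mul,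
    cHom_apply, wick_C]

theorem bullet_isDeformation (K : KahlerRing n S) : IsDeformation K.bullet where
  left g := by
    refine ⟨fun f f' => ?_, fun f => ?_⟩
    · ext m
      simp [bullet, halfExp, doubleExp_add, (K.bul_left _).add]
    · ext m
      simp only [bullet, doubleExp_X_mul, (K.bul_left _).X_mul]
      cases m <;> simp [halfExp, PowerSeries.coeff_succ_X_mul, mul_add]
  right f := by
    refine ⟨fun g g' => ?_, fun g => ?_⟩
    · ext m
      simp [bullet, halfExp, doubleExp_add, (K.bul_right _).add]
    · ext m
      simp only [bullet, doubleExp_X_mul, (K.bul_right _).X_mul]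
      cases m <;> simp [halfExp, PowerSeries.coeff_succ_X_mul, mul_add]
  assoc f g h := by
    rw [bullet, doubleExp_bullet, bul_assoc, ← doubleExp_bullet]; rfl
  coeff_zero f g := by
    rw [bullet, halfExp, PowerSeries.coeff_mk, mul_zero, coeff_zero_bul]
    simp [doubleExp]

lemma coeff_bullet_C (K : KahlerRing n S) (f g : S) (m : ℕ) :
    PowerSeries.coeff m (K.bullet (PowerSeries.C f) (PowerSeries.C g)) =
      PowerSeries.coeff (2 * m) (K.bul (PowerSeries.C f) (PowerSeries.C g)) := by
  simp [bullet, halfExp, doubleExp_C]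

lemma bul_smul_left (K : KahlerRing n S) (c : ℂ) (f g : PowerSeries S) :
    K.bul (c • f) g = c • K.bul f g := by
  have : pmap (cHom (Fin n ⊕ Fin n) S) (c • f) = c • pmap (cHom _ S) f := by
    rw [← cw_map, map_smul, cw_map]
  rw [bul, bul, integrand, this, flow_apply, map_smul, smul_mul_assoc, smul_mul_assoc, smul_mul_assoc,
    map_smul]
  rfl

lemma bul_smul_right (K : KahlerRing n S) (c : ℂ) (f g : PowerSeries S) :
    K.bul f (c • g) = c • K.bul f g := by
  have : pmap (cHom (Fin n ⊕ Fin n) S) (c • g) = c • pmap (cHom _ S) g := by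
    rw [← cw_map, map_smul, cw_map]
  rw [bul, bul, integrand, this, flow_apply _ (c • _), map_smul, mul_smul_comm, smul_mul_assoc,
    smul_mul_assoc, map_smul]
  rfl

lemma doubleExp_smul (c : ℂ) (f : PowerSeries S) : doubleExp (c • f) = c • doubleExp f := by
  ext m
  simp only [doubleExp, PowerSeries.coeff_mk, coeff_csmul]
  split_ifs <;> simp

lemma bullet_smul_left (K : KahlerRing n S) (c : ℂ) (f g : PowerSeries S) :
    K.bullet (c • f) g = c • K.bullet f g := by
  ext m
  simp [bullet, doubleExp_smul, bul_smul_left, halfExp]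

lemma bullet_smul_right (K : KahlerRing n S) (c : ℂ) (f g : PowerSeries S) :
    K.bullet f (c • g) = c • K.bullet f g := by
  ext m
  simp [bullet, doubleExp_smul, bul_smul_right, halfExp]

/-- The first order term of the non-normalized product. -/
theorem coeff_one_bullet (K : KahlerRing n S) : ∃ (w : S) (a b : S → S), a 1 = 0 ∧ b 1 = 0 ∧
    ∀ f g, PowerSeries.coeff 1 (K.bullet (PowerSeries.C f) (PowerSeries.C g)) =
      w * f * g + g * a f + f * b g + ∑ i, ∑ j, K.hi i j * K.b j f * K.a i g := by
  set Q := K.poly (Fin n ⊕ Fin n)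
  -- `W` gathers the factors of the integrand that involve neither `f` nor `g`.
  obtain ⟨W, hW⟩ : ∃ W, W = pexp (Q.tail (yv n S) (ybv n S)) *
    flow (Q.A (yv n S)) (flow (Q.B (ybv n S)) (PowerSeries.C Q.h.det)) := ⟨_, rfl⟩
  have hW0 : PowerSeries.coeff 0 W = MvPolynomial.C K.h.det := by
    rw [hW, coeff_zero_mul', coeff_zero_pexp, coeff_zero_flow, coeff_zero_flow, PowerSeries.coeff_C,
      if_pos rfl, one_mul, poly_det]
  -- The order `ε²` terms in which only one argument is differentiated: once, against `W_1`, or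
  -- twice, against `W_0`.
  let F : (Derivation ℂ (MvPolynomial (Fin n ⊕ Fin n) S) (MvPolynomial (Fin n ⊕ Fin n) S)) → S → S :=
    fun D f => K.gaussL (D (MvPolynomial.C f) * PowerSeries.coeff 1 W +
      (2⁻¹ : ℂ) • D (D (MvPolynomial.C f)) * PowerSeries.coeff 0 W)
  refine ⟨K.gaussL (PowerSeries.coeff 2 W), F (Q.B (ybv n S)), F (Q.A (yv n S)), by simp [F],
    by simp [F], fun f g => ?_⟩
  have e0 : ∀ D : Derivation ℂ (MvPolynomial (Fin n ⊕ Fin n) S) (MvPolynomial (Fin n ⊕ Fin n) S),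
      ∀ f : S, PowerSeries.coeff 0 (flow D (PowerSeries.C (MvPolynomial.C f))) = MvPolynomial.C f :=
    fun D f => by rw [coeff_zero_flow, PowerSeries.coeff_C, if_pos rfl]
  have e1 : ∀ D : Derivation ℂ (MvPolynomial (Fin n ⊕ Fin n) S) (MvPolynomial (Fin n ⊕ Fin n) S),
      ∀ f : S, PowerSeries.coeff 1 (flow D (PowerSeries.C (MvPolynomial.C f))) =
        D (MvPolynomial.C f) :=
    fun D f => by rw [flow_apply, coeff_opS_C]; simp
  have e2 : ∀ D : Derivation ℂ (MvPolynomial (Fin n ⊕ Fin n) S) (MvPolynomial (Fin n ⊕ Fin n) S),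
      ∀ f : S, PowerSeries.coeff 2 (flow D (PowerSeries.C (MvPolynomial.C f))) =
        (2⁻¹ : ℂ) • D (D (MvPolynomial.C f)) :=
    fun D f => by rw [flow_apply, coeff_opS_C]; simp [pow_two]
  have hm1 : ∀ u v : PowerSeries (MvPolynomial (Fin n ⊕ Fin n) S), PowerSeries.coeff 1 (u * v) =
      PowerSeries.coeff 0 u * PowerSeries.coeff 1 v + PowerSeries.coeff 1 u * PowerSeries.coeff 0 v :=
    fun u v => by simp [PowerSeries.coeff_mul, Nat.antidiagonal_succ]
  have hm2 : ∀ u v : PowerSeries (MvPolynomial (Fin n ⊕ Fin n) S), PowerSeries.coeff 2 (u * v) =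
      PowerSeries.coeff 0 u * PowerSeries.coeff 2 v + PowerSeries.coeff 1 u * PowerSeries.coeff 1 v +
        PowerSeries.coeff 2 u * PowerSeries.coeff 0 v :=
    fun u v => by simp [PowerSeries.coeff_mul, Nat.antidiagonal_succ, add_assoc]
  rw [coeff_bullet_C, mul_one, bul, coeff_cw, integrand, mul_assoc, ← hW, pmap_C, pmap_C, cHom_apply,
    cHom_apply, hm2, coeff_zero_mul', hm1, hm2, e0, e0, e1, e1, e2, e2]
  -- In the mixed term each argument is differentiated once, leaving `W_0 = det H`, which cancels
  -- the normalization; the covariance of `y_i ȳ_j` is `h^{ij}`.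
  have hM : K.gaussL (Q.B (ybv n S) (MvPolynomial.C f) * Q.A (yv n S) (MvPolynomial.C g) *
      PowerSeries.coeff 0 W) = ∑ i, ∑ j, K.hi i j * K.b j f * K.a i g := by
    rw [hW0, mul_comm, gaussL_C_det_mul, B_apply, A_apply, sum_mul_sum, sum_comm]
    simp only [map_sum]
    refine sum_congr rfl fun i _ => sum_congr rfl fun j _ => ?_
    have hb : Q.b j (MvPolynomial.C f) = MvPolynomial.C (K.b j f) := coeffDer_C _ _
    have ha : Q.a i (MvPolynomial.C g) = MvPolynomial.C (K.a i g) := coeffDer_C _ _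
    have hp : ybv n S j * MvPolynomial.C (K.b j f) * (yv n S i * MvPolynomial.C (K.a i g)) =
        MvPolynomial.C (K.b j f * K.a i g) * (yv n S i * ybv n S j) := by
      rw [map_mul]; ring
    rw [hb, ha, hp, wick_C_mul, wick_yv_ybv]
    ring
  rw [← hM]
  have e3 : ∀ s P, s * K.gaussL P = K.gaussL (MvPolynomial.C s * P) := fun s P => (K.gaussL_C_mul s P).symm
  have e4 : K.gaussL (PowerSeries.coeff 2 W) * f * g =
      f * g * K.gaussL (PowerSeries.coeff 2 W) := by ring
  rw [e4]
  simp only [F, e3, Q]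
  rw [← map_add, ← map_add, ← map_add]
  congr 1
  simp only [map_mul]
  ring

end KahlerRing

end FormalKahler

namespace FormalKahler

open Finset

/-! ### The trace -/

namespace KahlerRing

variable {n : ℕ} {S : Type*} [CommRing S] [Algebra ℂ S]

lemma coeff_mul_mem {J : Ideal S} {f : PowerSeries S} (hf : ∀ m, PowerSeries.coeff m f ∈ J)
    (g : PowerSeries S) (m : ℕ) : PowerSeries.coeff m (f * g) ∈ J := by
  rw [PowerSeries.coeff_mul]
  exact J.sum_mem fun p _ => J.mul_mem_right _ (hf _)

lemma coeff_flow_mem {J : Ideal S} {D : Derivation ℂ S S} (hD : ∀ s ∈ J, D s ∈ J)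
    {f : PowerSeries S} (hf : ∀ m, PowerSeries.coeff m f ∈ J) (m : ℕ) :
    PowerSeries.coeff m (flow D f) ∈ J := by
  have hp : ∀ k, ∀ s ∈ J, ((D : S →ₗ[ℂ] S) ^ k) s ∈ J := by
    intro k
    induction k with
    | zero => intro s hs; simpa using hs
    | succ k ih => intro s hs; rw [pow_succ', Module.End.mul_apply]; exact hD _ (ih s hs)
  rw [flow_apply, coeff_opS]
  refine J.sum_mem fun p _ => ?_
  rw [Algebra.smul_def]
  exact J.mul_mem_left _ (hp _ _ (hf _))

lemma A_mem {K : KahlerRing n S} {J : Ideal S} (ha : ∀ i, ∀ s ∈ J, K.a i s ∈ J) (ξ : Fin n → S)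
    {s : S} (hs : s ∈ J) : K.A ξ s ∈ J := by
  rw [A_apply]
  exact J.sum_mem fun i _ => J.mul_mem_left _ (ha i s hs)

lemma B_mem {K : KahlerRing n S} {J : Ideal S} (hb : ∀ i, ∀ s ∈ J, K.b i s ∈ J) (ξ : Fin n → S)
    {s : S} (hs : s ∈ J) : K.B ξ s ∈ J := by
  rw [B_apply]
  exact J.sum_mem fun i _ => J.mul_mem_left _ (hb i s hs)

lemma coeffDer_mem {V : Type*} {J : Ideal S} {D : Derivation ℂ S S} (hD : ∀ s ∈ J, D s ∈ J)
    {P : MvPolynomial V S} (hP : P ∈ J.map (MvPolynomial.C (σ := V))) :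
    coeffDer V D P ∈ J.map (MvPolynomial.C (σ := V)) := by
  rw [MvPolynomial.mem_map_C_iff] at hP ⊢
  intro m
  rw [coeff_coeffDer]
  exact hD _ (hP m)

lemma gaussL_mem (K : KahlerRing n S) {J : Ideal S} {P : MvPolynomial (Fin n ⊕ Fin n) S}
    (hP : P ∈ J.map (MvPolynomial.C (σ := Fin n ⊕ Fin n))) : K.gaussL P ∈ J := by
  rw [MvPolynomial.mem_map_C_iff] at hP
  rw [P.as_sum, map_sum]
  refine J.sum_mem fun m _ => ?_
  rw [← mul_one (MvPolynomial.coeff m P), ← MvPolynomial.C_mul_monomial, gaussL_C_mul]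
  exact J.mul_mem_right _ (hP m)

lemma coeff_integrand_mem {K : KahlerRing n S} {J : Ideal S} (hb : ∀ i, ∀ s ∈ J, K.b i s ∈ J)
    (ξ η : Fin n → S) {f : PowerSeries S} (hf : ∀ m, PowerSeries.coeff m f ∈ J) (g : PowerSeries S)
    (m : ℕ) : PowerSeries.coeff m (K.integrand ξ η f g) ∈ J :=
  coeff_mul_mem (coeff_mul_mem (coeff_mul_mem (coeff_flow_mem (fun _ => B_mem hb _) hf) _) _) _ m

lemma coeff_bul_mem {K : KahlerRing n S} {J : Ideal S} (hb : ∀ i, ∀ s ∈ J, K.b i s ∈ J)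
    {f : PowerSeries S} (hf : ∀ m, PowerSeries.coeff m f ∈ J) (g : PowerSeries S) (m : ℕ) :
    PowerSeries.coeff m (K.bul f g) ∈ J := by
  rw [bul, coeff_cw]
  refine K.gaussL_mem (coeff_integrand_mem (fun i _ => coeffDer_mem (hb i)) _ _ (fun k => ?_) _ _)
  rw [coeff_pmap]
  exact Ideal.mem_map_of_mem _ (hf k)

/-- The variables are constants for the derivations, so `derivation_gauss` applied to `y_i P` and
`ȳ_i P` writes the argument of `σ` as a sum of `∂_i Γ(y_i P)` and `∂̄_i Γ(ȳ_i P)`. -/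
lemma gaussL_A_B (K : KahlerRing n S) {J : Ideal S} {σ : S →ₗ[ℂ] ℂ}
    (hσa : ∀ i, ∀ s ∈ J, σ (K.a i s) = 0) (hσb : ∀ i, ∀ s ∈ J, σ (K.b i s) = 0)
    {P : MvPolynomial (Fin n ⊕ Fin n) S} (hP : P ∈ J.map (MvPolynomial.C (σ := Fin n ⊕ Fin n))) :
    σ (K.gaussL (((K.poly _).A (yv n S) + (K.poly _).B (ybv n S)) P -
      ((K.poly _).A (yv n S) + (K.poly _).B (ybv n S)) ((K.poly _).κ (yv n S) (ybv n S)) * P)) = 0 := by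
  have key : ∀ (D : Derivation ℂ S S) (v : Fin n ⊕ Fin n), (∀ s ∈ J, σ (D s) = 0) →
      σ (K.gaussL (MvPolynomial.X v * (coeffDer _ D P -
        coeffDer _ D ((K.poly _).κ (yv n S) (ybv n S)) * P))) = 0 := fun D v hD => by
    have h := K.derivation_gauss D (MvPolynomial.X v * P)
    rw [Derivation.leibniz, coeffDer_X, smul_zero, add_zero, smul_eq_mul] at h
    rw [← hD _ (K.gaussL_mem (Ideal.mul_mem_left _ (MvPolynomial.X v) hP)), gaussL_apply, gaussL_apply, ← h]
    congr 2
    ring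
  rw [Derivation.add_apply, Derivation.add_apply, A_apply, B_apply, A_apply, B_apply]
  have e : ∀ (F G : Fin n → MvPolynomial (Fin n ⊕ Fin n) S) (F' G' : Fin n → MvPolynomial (Fin n ⊕ Fin n) S),
      (∑ i, yv n S i * F i + ∑ i, ybv n S i * G i) - (∑ i, yv n S i * F' i + ∑ i, ybv n S i * G' i) * P =
      ∑ i, yv n S i * (F i - F' i * P) + ∑ i, ybv n S i * (G i - G' i * P) := fun F G F' G' => by
    simp only [mul_sub, sum_sub_distrib, add_mul, sum_mul, mul_assoc]
    ring
  rw [e, map_add, map_sum, map_sum, map_add, map_sum, map_sum]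
  exact (congrArg₂ (· + ·) (sum_eq_zero fun i _ => key (K.a i) (.inl i) (hσa i))
    (sum_eq_zero fun i _ => key (K.b i) (.inr i) (hσb i))).trans (add_zero _)

lemma flow_zero {T : Type*} [CommRing T] [Algebra ℂ T] (f : PowerSeries T) :
    flow (0 : Derivation ℂ T T) f = f := by
  have := flow_neg (0 : Derivation ℂ T T) f
  rw [neg_zero, ← flow_add (fun _ => rfl), add_zero] at this
  exact this

/-- The flow that reflects the integrand at the midpoint and exchanges the factors. -/
lemma flow_integrand_neg (Q : KahlerRing n S) {y yb : Fin n → S} (cy : ∀ i, Q.IsConst (y i))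
    (cyb : ∀ i, Q.IsConst (yb i)) (f g : PowerSeries S) :
    pexp (PowerSeries.C (Q.κ y yb) - flow (Q.A y + Q.B yb) (PowerSeries.C (Q.κ y yb))) *
      flow (Q.A y + Q.B yb) (Q.integrand (-y) (-yb) f g * PowerSeries.C Q.h.det) =
    Q.integrand y yb g f * PowerSeries.C Q.h.det := by
  have cAB := Q.A_B_comm cy cyb
  have fa : ∀ u, flow (Q.A y + Q.B yb) u = flow (Q.A y) (flow (Q.B yb) u) := flow_add cAB
  have fc : ∀ u, flow (Q.A y) (flow (Q.B yb) u) = flow (Q.B yb) (flow (Q.A y) u) := flow_comm cAB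
  -- Translation by `(y, ȳ)` takes `(z, z̄ - ȳ)` to `(z + y, z̄)` and `(z - y, z̄)` to `(z, z̄ +
  -- ȳ)`. This swaps the roles of `f` and `g`; the two determinants are swapped likewise.
  have h1 : ∀ u, flow (Q.A y + Q.B yb) (flow (Q.B (-yb)) u) = flow (Q.A y) u := fun u => by
    rw [fa, B_neg, flow_neg]
  have h2 : ∀ u, flow (Q.A y + Q.B yb) (flow (Q.A (-y)) u) = flow (Q.B yb) u := fun u => by
    rw [fa, fc, A_neg, flow_neg]
  have h3 : ∀ u, flow (Q.A y + Q.B yb) (flow (Q.A (-y)) (flow (Q.B (-yb)) u)) = u := fun u => by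
    rw [h2, B_neg, flow_neg]
  have h4 : ∀ u, flow (Q.A y + Q.B yb) (flowInt (Q.A (-y)) (flowInt (Q.B (-yb)) u)) =
      flowInt (Q.A y) (flowInt (Q.B yb) u) := fun u => by
    rw [fa, flow_flowInt_comm (D := Q.B yb) (D' := Q.A (-y)) (fun s => by
      rw [A_neg, Derivation.neg_apply, Derivation.neg_apply, map_neg, cAB]), B_neg, flow_flowInt_neg,
      A_neg, flow_flowInt_neg]
  have h5 : PowerSeries.C (Q.κ y yb) - flow (Q.A y + Q.B yb) (PowerSeries.C (Q.κ y yb)) +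
      flow (Q.A y + Q.B yb) (Q.tail (-y) (-yb)) = Q.tail y yb := by
    rw [tail, map_sub, κ_neg_neg, h4, tail]
    ring
  have h6 := congrArg pexp h5
  rw [pexp_add (by rw [map_sub, coeff_zero_flow, sub_self])
    (by rw [coeff_zero_flow, coeff_zero_tail])] at h6
  rw [integrand, integrand, map_mul, map_mul, map_mul, map_mul, h1, h2, h3,
    flow_pexp _ (Q.coeff_zero_tail _ _), fa (PowerSeries.C Q.h.det), ← h6]
  ring

/-- Integration by parts exchanges the factors of the product under the trace. -/
theorem trace_bul (K : KahlerRing n S) {J : Ideal S} (ha : ∀ i, ∀ s ∈ J, K.a i s ∈ J)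
    (hb : ∀ i, ∀ s ∈ J, K.b i s ∈ J) {σ : S →ₗ[ℂ] ℂ} (hσa : ∀ i, ∀ s ∈ J, σ (K.a i s) = 0)
    (hσb : ∀ i, ∀ s ∈ J, σ (K.b i s) = 0) {f : PowerSeries S}
    (hf : ∀ m, PowerSeries.coeff m f ∈ J) (g : PowerSeries S) :
    cw σ (K.bul f g * PowerSeries.C K.h.det) = cw σ (K.bul g f * PowerSeries.C K.h.det) := by
  have hcw : ∀ F : PowerSeries (MvPolynomial (Fin n ⊕ Fin n) S),
      cw σ (cw K.gaussL F) = cw (σ ∘ₗ K.gaussL) F := fun F => by ext m; simp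
  have hJ : ∀ P ∈ J.map (MvPolynomial.C (σ := Fin n ⊕ Fin n)),
      ((K.poly _).A (yv n S) + (K.poly _).B (ybv n S)) P ∈
        J.map (MvPolynomial.C (σ := Fin n ⊕ Fin n)) := fun P hP => by
    rw [Derivation.add_apply]
    exact add_mem (A_mem (fun i _ => coeffDer_mem (ha i)) _ hP)
      (B_mem (fun i _ => coeffDer_mem (hb i)) _ hP)
  have hmem : ∀ m, PowerSeries.coeff m ((K.poly _).integrand (-yv n S) (-ybv n S)
      (pmap (cHom _ S) f) (pmap (cHom _ S) g) * PowerSeries.C (K.poly _).h.det) ∈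
        J.map (MvPolynomial.C (σ := Fin n ⊕ Fin n)) :=
    coeff_mul_mem (coeff_integrand_mem (fun i _ => coeffDer_mem (hb i)) _ _ (fun k => by
      rw [coeff_pmap]; exact Ideal.mem_map_of_mem _ (hf k)) _) _
  -- The target derivation is `0` because `σ ∘ Γ` kills total derivatives. Translating the
  -- integrand, with the weight correction, thus leaves its image unchanged.
  have ht := transport (D := (K.poly _).A (yv n S) + (K.poly _).B (ybv n S))
    (D' := ((0 : Derivation ℂ ℂ ℂ) : ℂ →ₗ[ℂ] ℂ)) (L := σ ∘ₗ K.gaussL) hJ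
    (fun P hP => K.gaussL_A_B hσa hσb hP) hmem
  rw [← flow_apply, ← flow_apply, ← flow_apply, flow_zero, flow_integrand_neg (y := yv n S) (yb := ybv n S) _
    (fun i => K.poly_const_X _) (fun i => K.poly_const_X _)] at ht
  rw [bul_eq_neg, bul, cw_gaussL_mul, cw_gaussL_mul, pmap_C, (K.cHom_isHom _).det, hcw, hcw, ht]

lemma coeff_doubleExp_mem {J : Ideal S} {f : PowerSeries S} (hf : ∀ m, PowerSeries.coeff m f ∈ J)
    (m : ℕ) : PowerSeries.coeff m (doubleExp f) ∈ J := by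
  rw [doubleExp, PowerSeries.coeff_mk]
  split_ifs
  · exact hf _
  · exact J.zero_mem

lemma coeff_bullet_mem {K : KahlerRing n S} {J : Ideal S} (hb : ∀ i, ∀ s ∈ J, K.b i s ∈ J)
    {f : PowerSeries S} (hf : ∀ m, PowerSeries.coeff m f ∈ J) (g : PowerSeries S) (m : ℕ) :
    PowerSeries.coeff m (K.bullet f g) ∈ J := by
  rw [bullet, halfExp, PowerSeries.coeff_mk]
  exact coeff_bul_mem hb (coeff_doubleExp_mem hf) _ _

theorem trace_bullet (K : KahlerRing n S) {J : Ideal S} (ha : ∀ i, ∀ s ∈ J, K.a i s ∈ J)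
    (hb : ∀ i, ∀ s ∈ J, K.b i s ∈ J) {σ : S →ₗ[ℂ] ℂ} (hσa : ∀ i, ∀ s ∈ J, σ (K.a i s) = 0)
    (hσb : ∀ i, ∀ s ∈ J, σ (K.b i s) = 0) {f : PowerSeries S}
    (hf : ∀ m, PowerSeries.coeff m f ∈ J) (g : PowerSeries S) (m : ℕ) :
    σ (PowerSeries.coeff m (K.bullet f g) * K.h.det) =
      σ (PowerSeries.coeff m (K.bullet g f) * K.h.det) := by
  have h := congrArg (PowerSeries.coeff (2 * m))
    (K.trace_bul ha hb hσa hσb (coeff_doubleExp_mem hf) (doubleExp g))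
  simpa only [coeff_cw, PowerSeries.coeff_mul_C, bullet, halfExp, PowerSeries.coeff_mk] using h

end KahlerRing

end FormalKahler

namespace FormalKahler

open Finset

/-! ### Smooth functions -/

section SmoothFunctions

variable {n : ℕ}

lemma Smooth.contDiff (f : Smooth n) : ContDiff ℝ ∞ f.1 := f.2

lemma Smooth.differentiableAt (f : Smooth n) (z : Fin n → ℂ) : DifferentiableAt ℝ f.1 z :=
  f.contDiff.differentiable (by simp) z

lemma Smooth.continuous (f : Smooth n) : Continuous f.1 := f.contDiff.continuous

lemma halfDir_apply (u v : Fin n → ℂ) (c : ℂ) (f : Smooth n) (z : Fin n → ℂ) :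
    (halfDir u v c f).1 z = (fderiv ℝ f.1 z u + c * fderiv ℝ f.1 z v) / 2 := rfl

/-- `halfDir` as a derivation. -/
def halfDirDer (u v : Fin n → ℂ) (c : ℂ) : Derivation ℂ (Smooth n) (Smooth n) :=
  Derivation.mk' (halfDir u v c) fun f g => by
    ext z
    have h : fderiv ℝ (f * g : Smooth n).1 z = f.1 z • fderiv ℝ g.1 z + g.1 z • fderiv ℝ f.1 z :=
      fderiv_mul (f.differentiableAt z) (g.differentiableAt z)
    change (halfDir u v c (f * g)).1 z = f.1 z * (halfDir u v c g).1 z + g.1 z * (halfDir u v c f).1 z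
    simp only [halfDir_apply, h, add_apply, smul_apply, smul_eq_mul]
    ring

lemma fderiv_halfDir (u v w : Fin n → ℂ) (c : ℂ) (f : Smooth n) (z : Fin n → ℂ) :
    fderiv ℝ (halfDir u v c f).1 z w =
      (fderiv ℝ (fderiv ℝ f.1) z w u + c * fderiv ℝ (fderiv ℝ f.1) z w v) / 2 := by
  have hf : DifferentiableAt ℝ (fderiv ℝ f.1) z :=
    (f.contDiff.fderiv_right (m := ∞) (by simp)).differentiable (by simp) z
  have h1 : ∀ x : Fin n → ℂ, HasFDerivAt (fun z => fderiv ℝ f.1 z x)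
      ((fderiv ℝ (fderiv ℝ f.1) z).flip x) z := fun x => by
    have := hf.hasFDerivAt.clm_apply (hasFDerivAt_const x z)
    convert! this using 1
    ext y; simp
  have h2 : HasFDerivAt (halfDir u v c f).1 ((2⁻¹ : ℂ) • ((fderiv ℝ (fderiv ℝ f.1) z).flip u +
      c • (fderiv ℝ (fderiv ℝ f.1) z).flip v)) z := by
    have := (((h1 u).add ((h1 v).const_smul c)).const_smul (2⁻¹ : ℂ))
    convert! this using 1
    funext y
    rw [halfDir_apply]
    simp
    ring
  rw [h2.fderiv]
  simp
  ring

lemma halfDir_comm (u v u' v' : Fin n → ℂ) (c c' : ℂ) (f : Smooth n) :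
    halfDir u v c (halfDir u' v' c' f) = halfDir u' v' c' (halfDir u v c f) := by
  have hs : ∀ z, IsSymmSndFDerivAt ℝ f.1 z := fun z =>
    (f.contDiff.contDiffAt).isSymmSndFDerivAt (by
      rw [minSmoothness_of_isRCLikeNormedField]
      exact WithTop.coe_le_coe.2 (le_top : (2 : ℕ∞) ≤ ⊤))
  ext z
  rw [halfDir_apply, halfDir_apply, fderiv_halfDir, fderiv_halfDir, fderiv_halfDir, fderiv_halfDir,
    (hs z).eq u u', (hs z).eq u v', (hs z).eq v u', (hs z).eq v v']
  ring

/-- `∂_i` as a derivation. -/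
def dzDer (i : Fin n) : Derivation ℂ (Smooth n) (Smooth n) :=
  halfDirDer (Pi.single i 1) (Pi.single i Complex.I) (-Complex.I)

/-- `∂̄_i` as a derivation. -/
def dzbarDer (i : Fin n) : Derivation ℂ (Smooth n) (Smooth n) :=
  halfDirDer (Pi.single i 1) (Pi.single i Complex.I) Complex.I

lemma dzbar_apply_conj {f g : Smooth n} (h : ∀ z, g.1 z = (starRingEnd ℂ) (f.1 z)) (k : Fin n)
    (z : Fin n → ℂ) : (dzbar k g).1 z = (starRingEnd ℂ) ((dz k f).1 z) := by
  have hg : g.1 = fun z => Complex.conjCLE (f.1 z) := funext fun z => h z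
  have h1 : ∀ w, fderiv ℝ g.1 z w = (starRingEnd ℂ) (fderiv ℝ f.1 z w) := fun w => by
    have := ((Complex.conjCLE : ℂ →L[ℝ] ℂ).hasFDerivAt (x := f.1 z)).comp z
      (f.differentiableAt z).hasFDerivAt
    rw [hg]
    exact congrArg (fun L : (Fin n → ℂ) →L[ℝ] ℂ => L w) this.fderiv
  rw [dz, dzbar, halfDir_apply, halfDir_apply, h1, h1]
  simp [map_ofNat]

namespace KahlerMetric

lemma matAt_det (h : Matrix (Fin n) (Fin n) (Smooth n)) (z : Fin n → ℂ) :
    (matAt h z).det = h.det.1 z := by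
  rw [matAt_eq_map, ← RingHom.map_det]; rfl

lemma det_ne_zero (K : KahlerMetric n) (z : Fin n → ℂ) : K.h.det.1 z ≠ 0 := by
  rw [← matAt_det]
  exact (K.posDef z).det_pos.ne'

lemma conj_h (K : KahlerMetric n) (i j : Fin n) (z : Fin n → ℂ) :
    (starRingEnd ℂ) ((K.h i j).1 z) = (K.h j i).1 z :=
  congrFun (congrFun (K.posDef z).1 j) i

/-- The complex conjugate of `closed`: conjugation exchanges `∂` with `∂̄` and, the metric being
Hermitian, transposes `h`. -/
lemma closed_bar (K : KahlerMetric n) (i j k : Fin n) :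
    dzbar k (K.h i j) = dzbar j (K.h i k) := by
  ext z
  rw [dzbar_apply_conj (f := K.h j i) (fun z => (K.conj_h j i z).symm),
    dzbar_apply_conj (f := K.h k i) (fun z => (K.conj_h k i z).symm), K.closed]

/-- The reciprocal of `det H`. -/
def detInv (K : KahlerMetric n) : Smooth n :=
  ⟨fun z => (K.h.det.1 z)⁻¹, K.h.det.contDiff.inv K.det_ne_zero⟩

/-- Smooth functions on a Kähler manifold with global coordinates as a Kähler ring. -/
def ring (K : KahlerMetric n) : KahlerRing n (Smooth n) where
  a := dzDer
  b := dzbarDer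
  aa _ _ f := halfDir_comm _ _ _ _ _ _ f
  ab _ _ f := halfDir_comm _ _ _ _ _ _ f
  bb _ _ f := halfDir_comm _ _ _ _ _ _ f
  h := K.h
  closed_a := K.closed
  closed_b := K.closed_bar
  hi := K.hInv
  hi_mul i k := by
    ext z
    have h : IsUnit (matAt K.h z).det := (isUnit_iff_ne_zero.2 (K.posDef z).det_pos.ne')
    have := congrFun (congrFun (Matrix.mul_nonsing_inv (matAt K.h z) h) k) i
    rw [Matrix.mul_apply, Matrix.one_apply] at this
    rw [AddSubmonoidClass.coe_finsetSum, Finset.sum_apply]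
    refine (Finset.sum_congr rfl fun j _ => mul_comm _ _).trans (this.trans ?_)
    by_cases hik : i = k
    · subst hik; simp
    · simp [hik, Ne.symm hik]
  mul_hi j l := by
    ext z
    have h : IsUnit (matAt K.h z).det := (isUnit_iff_ne_zero.2 (K.posDef z).det_pos.ne')
    have := congrFun (congrFun (Matrix.nonsing_inv_mul (matAt K.h z) h) j) l
    rw [Matrix.mul_apply, Matrix.one_apply] at this
    rw [AddSubmonoidClass.coe_finsetSum, Finset.sum_apply]
    refine this.trans ?_
    by_cases hjl : j = l
    · subst hjl; simp
    · simp [hjl]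
  d := K.detInv
  d_mul := by
    ext z
    exact inv_mul_cancel₀ (K.det_ne_zero z)

end KahlerMetric

/-! ### Functions with compact support and their integrals. -/

/-- The ideal of the functions with compact support. -/
def compactIdeal (n : ℕ) : Ideal (Smooth n) where
  carrier := {f | HasCompactSupport f.1}
  add_mem' hf hg := HasCompactSupport.add hf hg
  zero_mem' := HasCompactSupport.zero
  smul_mem' _ _ hf := HasCompactSupport.mul_left hf

lemma mem_compactIdeal {f : Smooth n} : f ∈ compactIdeal n ↔ HasCompactSupport f.1 := Iff.rfl

lemma halfDir_mem (u v : Fin n → ℂ) (c : ℂ) {f : Smooth n} (hf : f ∈ compactIdeal n) :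
    halfDir u v c f ∈ compactIdeal n := by
  have h1 := (mem_compactIdeal.1 hf).fderiv (𝕜 := ℝ)
  refine h1.mono fun z hz => ?_
  contrapose! hz
  simp only [Function.mem_support, not_not] at hz ⊢
  rw [halfDir_apply, hz]
  simp

lemma integrable_of_mem {f : Smooth n} (hf : f ∈ compactIdeal n) : Integrable f.1 :=
  f.continuous.integrable_of_hasCompactSupport hf

lemma integral_fderiv_eq_zero {f : (Fin n → ℂ) → ℂ} (hd : Differentiable ℝ f) (hf : Integrable f)
    (v : Fin n → ℂ) (hf' : Integrable fun z => fderiv ℝ f z v) : ∫ z, fderiv ℝ f z v = 0 := by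
  -- Integration by parts against the constant function `1`.
  have := integral_mul_fderiv_eq_neg_fderiv_mul_of_integrable (μ := volume) (f := fun _ : Fin n → ℂ => (1 : ℂ))
    (g := f) (v := v) (by simp) (by simpa using hf') (by simpa using hf)
    (fun x _ => differentiableAt_const _) (fun x _ => hd x)
  simpa using this

lemma integral_halfDir (u v : Fin n → ℂ) (c : ℂ) {f : Smooth n} (hf : f ∈ compactIdeal n) :
    ∫ z, (halfDir u v c f).1 z = 0 := by
  have hc : ∀ w, Integrable fun z => fderiv ℝ f.1 z w := fun w =>
    (((f.contDiff.fderiv_right (m := ∞) (by simp)).clm_apply contDiff_const).continuous).integrable_of_hasCompactSupport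
      ((mem_compactIdeal.1 hf).fderiv_apply ℝ w)
  have h0 := fun w => integral_fderiv_eq_zero (fun z => f.differentiableAt z) (integrable_of_mem hf) w (hc w)
  simp only [halfDir_apply]
  rw [integral_div, integral_add (hc u) ((hc v).const_mul c), integral_const_mul, h0, h0]
  simp

/-- The integral of functions with compact support is the restriction of a linear functional. -/
lemma exists_integral_extension (n : ℕ) : ∃ σ : Smooth n →ₗ[ℂ] ℂ, ∀ f ∈ compactIdeal n,
    σ f = ∫ z, f.1 z := by
  let I : (compactIdeal n).restrictScalars ℂ →ₗ[ℂ] ℂ :=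
    { toFun := fun f => ∫ z, f.1.1 z
      map_add' := fun f g => integral_add (integrable_of_mem f.2) (integrable_of_mem g.2)
      map_smul' := fun c f => integral_const_mul c _ }
  -- An arbitrary algebraic extension is enough: `trace_bullet` wants a functional on the whole
  -- ring, but its values matter only on the ideal.
  obtain ⟨σ, hσ⟩ := I.exists_extend
  exact ⟨σ, fun f hf => LinearMap.congr_fun hσ ⟨f, hf⟩⟩

namespace KahlerMetric

lemma ring_a_apply (K : KahlerMetric n) (i : Fin n) (f : Smooth n) : K.ring.a i f = dz i f := rfl

lemma ring_b_apply (K : KahlerMetric n) (i : Fin n) (f : Smooth n) : K.ring.b i f = dzbar i f := rfl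

lemma ring_a_mem (K : KahlerMetric n) (i : Fin n) (f : Smooth n) (hf : f ∈ compactIdeal n) :
    K.ring.a i f ∈ compactIdeal n := by
  rw [ring_a_apply]; exact halfDir_mem _ _ _ hf

lemma ring_b_mem (K : KahlerMetric n) (i : Fin n) (f : Smooth n) (hf : f ∈ compactIdeal n) :
    K.ring.b i f ∈ compactIdeal n := by
  rw [ring_b_apply]; exact halfDir_mem _ _ _ hf

lemma coeff_bullet_mem (K : KahlerMetric n) {f : FormalSmooth n}
    (hf : CompactCoeffs f) (g : FormalSmooth n) (m : ℕ) :
    PowerSeries.coeff m (K.ring.bullet f g) ∈ compactIdeal n :=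
  KahlerRing.coeff_bullet_mem K.ring_b_mem (fun m => mem_compactIdeal.2 (hf m)) g m

/-- The trace property of the non-normalized product. -/
theorem integral_bullet_comm (K : KahlerMetric n) {f g : FormalSmooth n}
    (hf : CompactCoeffs f) (hg : CompactCoeffs g) (m : ℕ) :
    ∫ z, (PowerSeries.coeff m (K.ring.bullet f g)).1 z * K.h.det.1 z =
      ∫ z, (PowerSeries.coeff m (K.ring.bullet g f)).1 z * K.h.det.1 z := by
  obtain ⟨σ, hσ⟩ := exists_integral_extension n
  have ha : ∀ i, ∀ f ∈ compactIdeal n, σ (K.ring.a i f) = 0 := fun i f hf => by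
    rw [hσ _ (K.ring_a_mem i f hf), ring_a_apply, dz, integral_halfDir _ _ _ hf]
  have hb : ∀ i, ∀ f ∈ compactIdeal n, σ (K.ring.b i f) = 0 := fun i f hf => by
    rw [hσ _ (K.ring_b_mem i f hf), ring_b_apply, dzbar, integral_halfDir _ _ _ hf]
  have h := KahlerRing.trace_bullet K.ring (J := compactIdeal n) K.ring_a_mem K.ring_b_mem (σ := σ)
    ha hb (f := f) (fun m => mem_compactIdeal.2 (hf m)) g m
  rw [hσ _ ((compactIdeal n).mul_mem_right _ (K.coeff_bullet_mem hf g m)),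
    hσ _ ((compactIdeal n).mul_mem_right _ (K.coeff_bullet_mem hg f m))] at h
  exact h

end KahlerMetric

end SmoothFunctions

end FormalKahler

namespace FormalKahler

open Finset

/-! ### Gaussian integrals -/

section Gaussian

variable {n : ℕ}

/-- A Hermitian metric with constant coefficients, as a Kähler ring. -/
def constKahler (H : Matrix (Fin n) (Fin n) ℂ) (hH : H.det ≠ 0) : KahlerRing n ℂ where
  a _ := 0
  b _ := 0
  aa _ _ _ := rfl
  ab _ _ _ := rfl
  bb _ _ _ := rfl
  h := H
  closed_a _ _ _ := rfl
  closed_b _ _ _ := rfl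
  hi i j := H⁻¹ j i
  hi_mul i k := by
    have := congrFun (congrFun (Matrix.mul_nonsing_inv H (isUnit_iff_ne_zero.2 hH)) k) i
    rw [Matrix.mul_apply, Matrix.one_apply] at this
    simpa only [mul_comm, eq_comm] using this
  mul_hi j l := by
    have := congrFun (congrFun (Matrix.nonsing_inv_mul H (isUnit_iff_ne_zero.2 hH)) j) l
    rwa [Matrix.mul_apply, Matrix.one_apply] at this
  d := H.det⁻¹
  d_mul := inv_mul_cancel₀ hH

/-- The function `y ↦ P(y, ȳ)`. -/
def polyFun (P : YPoly n) (y : Fin n → ℂ) : ℂ :=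
  MvPolynomial.eval (Sum.elim y fun j => (starRingEnd ℂ) (y j)) P

@[simp] lemma polyFun_C (c : ℂ) (y : Fin n → ℂ) : polyFun (MvPolynomial.C c) y = c := by
  simp [polyFun]

@[simp] lemma polyFun_add (P Q : YPoly n) (y : Fin n → ℂ) :
    polyFun (P + Q) y = polyFun P y + polyFun Q y := by simp [polyFun]

@[simp] lemma polyFun_sub (P Q : YPoly n) (y : Fin n → ℂ) :
    polyFun (P - Q) y = polyFun P y - polyFun Q y := by simp [polyFun]

@[simp] lemma polyFun_mul (P Q : YPoly n) (y : Fin n → ℂ) :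
    polyFun (P * Q) y = polyFun P y * polyFun Q y := by simp [polyFun]

@[simp] lemma polyFun_inl (i : Fin n) (y : Fin n → ℂ) :
    polyFun (MvPolynomial.X (.inl i)) y = y i := by simp [polyFun]

@[simp] lemma polyFun_inr (i : Fin n) (y : Fin n → ℂ) :
    polyFun (MvPolynomial.X (.inr i)) y = (starRingEnd ℂ) (y i) := by simp [polyFun]

/-- The derivative in the direction `v`. -/
def dirDer (v : Fin n → ℂ) : Derivation ℂ (YPoly n) (YPoly n) :=
  MvPolynomial.mkDerivation ℂ (Sum.elim (fun i => MvPolynomial.C (v i))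
    fun i => MvPolynomial.C ((starRingEnd ℂ) (v i)))

lemma hasFDerivAt_polyFun (P : YPoly n) (y : Fin n → ℂ) :
    ∃ L : (Fin n → ℂ) →L[ℝ] ℂ, HasFDerivAt (polyFun P) L y ∧ ∀ v, L v = polyFun (dirDer v P) y := by
  induction P using MvPolynomial.induction_on with
  | C c => exact ⟨0, by
      convert! hasFDerivAt_const (𝕜 := ℝ) c y using 1
      ext; simp, fun v => by simp [polyFun]⟩
  | add P Q hP hQ =>
    obtain ⟨L, hL, hL'⟩ := hP
    obtain ⟨M, hM, hM'⟩ := hQ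
    refine ⟨L + M, ?_, fun v => by simp [hL', hM']⟩
    convert! hL.add hM using 1
    ext; simp
  | mul_X P u hP =>
    obtain ⟨L, hL, hL'⟩ := hP
    have hX : ∃ M : (Fin n → ℂ) →L[ℝ] ℂ, HasFDerivAt (polyFun (MvPolynomial.X u)) M y ∧
        ∀ v, M v = polyFun (dirDer v (MvPolynomial.X u)) y := by
      cases u with
      | inl i =>
        refine ⟨ContinuousLinearMap.proj i, ?_, fun v => by simp [dirDer]⟩
        convert! (ContinuousLinearMap.proj (R := ℝ) (φ := fun _ : Fin n => ℂ) i).hasFDerivAt using 1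
        ext; simp
      | inr i =>
        refine ⟨(Complex.conjCLE : ℂ →L[ℝ] ℂ).comp (ContinuousLinearMap.proj i), ?_, fun v => by simp [dirDer]⟩
        convert! ((Complex.conjCLE : ℂ →L[ℝ] ℂ).comp (ContinuousLinearMap.proj (R := ℝ) (φ := fun _ : Fin n => ℂ) i)).hasFDerivAt using 1
        ext; simp
    obtain ⟨M, hM, hM'⟩ := hX
    refine ⟨polyFun P y • M + polyFun (MvPolynomial.X u) y • L, ?_, fun v => ?_⟩
    · convert! hL.mul hM using 1
      ext; simp
    · rw [Derivation.leibniz]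
      simp [hL', hM']

lemma polyFun_bound (P : YPoly n) : ∃ C : ℝ, ∃ N : ℕ, 0 ≤ C ∧ ∀ y, ‖polyFun P y‖ ≤ C * (1 + ‖y‖) ^ N := by
  induction P using MvPolynomial.induction_on with
  | C c => exact ⟨‖c‖, 0, norm_nonneg _, fun y => by simp⟩
  | add P Q hP hQ =>
    obtain ⟨C, N, hC, h⟩ := hP
    obtain ⟨D, M, hD, h'⟩ := hQ
    refine ⟨C + D, N + M, add_nonneg hC hD, fun y => ?_⟩
    have h1 : (1 : ℝ) ≤ 1 + ‖y‖ := by linarith [norm_nonneg y]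
    rw [polyFun_add]
    refine (norm_add_le _ _).trans ((add_le_add (h y) (h' y)).trans ?_)
    rw [add_mul]
    gcongr <;> omega
  | mul_X P u hP =>
    obtain ⟨C, N, hC, h⟩ := hP
    refine ⟨C, N + 1, hC, fun y => ?_⟩
    have h2 : ‖polyFun (MvPolynomial.X u) y‖ ≤ 1 + ‖y‖ := by
      cases u with
      | inl i => rw [polyFun_inl]; linarith [norm_le_pi_norm y i]
      | inr i => rw [polyFun_inr, RCLike.norm_conj]; linarith [norm_le_pi_norm y i]
    rw [polyFun_mul, norm_mul, pow_succ, ← mul_assoc]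
    exact mul_le_mul (h y) h2 (norm_nonneg _) (by positivity)

open scoped MatrixOrder in
open scoped Matrix.Norms.L2Operator in
/-- A positive definite Hermitian form is a sum of squares of linear forms. -/
lemma exists_sum_sq {H : Matrix (Fin n) (Fin n) ℂ} (hH : H.PosDef) :
    ∃ B : Matrix (Fin n) (Fin n) ℂ, B.det ≠ 0 ∧ H.det = Complex.normSq B.det ∧
      ∀ y : Fin n → ℂ, ∑ i, ∑ j, H i j * y i * (starRingEnd ℂ) (y j) =
        ((∑ k, ‖B.mulVec y k‖ ^ 2 : ℝ) : ℂ) := by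
  -- The transpose appears because `∑ H_{ij} y_i ȳ_j` is the form `y* Hᵀ y`; a factorization `Hᵀ =
  -- B* B` turns it into `‖B y‖²`.
  obtain ⟨B, hB⟩ := CStarAlgebra.nonneg_iff_eq_star_mul_self.mp hH.transpose.posSemidef.nonneg
  have hd : H.det = Complex.normSq B.det := by
    rw [← Matrix.det_transpose, hB, Matrix.det_mul, Matrix.star_eq_conjTranspose, Matrix.det_conjTranspose,
      Complex.normSq_eq_conj_mul_self]
    rfl
  refine ⟨B, fun h => ?_, hd, fun y => ?_⟩
  · rw [h] at hd
    exact hH.det_pos.ne' (by simpa using hd)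
  · have h1 : ∀ i j, H i j = ∑ k, (starRingEnd ℂ) (B k j) * B k i := fun i j => by
      have := congrFun (congrFun hB j) i
      rw [Matrix.transpose_apply, Matrix.mul_apply] at this
      exact this
    have e : ∀ F : Fin n → Fin n → Fin n → ℂ,
        ∑ k, ∑ i, ∑ j, F k i j = ∑ j, ∑ i, ∑ k, F k i j := fun F => by
      rw [sum_comm, sum_congr rfl fun i _ => sum_comm (f := fun k j => F k i j), sum_comm]
    push_cast
    simp only [← Complex.conj_mul', Matrix.mulVec, dotProduct, map_sum, map_mul, h1, sum_mul, mul_sum]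
    rw [e]
    refine sum_congr rfl fun k _ => ?_
    rw [sum_comm]
    exact sum_congr rfl fun i _ => sum_congr rfl fun j _ => by ring

/-- The Gaussian weight. -/
def gaussWeight (H : Matrix (Fin n) (Fin n) ℂ) (y : Fin n → ℂ) : ℂ :=
  Complex.exp (-∑ i, ∑ j, H i j * y i * (starRingEnd ℂ) (y j))

/-- The exponent of the Gaussian weight as a polynomial. -/
def quadPoly (H : Matrix (Fin n) (Fin n) ℂ) : YPoly n :=
  ∑ i, ∑ j, MvPolynomial.C (H i j) * MvPolynomial.X (.inl i) * MvPolynomial.X (.inr j)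

lemma gaussWeight_eq (H : Matrix (Fin n) (Fin n) ℂ) (y : Fin n → ℂ) :
    gaussWeight H y = Complex.exp (-polyFun (quadPoly H) y) := by
  simp [gaussWeight, quadPoly, polyFun]

lemma hasFDerivAt_mul_gaussWeight (H : Matrix (Fin n) (Fin n) ℂ) (P : YPoly n) (y : Fin n → ℂ) :
    ∃ L : (Fin n → ℂ) →L[ℝ] ℂ, HasFDerivAt (fun y => polyFun P y * gaussWeight H y) L y ∧
      ∀ v, L v = polyFun (dirDer v P - dirDer v (quadPoly H) * P) y * gaussWeight H y := by
  obtain ⟨L, hL, hL'⟩ := hasFDerivAt_polyFun P y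
  obtain ⟨M, hM, hM'⟩ := hasFDerivAt_polyFun (quadPoly H) y
  refine ⟨_, hL.mul ((hM.neg.cexp).congr_of_eventuallyEq (Filter.Eventually.of_forall (gaussWeight_eq H))), fun v => ?_⟩
  simp [hL', hM', gaussWeight_eq]
  ring

lemma continuous_mul_gaussWeight (H : Matrix (Fin n) (Fin n) ℂ) (P : YPoly n) :
    Continuous fun y => polyFun P y * gaussWeight H y :=
  continuous_iff_continuousAt.2 fun y =>
    (hasFDerivAt_mul_gaussWeight H P y).choose_spec.1.continuousAt

/-- From `(1 + t)^M ≤ M! e^{1 + t}` and `1 + t - t² ≤ 2` for `t ≥ 0`. -/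
lemma one_add_pow_mul_exp_le (M : ℕ) {t : ℝ} (ht : 0 ≤ t) :
    (1 + t) ^ M * Real.exp (-t ^ 2) ≤ M.factorial * Real.exp 2 := by
  have h1 := Real.pow_div_factorial_le_exp (1 + t) (by linarith) M
  rw [div_le_iff₀ (by positivity)] at h1
  calc (1 + t) ^ M * Real.exp (-t ^ 2) ≤ Real.exp (1 + t) * M.factorial * Real.exp (-t ^ 2) := by gcongr
    _ = M.factorial * Real.exp (1 + t + -t ^ 2) := by
      rw [Real.exp_add (1 + t)]; ring
    _ ≤ M.factorial * Real.exp 2 := by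
      gcongr
      nlinarith [sq_nonneg (t - 1)]

lemma gaussWeight_bound {H : Matrix (Fin n) (Fin n) ℂ} (hH : H.PosDef) (M : ℕ) :
    ∃ C : ℝ, 0 ≤ C ∧ ∀ y, (1 + ‖y‖) ^ M * ‖gaussWeight H y‖ ≤ C := by
  obtain ⟨B, hB, -, hq⟩ := exists_sum_sq hH
  obtain ⟨K, hK0, hK⟩ : ∃ K : ℝ, 0 ≤ K ∧ ∀ y, ‖y‖ ≤ K * ‖B.mulVec y‖ := by
    refine ⟨‖LinearMap.toContinuousLinearMap (Matrix.toLin' B⁻¹)‖, norm_nonneg _, fun y => ?_⟩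
    have := (LinearMap.toContinuousLinearMap (Matrix.toLin' B⁻¹)).le_opNorm (B.mulVec y)
    simpa [Matrix.mulVec_mulVec, Matrix.nonsing_inv_mul B (isUnit_iff_ne_zero.2 hB)] using this
  refine ⟨(1 + K) ^ M * (M.factorial * Real.exp 2), by positivity, fun y => ?_⟩
  set t := ‖B.mulVec y‖
  have ht : 0 ≤ t := norm_nonneg _
  have h1 : ‖gaussWeight H y‖ ≤ Real.exp (-t ^ 2) := by
    rw [gaussWeight, hq, Complex.norm_exp, Complex.neg_re, Complex.ofReal_re]
    refine Real.exp_le_exp.2 (neg_le_neg ?_)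
    -- The norm is the maximum norm; for `n = 0` no index attains it.
    rcases isEmpty_or_nonempty (Fin n) with hn | hn
    · have : t = 0 := by simp [t, Subsingleton.elim (B.mulVec y) 0]
      simp [this]
    · obtain ⟨k, hk⟩ := Finite.exists_max fun k => ‖B.mulVec y k‖
      have : t ≤ ‖B.mulVec y k‖ := (pi_norm_le_iff_of_nonneg (norm_nonneg _)).2 hk
      calc t ^ 2 ≤ ‖B.mulVec y k‖ ^ 2 := by gcongr
        _ ≤ _ := single_le_sum (f := fun k => ‖B.mulVec y k‖ ^ 2) (fun _ _ => by positivity) (mem_univ k)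
  calc (1 + ‖y‖) ^ M * ‖gaussWeight H y‖ ≤ ((1 + K) * (1 + t)) ^ M * Real.exp (-t ^ 2) := by
        gcongr
        nlinarith [hK y]
    _ = (1 + K) ^ M * ((1 + t) ^ M * Real.exp (-t ^ 2)) := by rw [mul_pow]; ring
    _ ≤ _ := mul_le_mul_of_nonneg_left (one_add_pow_mul_exp_le M ht) (by positivity)

lemma integrable_mul_gaussWeight {H : Matrix (Fin n) (Fin n) ℂ} (hH : H.PosDef) (P : YPoly n) :
    Integrable fun y => polyFun P y * gaussWeight H y := by
  obtain ⟨C, N, hC, hP⟩ := polyFun_bound P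
  -- `N` absorbs the growth of the polynomial, and `2 * n + 1` exceeds the real dimension `2 * n`,
  -- so that `(1 + ‖y‖)^{-(2n + 1)}` is an integrable majorant.
  obtain ⟨D, hD, hW⟩ := gaussWeight_bound hH (N + (2 * n + 1))
  have hr : (Module.finrank ℝ (Fin n → ℂ) : ℝ) < (2 * n + 1 : ℕ) := by
    rw [Module.finrank_pi_fintype]
    simp
    linarith
  refine ((integrable_one_add_norm (μ := volume) hr).const_mul (C * D)).mono'
    (continuous_mul_gaussWeight H P).aestronglyMeasurable (Filter.Eventually.of_forall fun y => ?_)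
  have h1 : (0 : ℝ) < 1 + ‖y‖ := by positivity
  rw [Real.rpow_neg h1.le, Real.rpow_natCast, norm_mul, ← div_eq_mul_inv, le_div_iff₀ (by positivity)]
  calc ‖polyFun P y‖ * ‖gaussWeight H y‖ * (1 + ‖y‖) ^ (2 * n + 1)
      ≤ C * (1 + ‖y‖) ^ N * ‖gaussWeight H y‖ * (1 + ‖y‖) ^ (2 * n + 1) := by gcongr; exact hP y
    _ = C * ((1 + ‖y‖) ^ (N + (2 * n + 1)) * ‖gaussWeight H y‖) := by rw [pow_add]; ring
    _ ≤ C * D := by gcongr; exact hW y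

/-- The total mass of the Gaussian weight. -/
lemma integral_gaussWeight {H : Matrix (Fin n) (Fin n) ℂ} (hH : H.PosDef) :
    ∫ y, gaussWeight H y = (Real.pi : ℂ) ^ n * H.det⁻¹ := by
  obtain ⟨B, hB, hd, hq⟩ := exists_sum_sq hH
  have h1 : ∀ y, gaussWeight H y = ((∏ k, Real.exp (-1 * ‖B.mulVec y k‖ ^ 2) : ℝ) : ℂ) := fun y => by
    rw [gaussWeight, hq, ← Real.exp_sum, Complex.ofReal_exp]
    congr 1
    push_cast
    simp
  -- The real determinant of a complex linear map is the squared modulus of its complex determinant,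
  -- which here is `det H`.
  have h2 : LinearMap.det ((Matrix.toLin' B).restrictScalars ℝ) = Complex.normSq B.det := by
    rw [LinearMap.det_restrictScalars, LinearMap.det_toLin', Algebra.norm_complex_apply]
  have h3 : LinearMap.det ((Matrix.toLin' B).restrictScalars ℝ) ≠ 0 := by
    rw [h2]; simpa using hB
  have h4 : ∫ z : ℂ, Real.exp (-1 * ‖z‖ ^ 2) = Real.pi := by
    rw [GaussianFourier.integral_rexp_neg_mul_sq_norm one_pos]
    simp
  have hcont : Continuous ((Matrix.toLin' B).restrictScalars ℝ) := LinearMap.continuous_of_finiteDimensional _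
  have h5 : ∫ y, ∏ k, Real.exp (-1 * ‖B.mulVec y k‖ ^ 2) =
      (Complex.normSq B.det)⁻¹ * ∫ u : Fin n → ℂ, ∏ k, Real.exp (-1 * ‖u k‖ ^ 2) := by
    have hf : Continuous fun u : Fin n → ℂ => ∏ k, Real.exp (-1 * ‖u k‖ ^ 2) := by fun_prop
    have := integral_map (μ := volume) hcont.aemeasurable (f := fun u : Fin n → ℂ => ∏ k, Real.exp (-1 * ‖u k‖ ^ 2))
      hf.aestronglyMeasurable
    rw [Measure.map_linearMap_addHaar_eq_smul_addHaar volume h3, integral_smul_measure, h2,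
      ENNReal.toReal_ofReal (abs_nonneg _), abs_of_nonneg (inv_nonneg.2 (Complex.normSq_nonneg _))] at this
    exact this.symm
  simp only [h1]
  rw [integral_complex_ofReal, h5, integral_fintype_prod_volume_eq_pow (fun z : ℂ => Real.exp (-1 * ‖z‖ ^ 2)), h4, hd]
  push_cast
  rw [Fintype.card_fin, mul_comm]

lemma dirDer_single_one (i : Fin n) : dirDer (Pi.single i 1) =
    MvPolynomial.pderiv (R := ℂ) (.inl i) + MvPolynomial.pderiv (.inr i) :=
  MvPolynomial.derivation_ext fun u => by
    cases u <;> simp [dirDer, MvPolynomial.pderiv_X, Pi.single_apply, apply_ite MvPolynomial.C,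
      apply_ite (starRingEnd ℂ)]

lemma dirDer_single_I (i : Fin n) : dirDer (Pi.single i Complex.I) =
    Complex.I • (MvPolynomial.pderiv (R := ℂ) (.inl i) - MvPolynomial.pderiv (.inr i)) :=
  MvPolynomial.derivation_ext fun u => by
    rcases u with u | u <;> by_cases h : u = i <;>
      simp [dirDer, MvPolynomial.pderiv_X, Pi.single_apply, h, MvPolynomial.smul_eq_C_mul]

/-- The integral of polynomials against the Gaussian weight. -/
def gaussFunctional {H : Matrix (Fin n) (Fin n) ℂ} (hH : H.PosDef) : YPoly n →ₗ[ℂ] ℂ where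
  toFun P := ∫ y, polyFun P y * gaussWeight H y
  map_add' P Q := by
    simp only [polyFun_add, add_mul]
    exact integral_add (integrable_mul_gaussWeight hH P) (integrable_mul_gaussWeight hH Q)
  map_smul' c P := by
    simp only [MvPolynomial.smul_eq_C_mul, polyFun_mul, polyFun_C, mul_assoc]
    exact integral_const_mul c _

lemma gaussFunctional_dirDer {H : Matrix (Fin n) (Fin n) ℂ} (hH : H.PosDef) (v : Fin n → ℂ)
    (P : YPoly n) : gaussFunctional hH (dirDer v P - dirDer v (quadPoly H) * P) = 0 := by
  choose L hL hL' using hasFDerivAt_mul_gaussWeight H P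
  have h1 : ∀ y, fderiv ℝ (fun y => polyFun P y * gaussWeight H y) y v =
      polyFun (dirDer v P - dirDer v (quadPoly H) * P) y * gaussWeight H y := fun y => by
    rw [(hL y).fderiv, hL']
  have := integral_fderiv_eq_zero (fun y => (hL y).differentiableAt)
    (integrable_mul_gaussWeight hH P) v
    (by simp only [h1]; exact integrable_mul_gaussWeight hH _)
  simp only [h1] at this
  exact this

/-- Integration by parts in the two real directions of each coordinate gives the sum and the
difference of the identities for `∂/∂y_i` and `∂/∂ȳ_i`. -/
lemma gaussFunctional_pderiv {H : Matrix (Fin n) (Fin n) ℂ} (hH : H.PosDef) (u : Fin n ⊕ Fin n)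
    (P : YPoly n) : gaussFunctional hH (MvPolynomial.pderiv u P) =
      gaussFunctional hH (MvPolynomial.pderiv u (quadPoly H) * P) := by
  have key : ∀ i : Fin n, ∀ a b : YPoly n,
      a = MvPolynomial.pderiv (.inl i) P - MvPolynomial.pderiv (.inl i) (quadPoly H) * P →
      b = MvPolynomial.pderiv (.inr i) P - MvPolynomial.pderiv (.inr i) (quadPoly H) * P →
      gaussFunctional hH a = 0 ∧ gaussFunctional hH b = 0 := fun i a b ha hb => by
    have h1 := gaussFunctional_dirDer hH (Pi.single i 1) P
    have h2 := gaussFunctional_dirDer hH (Pi.single i Complex.I) P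
    rw [dirDer_single_one, Derivation.add_apply, Derivation.add_apply] at h1
    rw [dirDer_single_I, Derivation.smul_apply, Derivation.smul_apply, smul_mul_assoc, ← smul_sub,
      map_smul, smul_eq_mul, Derivation.sub_apply, Derivation.sub_apply] at h2
    replace h2 := (mul_eq_zero.1 h2).resolve_left Complex.I_ne_zero
    have e1 : gaussFunctional hH (a + b) = 0 := by
      rw [← h1, ha, hb]; congr 1; ring
    have e2 : gaussFunctional hH (a - b) = 0 := by
      rw [← h2, ha, hb]; congr 1; ring
    rw [map_add] at e1
    rw [map_sub] at e2
    exact ⟨by linear_combination (e1 + e2) / 2, by linear_combination (e1 - e2) / 2⟩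
  rw [← sub_eq_zero, ← map_sub]
  cases u with
  | inl i => exact (key i _ _ rfl rfl).1
  | inr i => exact (key i _ _ rfl rfl).2

/-- Gaussian integrals of polynomials are given by the Gaussian functional. -/
theorem gaussianIntegral_eq {H : Matrix (Fin n) (Fin n) ℂ} (hH : H.PosDef) (P : YPoly n) :
    gaussianIntegral H P = (constKahler H hH.det_pos.ne').gauss P := by
  have hκ : quadPoly H = ((constKahler H hH.det_pos.ne').poly _).κ (KahlerRing.yv n ℂ)
    (KahlerRing.ybv n ℂ) := rfl
  -- Integration by parts fixes the integral up to its total mass `π^n / det H`, whose factor `π^n`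
  -- cancels the prefactor of `gaussianIntegral`.
  have h := eq_wick_of_pderiv (constKahler H hH.det_pos.ne').cov_symm
    (constKahler H hH.det_pos.ne').cov_hess (Λ := gaussFunctional hH) (fun v P => by
      rw [← KahlerRing.pderiv_κ, ← hκ, gaussFunctional_pderiv]) P
  have h1 : gaussFunctional hH 1 = (Real.pi : ℂ) ^ n * H.det⁻¹ := by
    rw [← integral_gaussWeight hH]
    simp [gaussFunctional, polyFun]
  have h2 : gaussianIntegral H P = ((Real.pi : ℂ) ^ n)⁻¹ * gaussFunctional hH P := rfl
  have hpi : (Real.pi : ℂ) ^ n ≠ 0 := pow_ne_zero _ (by exact_mod_cast Real.pi_ne_zero)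
  rw [h2, h, h1, KahlerRing.gauss_apply, ← mul_assoc, ← mul_assoc, inv_mul_cancel₀ hpi, one_mul]
  rfl

end Gaussian

end FormalKahler

namespace FormalKahler

open Finset

/-! ### Taylor expansions as flows -/

section Taylor

variable {n : ℕ} {S V : Type*} [CommRing S] [Algebra ℂ S]

/-- `D_{j_1} ⋯ D_{j_q}` -/
def iterDer (D : Fin n → Derivation ℂ S S) {q : ℕ} (J : Fin q → Fin n) : Module.End ℂ S :=
  (List.ofFn fun k => ((D (J k) : S →ₗ[ℂ] S) : Module.End ℂ S)).prod

lemma sum_fin_cons {α M : Type*} [Fintype α] [AddCommMonoid M] (q : ℕ) (F : (Fin (q + 1) → α) → M) :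
    ∑ J, F J = ∑ a, ∑ J : Fin q → α, F (Fin.cons a J) := by
  rw [← Fintype.sum_prod_type']
  exact (Fintype.sum_equiv (Fin.consEquiv fun _ => α) _ _ fun _ => rfl).symm

lemma coeffDer_prod_X (D : Derivation ℂ S S) {ι : Type*} (s : Finset ι) (v : ι → V) :
    coeffDer V D (∏ k ∈ s, MvPolynomial.X (v k)) = 0 := by
  classical
  rw [derivation_prod]
  exact sum_eq_zero fun i _ => by rw [coeffDer_X, mul_zero]

lemma pow_mul_of_apply_eq_zero (D : Derivation ℂ S S) {M : S} (hM : D M = 0) (q : ℕ) (s : S) :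
    ((D : S →ₗ[ℂ] S) ^ q) (s * M) = ((D : S →ₗ[ℂ] S) ^ q) s * M := by
  induction q with
  | zero => simp
  | succ q ih =>
    rw [pow_succ', Module.End.mul_apply, ih, Module.End.mul_apply, Derivation.coeFn_coe,
      Derivation.leibniz, hM, smul_zero, zero_add, smul_eq_mul, mul_comm]

/-- The variables are constants for the coefficientwise derivations, so powers expand without
correction terms. Summing over tuples rather than multi-indices leaves `1 / q!` as the only factor,
as in `taylorBar` and `taylorHol`. -/
lemma pow_sum_X_smul_coeffDer (D : Fin n → Derivation ℂ S S) (v : Fin n → V) (q : ℕ) (s : S) :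
    (((∑ i, (MvPolynomial.X (v i) : MvPolynomial V S) • coeffDer V (D i) :
      Derivation ℂ (MvPolynomial V S) (MvPolynomial V S)) :
        MvPolynomial V S →ₗ[ℂ] MvPolynomial V S) ^ q) (MvPolynomial.C s) =
      ∑ J : Fin q → Fin n, MvPolynomial.C (iterDer D J s) * ∏ k, MvPolynomial.X (v (J k)) := by
  induction q with
  | zero => simp [iterDer]
  | succ q ih =>
    rw [pow_succ', Module.End.mul_apply, ih, map_sum, sum_fin_cons, sum_comm]
    refine sum_congr rfl fun J _ => ?_
    rw [Derivation.coeFn_coe, KahlerRing.derivation_sum_smul_apply]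
    refine sum_congr rfl fun i _ => ?_
    rw [Derivation.leibniz, coeffDer_prod_X, smul_zero, zero_add, coeffDer_C, Fin.prod_univ_succ,
      smul_eq_mul]
    simp only [Fin.cons_zero, Fin.cons_succ, iterDer, List.ofFn_succ, List.prod_cons,
      Module.End.mul_apply, Derivation.coeFn_coe]
    ring

namespace KahlerRing

variable (K : KahlerRing n S)

lemma pow_B_C (q : ℕ) (s : S) : (((K.poly _).B (ybv n S) : MvPolynomial (Fin n ⊕ Fin n) S →ₗ[ℂ]
    MvPolynomial (Fin n ⊕ Fin n) S) ^ q) (MvPolynomial.C s) =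
      ∑ J : Fin q → Fin n, MvPolynomial.C (iterDer K.b J s) * ∏ k, MvPolynomial.X (.inr (J k)) :=
  pow_sum_X_smul_coeffDer K.b _ q s

lemma pow_A_C (p : ℕ) (s : S) : (((K.poly _).A (yv n S) : MvPolynomial (Fin n ⊕ Fin n) S →ₗ[ℂ]
    MvPolynomial (Fin n ⊕ Fin n) S) ^ p) (MvPolynomial.C s) =
      ∑ I : Fin p → Fin n, MvPolynomial.C (iterDer K.a I s) * ∏ k, MvPolynomial.X (.inl (I k)) :=
  pow_sum_X_smul_coeffDer K.a _ p s

lemma A_prod_X {ι : Type*} (s : Finset ι) (v : ι → Fin n ⊕ Fin n) :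
    (K.poly _).A (yv n S) (∏ k ∈ s, MvPolynomial.X (v k)) = 0 := by
  rw [A_apply]
  exact sum_eq_zero fun i _ => (congrArg _ (coeffDer_prod_X _ _ _)).trans (mul_zero _)

lemma pow_A_pow_B_C (p q : ℕ) (s : S) :
    (((K.poly _).A (yv n S) : MvPolynomial (Fin n ⊕ Fin n) S →ₗ[ℂ]
      MvPolynomial (Fin n ⊕ Fin n) S) ^ p) ((((K.poly _).B (ybv n S) :
        MvPolynomial (Fin n ⊕ Fin n) S →ₗ[ℂ] MvPolynomial (Fin n ⊕ Fin n) S) ^ q) (MvPolynomial.C s)) =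
      ∑ I : Fin p → Fin n, ∑ J : Fin q → Fin n, MvPolynomial.C (iterDer K.a I (iterDer K.b J s)) *
        ((∏ k, MvPolynomial.X (.inl (I k))) * ∏ k, MvPolynomial.X (.inr (J k))) := by
  rw [pow_B_C, map_sum, sum_comm]
  refine sum_congr rfl fun J _ => ?_
  rw [pow_mul_of_apply_eq_zero _ (K.A_prod_X _ _), pow_A_C, sum_mul]
  exact sum_congr rfl fun I _ => mul_assoc _ _ _

end KahlerRing

lemma coeff_opS_opS (c c' : ℕ → ℂ) (D D' : Module.End ℂ S) (s : S) (m : ℕ) :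
    PowerSeries.coeff m (opS c D (opS c' D' (PowerSeries.C s))) =
      ∑ pq ∈ antidiagonal m, (c pq.1 * c' pq.2) • (D ^ pq.1) ((D' ^ pq.2) s) := by
  rw [coeff_opS]
  refine sum_congr rfl fun pq _ => ?_
  rw [coeff_opS_C, map_smul, smul_smul]

end Taylor

/-! ### Evaluation at a point: the concrete expansions are the abstract ones. -/

section Translation

variable {n : ℕ}

/-- The evaluation of smooth functions at a point. -/
def evalAt (z : Fin n → ℂ) : Smooth n →ₐ[ℂ] ℂ :=
  (Pi.evalAlgHom ℂ (fun _ : Fin n → ℂ => ℂ) z).comp (smoothFunctions n).val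

/-- The evaluation of the coefficients of a polynomial at a point. -/
abbrev evalPoly (z : Fin n → ℂ) : MvPolynomial (Fin n ⊕ Fin n) (Smooth n) →ₐ[ℂ] YPoly n :=
  KahlerRing.mapHom _ (evalAt z)

lemma evalPoly_C (z : Fin n → ℂ) (f : Smooth n) :
    evalPoly z (MvPolynomial.C f) = MvPolynomial.C (f.1 z) := by
  rw [KahlerRing.mapHom_apply, MvPolynomial.map_C]; rfl

lemma evalPoly_X (z : Fin n → ℂ) (u : Fin n ⊕ Fin n) :
    evalPoly z (MvPolynomial.X u) = MvPolynomial.X u := by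
  rw [KahlerRing.mapHom_apply, MvPolynomial.map_X]

namespace KahlerMetric

variable (K : KahlerMetric n) (z : Fin n → ℂ)

lemma iterDer_a {p : ℕ} (I : Fin p → Fin n) : iterDer K.ring.a I = dzs I := rfl

lemma iterDer_b {q : ℕ} (J : Fin q → Fin n) : iterDer K.ring.b J = dzbars J := rfl

lemma taylorBar_eq (F : Smooth n) : taylorBar F z =
    pmap (evalPoly z) (flow ((K.ring.poly _).B (KahlerRing.ybv n _))
      (PowerSeries.C (MvPolynomial.C F))) := by
  ext1 q
  rw [coeff_pmap, flow_apply, coeff_opS_C, KahlerRing.pow_B_C, map_smul, map_sum, taylorBar,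
    PowerSeries.coeff_mk, smul_sum]
  refine sum_congr rfl fun J _ => ?_
  rw [iterDer_b, ybarMon, MvPolynomial.smul_eq_C_mul]
  simp only [map_mul, map_prod, evalPoly_C, evalPoly_X]
  ring

lemma taylorHol_eq (F : Smooth n) : taylorHol F z =
    pmap (evalPoly z) (flow ((K.ring.poly _).A (KahlerRing.yv n _))
      (PowerSeries.C (MvPolynomial.C F))) := by
  ext1 p
  rw [coeff_pmap, flow_apply, coeff_opS_C, KahlerRing.pow_A_C, map_smul, map_sum, taylorHol,
    PowerSeries.coeff_mk, smul_sum]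
  refine sum_congr rfl fun I _ => ?_
  rw [iterDer_a, yMon, MvPolynomial.smul_eq_C_mul]
  simp only [map_mul, map_prod, evalPoly_C, evalPoly_X]
  ring

lemma evalPoly_pow_A_pow_B (p q : ℕ) (F : Smooth n) :
    evalPoly z ((((K.ring.poly _).A (KahlerRing.yv n _) : MvPolynomial (Fin n ⊕ Fin n) (Smooth n) →ₗ[ℂ]
      MvPolynomial (Fin n ⊕ Fin n) (Smooth n)) ^ p) ((((K.ring.poly _).B (KahlerRing.ybv n _) :
        MvPolynomial (Fin n ⊕ Fin n) (Smooth n) →ₗ[ℂ]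
          MvPolynomial (Fin n ⊕ Fin n) (Smooth n)) ^ q) (MvPolynomial.C F))) =
      ∑ I : Fin p → Fin n, ∑ J : Fin q → Fin n,
        MvPolynomial.C ((dzs I (dzbars J F)).1 z) * (yMon I * ybarMon J) := by
  rw [KahlerRing.pow_A_pow_B_C, map_sum]
  refine sum_congr rfl fun I _ => ?_
  rw [map_sum]
  refine sum_congr rfl fun J _ => ?_
  rw [map_mul, map_mul, map_prod, map_prod, evalPoly_C, iterDer_a, iterDer_b, yMon, ybarMon]
  simp only [evalPoly_X]

lemma taylor_eq (F : Smooth n) : taylor F z =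
    pmap (evalPoly z) (flow ((K.ring.poly _).A (KahlerRing.yv n _))
      (flow ((K.ring.poly _).B (KahlerRing.ybv n _)) (PowerSeries.C (MvPolynomial.C F)))) := by
  ext1 m
  rw [coeff_pmap, flow_apply, flow_apply, coeff_opS_opS, map_sum, taylor, PowerSeries.coeff_mk]
  refine sum_congr rfl fun pq _ => ?_
  rw [map_smul, evalPoly_pow_A_pow_B, smul_sum]
  refine sum_congr rfl fun I _ => ?_
  rw [smul_sum]
  refine sum_congr rfl fun J _ => ?_
  rw [MvPolynomial.smul_eq_C_mul, mul_inv]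
  simp only [map_mul]
  ring

lemma calabiTail_eq : K.calabiTail z = pmap (evalPoly z)
    ((K.ring.poly _).tail (KahlerRing.yv n _) (KahlerRing.ybv n _)) := by
  ext1 m
  rw [coeff_pmap, calabiTail, PowerSeries.coeff_mk]
  split_ifs with hm
  · rw [hm, KahlerRing.coeff_zero_tail, map_zero]
  rw [KahlerRing.tail, map_sub, PowerSeries.coeff_C, if_neg hm, zero_sub, map_neg, flowInt, flowInt, ph, ph,
    coeff_opS_opS, map_sum]
  congr 1
  refine sum_congr rfl fun pq _ => ?_
  rw [map_smul]
  -- Displacements are constants for `A`, and in `hX'` for `B`, so in the derivatives of `κ` only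
  -- the coefficients `h_{ij}` are differentiated.
  have hX : ∀ i j, (K.ring.poly (Fin n ⊕ Fin n)).A (KahlerRing.yv n (Smooth n))
      (KahlerRing.yv n (Smooth n) i * KahlerRing.ybv n (Smooth n) j) = 0 := fun i j => by
    rw [KahlerRing.A_apply]
    refine sum_eq_zero fun k _ => ?_
    simp only [KahlerRing.yv, KahlerRing.ybv]
    rw [Derivation.leibniz, (K.ring.poly_const_X _).1, (K.ring.poly_const_X _).1, smul_zero, smul_zero, add_zero, mul_zero]
  have hX' : ∀ i j, (K.ring.poly (Fin n ⊕ Fin n)).B (KahlerRing.ybv n (Smooth n))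
      (KahlerRing.yv n (Smooth n) i * KahlerRing.ybv n (Smooth n) j) = 0 := fun i j => by
    rw [KahlerRing.B_apply]
    refine sum_eq_zero fun k _ => ?_
    simp only [KahlerRing.yv, KahlerRing.ybv]
    rw [Derivation.leibniz, (K.ring.poly_const_X _).2, (K.ring.poly_const_X _).2, smul_zero, smul_zero, add_zero, mul_zero]
  have hκ : (K.ring.poly (Fin n ⊕ Fin n)).κ (KahlerRing.yv n (Smooth n)) (KahlerRing.ybv n (Smooth n)) =
      ∑ i, ∑ j, MvPolynomial.C (K.h i j) *
        (KahlerRing.yv n (Smooth n) i * KahlerRing.ybv n (Smooth n) j) :=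
    sum_congr rfl fun i _ => sum_congr rfl fun j _ => mul_assoc _ _ _
  rw [hκ]
  simp only [map_sum, pow_mul_of_apply_eq_zero _ (hX _ _), pow_mul_of_apply_eq_zero _ (hX' _ _), map_mul,
    evalPoly_pow_A_pow_B]
  -- The first index of each tuple is the one already carried by `κ`. This accounts for the tuples
  -- of length `p + 1` and `q + 1`, and the factorials are those of `ph`.
  rw [sum_fin_cons, smul_sum]
  refine sum_congr rfl fun i _ => ?_
  simp only [sum_fin_cons (pq.2)]
  rw [sum_comm, smul_sum]
  refine sum_congr rfl fun j _ => ?_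
  rw [sum_mul, smul_sum]
  refine sum_congr rfl fun I _ => ?_
  rw [sum_mul, smul_sum]
  refine sum_congr rfl fun J _ => ?_
  have e1 : evalPoly z (KahlerRing.yv n (Smooth n) i) = MvPolynomial.X (.inl i) := evalPoly_X z _
  have e2 : evalPoly z (KahlerRing.ybv n (Smooth n) j) = MvPolynomial.X (.inr j) := evalPoly_X z _
  have e3 : K.potDeriv (Fin.cons i I) (Fin.cons j J) = dzs I (dzbars J (K.h i j)) := rfl
  have e4 : yMon (Fin.cons i I) = MvPolynomial.X (.inl i) * yMon I := by
    rw [yMon, Fin.prod_univ_succ]; rfl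
  have e5 : ybarMon (Fin.cons j J) = MvPolynomial.X (.inr j) * ybarMon J := by
    rw [ybarMon, Fin.prod_univ_succ]; rfl
  rw [e1, e2, e3, e4, e5, MvPolynomial.smul_eq_C_mul, mul_inv]
  simp only [map_mul]
  ring

lemma formalExp_eq (V : PowerSeries (YPoly n)) : formalExp V = pexp V := by
  ext1 m
  rw [formalExp, pexp, PowerSeries.coeff_mk, PowerSeries.coeff_mk]
  simp only [MvPolynomial.smul_eq_C_mul]

theorem laplaceCoeff_eq (k : ℕ) (f g : Smooth n) : K.laplaceCoeff k f g z =
    (PowerSeries.coeff (2 * k) (K.ring.bul (PowerSeries.C f) (PowerSeries.C g))).1 z := by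
  have hi : ∀ i j, (evalAt z : Smooth n →+* ℂ) (K.ring.hi i j) =
      (constKahler (matAt K.h z) (K.posDef z).det_pos.ne').hi i j := fun i j => rfl
  have hd : (evalAt z : Smooth n →+* ℂ) K.ring.d =
      (constKahler (matAt K.h z) (K.posDef z).det_pos.ne').d :=
    congrArg Inv.inv (matAt_det K.h z).symm
  have e : taylorBar f z * taylorHol g z * formalExp (K.calabiTail z) * taylor K.h.det z =
      pmap (evalPoly z) ((K.ring.poly _).integrand (KahlerRing.yv n _) (KahlerRing.ybv n _)
        (pmap (KahlerRing.cHom _ _) (PowerSeries.C f)) (pmap (KahlerRing.cHom _ _) (PowerSeries.C g))) := by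
    rw [KahlerRing.integrand, map_mul, map_mul, map_mul, K.taylorBar_eq, K.taylorHol_eq, K.taylor_eq,
      formalExp_eq, calabiTail_eq, pmap_pexp, pmap_C, pmap_C, KahlerRing.poly_det]
    rfl
  rw [laplaceCoeff, gaussianIntegral_eq (K.posDef z), e, coeff_pmap, KahlerRing.bul, coeff_cw]
  exact KahlerRing.gauss_map hi hd _

end KahlerMetric

end Translation

end FormalKahler

namespace FormalKahler

open Finset

/-! ### The star product -/

section StarProduct

variable {n : ℕ}

namespace KahlerMetric

variable (K : KahlerMetric n)

theorem isBullet_bullet : K.IsBullet K.ring.bullet := fun f g m z => by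
  rw [K.ring.bullet_isDeformation.coeff_eq]
  simp only [AddSubmonoidClass.coe_finsetSum, Finset.sum_apply]
  refine sum_congr rfl fun kc _ => sum_congr rfl fun ab _ => ?_
  rw [laplaceCoeff_eq, KahlerRing.coeff_bullet_C]

/-- An element is a two-sided unit as soon as it is one for the constants. -/
lemma isUnitFor_iff {e : FormalSmooth n} (he : ∀ f, K.ring.bullet e f = f ∧ K.ring.bullet f e = f)
    (e' : FormalSmooth n) : IsUnitFor K.ring.bullet e' ↔ e' = e := by
  refine ⟨fun h => ?_, fun h f => h ▸ he _⟩
  -- The single equation `e' • 1 = 1` suffices, since right multiplication by `1` is injective.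
  have h1 := (h 1).1
  rw [map_one] at h1
  exact K.ring.bullet_isDeformation.bijective_right.1 (h1.trans (he 1).1.symm)

lemma isUnit_of_unit {e : FormalSmooth n} (he : ∀ f, K.ring.bullet e f = f) : IsUnit e := by
  rw [PowerSeries.isUnit_iff_constantCoeff, ← PowerSeries.coeff_zero_eq_constantCoeff_apply,
    K.ring.bullet_isDeformation.coeff_zero_unit he]
  exact isUnit_one

lemma scalar_eq (c : PowerSeries ℂ) : scalar n c = pmap (Algebra.ofId ℂ (Smooth n)) c := rfl

lemma bullet_scalar_left (c : PowerSeries ℂ) (f g : FormalSmooth n) :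
    K.ring.bullet (scalar n c * f) g = scalar n c * K.ring.bullet f g := by
  rw [scalar_eq]
  exact (K.ring.bullet_isDeformation.left g).pmap_ofId_mul
    (fun a s => K.ring.bullet_smul_left a s g) c f

lemma bullet_scalar_right (c : PowerSeries ℂ) (f g : FormalSmooth n) :
    K.ring.bullet f (scalar n c * g) = scalar n c * K.ring.bullet f g := by
  rw [scalar_eq]
  exact (K.ring.bullet_isDeformation.right f).pmap_ofId_mul
    (fun a s => K.ring.bullet_smul_right a f s) c g

end KahlerMetric

lemma mul_normalized (B : FormalSmooth n → FormalSmooth n → FormalSmooth n) {e : FormalSmooth n}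
    (he : IsUnit e) (f g : FormalSmooth n) : e * normalized B e f g = B (f * e) (g * e) := by
  rw [normalized, ← mul_assoc, Ring.mul_inverse_cancel e he, one_mul]

lemma CompactCoeffs.mul {f : FormalSmooth n} (hf : CompactCoeffs f) (g : FormalSmooth n) :
    CompactCoeffs (f * g) := fun m =>
  mem_compactIdeal.1 (KahlerRing.coeff_mul_mem (J := compactIdeal n)
    (fun k => mem_compactIdeal.2 (hf k)) g m)

lemma CompactCoeffs.mul_left {f : FormalSmooth n} (hf : CompactCoeffs f) (g : FormalSmooth n) :
    CompactCoeffs (g * f) := mul_comm f g ▸ hf.mul g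

namespace KahlerMetric

variable (K : KahlerMetric n)

lemma integrable_coeff_mul_det {f : FormalSmooth n} (hf : CompactCoeffs f) (m : ℕ) :
    Integrable fun z => (PowerSeries.coeff m f).1 z * K.h.det.1 z :=
  integrable_of_mem (f := PowerSeries.coeff m f * K.h.det)
    ((compactIdeal n).mul_mem_right _ (mem_compactIdeal.2 (hf m)))

/-- The power series of the integrals of the coefficients against `det H`. -/
def integralSeries (f : FormalSmooth n) : PowerSeries ℂ :=
  PowerSeries.mk fun m => ((Real.pi : ℂ) ^ n)⁻¹ * ∫ z : Fin n → ℂ,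
    (PowerSeries.coeff m f).1 z * K.h.det.1 z

lemma tr_eq (e f : FormalSmooth n) : K.tr e f = HahnSeries.single (-(n : ℤ)) 1 *
    HahnSeries.ofPowerSeries ℤ ℂ (K.integralSeries (e * f)) := rfl

lemma integralSeries_add {f g : FormalSmooth n} (hf : CompactCoeffs f) (hg : CompactCoeffs g) :
    K.integralSeries (f + g) = K.integralSeries f + K.integralSeries g := by
  ext m
  simp only [integralSeries, PowerSeries.coeff_mk, map_add]
  rw [← mul_add, ← integral_add (K.integrable_coeff_mul_det hf m) (K.integrable_coeff_mul_det hg m)]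
  congr 2
  funext z
  exact add_mul _ _ _

lemma integralSeries_scalar_mul (c : PowerSeries ℂ) {f : FormalSmooth n} (hf : CompactCoeffs f) :
    K.integralSeries (scalar n c * f) = c * K.integralSeries f := by
  ext m
  rw [PowerSeries.coeff_mul]
  simp only [integralSeries, PowerSeries.coeff_mk]
  have h : ∀ z, (PowerSeries.coeff m (scalar n c * f)).1 z * K.h.det.1 z =
      ∑ p ∈ antidiagonal m, PowerSeries.coeff p.1 c *
        ((PowerSeries.coeff p.2 f).1 z * K.h.det.1 z) := fun z => by
    rw [PowerSeries.coeff_mul, AddSubmonoidClass.coe_finsetSum, Finset.sum_apply, sum_mul]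
    refine sum_congr rfl fun p _ => ?_
    rw [scalar, PowerSeries.coeff_map, ← mul_assoc]
    rfl
  simp only [h]
  rw [integral_finsetSum _ fun p _ => (K.integrable_coeff_mul_det hf p.2).const_mul _, mul_sum]
  refine sum_congr rfl fun p _ => ?_
  rw [integral_const_mul]
  ring

lemma coeff_normalized {e : FormalSmooth n} (he : ∀ f, K.ring.bullet e f = f ∧ K.ring.bullet f e = f)
    (f g : FormalSmooth n) :
    PowerSeries.coeff 0 (normalized K.ring.bullet e f g) =
      PowerSeries.coeff 0 f * PowerSeries.coeff 0 g ∧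
    PowerSeries.coeff 1 (normalized K.ring.bullet e f g) =
      PowerSeries.coeff 0 f * PowerSeries.coeff 1 g + PowerSeries.coeff 1 f * PowerSeries.coeff 0 g +
        ∑ i, ∑ j, K.hInv i j * dzbar j (PowerSeries.coeff 0 f) * dz i (PowerSeries.coeff 0 g) := by
  obtain ⟨w, a, b, ha, hb, h⟩ := K.ring.coeff_one_bullet
  exact K.ring.bullet_isDeformation.coeff_one_normalized he ha hb
    (M := fun f g => ∑ i, ∑ j, K.ring.hi i j * K.ring.b j f * K.ring.a i g)
    (fun f => by simp) (fun f => by simp) h (mul_normalized _ (K.isUnit_of_unit fun f => (he f).1) f g)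

lemma normalized_expansion {e : FormalSmooth n}
    (he : ∀ f, K.ring.bullet e f = f ∧ K.ring.bullet f e = f) (f g : FormalSmooth n) :
    PowerSeries.X ^ 2 ∣ normalized K.ring.bullet e f g - (f * g + PowerSeries.X *
      ∑ i, ∑ j, PowerSeries.C (K.hInv i j) * coeffwise (dzbar j) f * coeffwise (dz i) g) := by
  obtain ⟨h0, h1⟩ := K.coeff_normalized he f g
  rw [PowerSeries.X_pow_dvd_iff]
  intro m hm
  rw [map_sub, sub_eq_zero]
  obtain rfl | rfl : m = 0 ∨ m = 1 := by omega
  · rw [h0]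
    simp
  · have hX : ∀ u : FormalSmooth n, PowerSeries.coeff 1 (PowerSeries.X * u) = PowerSeries.coeff 0 u :=
      fun u => PowerSeries.coeff_succ_X_mul 0 u
    rw [h1, map_add, hX, PowerSeries.coeff_mul, map_sum]
    congr 1
    · simp [Nat.antidiagonal_succ]
    · refine sum_congr rfl fun i _ => ?_
      rw [map_sum]
      refine sum_congr rfl fun j _ => ?_
      rw [KahlerRing.coeff_zero_mul', KahlerRing.coeff_zero_mul', PowerSeries.coeff_C, if_pos rfl,
        coeffwise, coeffwise, PowerSeries.coeff_mk, PowerSeries.coeff_mk]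

/-- Multiplication by the invertible `e` carries the normalized product to `•`, so associativity is
inherited. -/
lemma normalized_assoc {e : FormalSmooth n} (he : IsUnit e) (f g h : FormalSmooth n) :
    normalized K.ring.bullet e (normalized K.ring.bullet e f g) h =
      normalized K.ring.bullet e f (normalized K.ring.bullet e g h) := by
  rw [normalized, normalized.eq_def _ _ f (normalized _ _ g h), mul_comm _ e, mul_normalized _ he,
    mul_comm (normalized _ _ g h) e, mul_normalized _ he, K.ring.bullet_isDeformation.assoc]

lemma compactCoeffs_normalized {e : FormalSmooth n} {f : FormalSmooth n} (hf : CompactCoeffs f)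
    (g : FormalSmooth n) : CompactCoeffs (normalized K.ring.bullet e f g) :=
  CompactCoeffs.mul_left (fun m => mem_compactIdeal.1 (K.coeff_bullet_mem (hf.mul e) (g * e) m)) _

/-- The factor `e` in the trace cancels the inverse in the product: what is integrated is `(f e) •
(g e)` against `det H`, to which `integral_bullet_comm` applies. -/
lemma tr_normalized_comm {e : FormalSmooth n} (he : IsUnit e) {f g : FormalSmooth n}
    (hf : CompactCoeffs f) (hg : CompactCoeffs g) :
    K.tr e (normalized K.ring.bullet e f g) = K.tr e (normalized K.ring.bullet e g f) := by
  have h : K.integralSeries (K.ring.bullet (f * e) (g * e)) =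
      K.integralSeries (K.ring.bullet (g * e) (f * e)) := by
    ext m
    simp only [integralSeries, PowerSeries.coeff_mk]
    rw [K.integral_bullet_comm (hf.mul e) (hg.mul e)]
  rw [tr_eq, tr_eq, mul_normalized _ he, mul_normalized _ he, h]

end KahlerMetric

end StarProduct

end FormalKahler

end

/-! ### The proposition. -/

theorem proposition4p3 (n : ℕ) (K : FormalKahler.KahlerMetric n) :
    ∃ (B : FormalKahler.FormalSmooth n → FormalKahler.FormalSmooth n →
        FormalKahler.FormalSmooth n) (e : FormalKahler.FormalSmooth n)
      (st : FormalKahler.FormalSmooth n → FormalKahler.FormalSmooth n →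
        FormalKahler.FormalSmooth n),
      -- `B` is the product `•`, `e` its unique unit, and `st` the normalized product `⋆`
      K.IsBullet B ∧
      (∀ e', FormalKahler.IsUnitFor B e' ↔ e' = e) ∧
      IsUnit e ∧
      st = FormalKahler.normalized B e ∧
      -- `⋆` is `ℂ[[ħ]]`-bilinear, associative, with unit `1`
      (∀ f₁ f₂ g, st (f₁ + f₂) g = st f₁ g + st f₂ g) ∧
      (∀ f g₁ g₂, st f (g₁ + g₂) = st f g₁ + st f g₂) ∧
      (∀ c f g, st (FormalKahler.scalar n c * f) g = FormalKahler.scalar n c * st f g) ∧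
      (∀ c f g, st f (FormalKahler.scalar n c * g) = FormalKahler.scalar n c * st f g) ∧
      (∀ f₁ f₂ f₃, st (st f₁ f₂) f₃ = st f₁ (st f₂ f₃)) ∧
      (∀ f, st 1 f = f ∧ st f 1 = f) ∧
      -- the expansion up to `O(ħ²)`
      (∀ f₁ f₂, PowerSeries.X ^ 2 ∣ st f₁ f₂ - (f₁ * f₂ + PowerSeries.X *
        ∑ i, ∑ j, PowerSeries.C (K.hInv i j) *
          FormalKahler.coeffwise (FormalKahler.dzbar j) f₁ *
          FormalKahler.coeffwise (FormalKahler.dz i) f₂)) ∧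
      -- `tr` is a `ℂ[[ħ]]`-linear functional on `𝒜_c[[ħ]]`
      (∀ f g, FormalKahler.CompactCoeffs f → FormalKahler.CompactCoeffs g →
        K.tr e (f + g) = K.tr e f + K.tr e g) ∧
      (∀ (c : PowerSeries ℂ) f, FormalKahler.CompactCoeffs f →
        K.tr e (FormalKahler.scalar n c * f) =
          HahnSeries.ofPowerSeries ℤ ℂ c * K.tr e f) ∧
      -- `𝒜_c[[ħ]]` is closed under `⋆`, and `tr` is cyclic
      (∀ f₁ f₂, FormalKahler.CompactCoeffs f₁ → FormalKahler.CompactCoeffs f₂ →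
        FormalKahler.CompactCoeffs (st f₁ f₂) ∧
        K.tr e (st f₁ f₂) = K.tr e (st f₂ f₁)) := by
  obtain ⟨e, he⟩ := K.ring.bullet_isDeformation.exists_unit
  have hu : IsUnit e := K.isUnit_of_unit fun f => (he f).1
  have hl := K.ring.bullet_isDeformation.left
  have hr := K.ring.bullet_isDeformation.right
  refine ⟨K.ring.bullet, e, FormalKahler.normalized K.ring.bullet e, K.isBullet_bullet,
    K.isUnitFor_iff he, hu, rfl, fun f₁ f₂ g => ?_, fun f g₁ g₂ => ?_, fun c f g => ?_, fun c f g => ?_,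
    K.normalized_assoc hu, fun f => ⟨?_, ?_⟩, K.normalized_expansion he, fun f g hf hg => ?_,
    fun c f hf => ?_, fun f g hf hg =>
      ⟨K.compactCoeffs_normalized hf g, K.tr_normalized_comm hu hf hg⟩⟩
  · rw [FormalKahler.normalized, add_mul, (hl _).add, mul_add]; rfl
  · rw [FormalKahler.normalized, add_mul, (hr _).add, mul_add]; rfl
  · rw [FormalKahler.normalized, mul_assoc, K.bullet_scalar_left, mul_left_comm]; rfl
  · rw [FormalKahler.normalized, mul_assoc, K.bullet_scalar_right, mul_left_comm]; rfl
  · rw [FormalKahler.normalized, one_mul, (he _).1, mul_comm f, ← mul_assoc,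
      Ring.inverse_mul_cancel e hu, one_mul]
  · rw [FormalKahler.normalized, one_mul, (he _).2, mul_comm f, ← mul_assoc,
      Ring.inverse_mul_cancel e hu, one_mul]
  · rw [FormalKahler.KahlerMetric.tr_eq, mul_add, K.integralSeries_add (hf.mul_left e) (hg.mul_left e),
      map_add, mul_add]
    rfl
  · rw [FormalKahler.KahlerMetric.tr_eq, mul_left_comm, K.integralSeries_scalar_mul c (hf.mul_left e),
      map_mul, mul_left_comm]
    rfl
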